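/- All vector spaces are over $\mathbb{K}=\mathbb{R}$ or $\mathbb{C}$. A complete convex bornological algebra is an associative (not necessarily unital) algebra $A$ with a vector space bornology such that the multiplication $A\times A\to A$ is bounded and every bounded subset is contained in a bounded complete disk, that is, a bounded absolutely convex set $T=\bigcap_{t>1}tT$ whose linear span $A_T$, normed by the gauge of $T$, is a Banach space. The spectral radius $\rho(S;A)\in[0,\infty]$ of a bounded subset $S\subseteq A$ is the infimum of all $r>0$ such that $\bigcup_{n\ge1}(r^{-1}S)^n$ is bounded; $A$ is locally multiplicative if $\rho(S;A)<\infty$ for all bounded $S\subseteq A$. A set $S$ is circled if $\lambda S\subseteq S$ for all $|\lambda|\le1$ and $S=\bigcap_{t>1}tS$. A sequence $(x_n)$ is $T$-convergent to $x$ if $x_n\in T$ for all $n$, $x\in T$ and $x_n-x\in\epsilon_nT$ for some null sequence of positive scalars $\epsilon_n$. A subset $X$ of a bornological vector space $V$ is locally dense if for every circled bounded $S\subseteq V$ there is a circled bounded $T\subseteq V$ such that every $v\in S$ is the limit of a $T$-convergent sequence with entries in $X\cap T$. A bounded algebra homomorphism $f\colon A\to B$ between locally multiplicative complete convex bornological algebras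 is isoradial if $f(A)$ is locally dense in $B$ and $\rho(S;A)=\rho(f(S);B)$ for all bounded $S\subseteq A$. A complete convex bornological vector space $C$ is nuclear if every bounded complete disk $S\subseteq C$ is contained in a bounded complete disk $T\subseteq C$ for which the inclusion of Banach spaces $C_S\to C_T$ is a nuclear operator. The complete projective bornological tensor product $\hat\otimes$ is the universal complete convex bornological vector space for bounded bilinear maps into complete convex bornological vector spaces; for algebras $A$ and $C$, $A\mathbin{\hat\otimes}C$ is a complete convex bornological algebra with $(a\otimes c)(a'\otimes c')=aa'\otimes cc'$. Theorem. Let $A$, $B$ and $C$ be locally multiplicative complete convex bornological algebras, and suppose that $C$ is nuclear. Let $f\colon A\to B$ be an isoradial homomorphism. Then $A\mathbin{\hat\otimes}C$ and $B\mathbin{\hat\otimes}C$ are locally multiplicative and the induced homomorphism $f\mathbin{\hat\otimes}\mathrm{id}_C\colon A\mathbin{\hat\otimes}C\to B\mathbin{\hat\otimes}C$ is isoradial. -/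

import Mathlib

open Bornology Filter Topology
open scoped Pointwise ENNReal

namespace BornAlg

set_option linter.unusedSectionVars false

noncomputable section

section Basic

/-! ### Bornological vector spaces -/

/-- A disk: an absolutely convex set `S` (containing zero) such that `S = ⋂_{t > 1} t S`. -/
structure IsDisk (𝕜 : Type*) [RCLike 𝕜] {V : Type*} [AddCommGroup V] [Module 𝕜 V]
    (S : Set V) : Prop where
  zero_mem : (0 : V) ∈ S
  absConvex : ∀ ⦃x : V⦄, x ∈ S → ∀ ⦃y : V⦄, y ∈ S → ∀ a b : 𝕜, ‖a‖ + ‖b‖ ≤ 1 → a • x + b • y ∈ S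
  closed : ∀ x : V, (∀ t : ℝ, 1 < t → x ∈ (t : 𝕜) • S) → x ∈ S

/-- A circled set: `c S ⊆ S` for all scalars with `|c| ≤ 1`, and `S = ⋂_{t > 1} t S`. -/
structure IsCircled (𝕜 : Type*) [RCLike 𝕜] {V : Type*} [AddCommGroup V] [Module 𝕜 V]
    (S : Set V) : Prop where
  smul_mem : ∀ c : 𝕜, ‖c‖ ≤ 1 → ∀ x ∈ S, c • x ∈ S
  closed : ∀ x : V, (∀ t : ℝ, 1 < t → x ∈ (t : 𝕜) • S) → x ∈ S

/-- A complete disk: the linear span `V_T` of `T`, with the gauge seminorm whose closed unit ball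
is `T`, is a Banach space.  The field `eq_zero` says that this seminorm is a norm, the field
`complete` says that Cauchy sequences converge. -/
structure IsCompleteDisk (𝕜 : Type*) [RCLike 𝕜] {V : Type*} [AddCommGroup V] [Module 𝕜 V]
    (T : Set V) : Prop extends IsDisk 𝕜 T where
  eq_zero : ∀ x : V, (∀ ε : ℝ, 0 < ε → x ∈ (ε : 𝕜) • T) → x = 0
  complete : ∀ x : ℕ → V, (∀ n, x n ∈ Submodule.span 𝕜 T) →
    (∀ ε : ℝ, 0 < ε → ∃ N, ∀ m ≥ N, ∀ n ≥ N, x m - x n ∈ (ε : 𝕜) • T) →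
    ∃ l ∈ Submodule.span 𝕜 T, ∀ ε : ℝ, 0 < ε → ∃ N, ∀ n ≥ N, x n - l ∈ (ε : 𝕜) • T

/-- A bornological vector space: addition and scalar multiplication are bounded maps. -/
class BornologicalVectorSpace (𝕜 : Type*) [RCLike 𝕜] (V : Type*) [AddCommGroup V] [Module 𝕜 V]
    [Bornology V] : Prop extends BoundedAdd V where
  isBounded_smul : ∀ (r : ℝ) {S : Set V}, IsBounded S →
    IsBounded {y : V | ∃ c : 𝕜, ‖c‖ ≤ r ∧ ∃ x ∈ S, c • x = y}

/-- A complete convex bornological vector space: each bounded subset is contained in a complete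
bounded disk. -/
class CompleteConvexSpace (𝕜 : Type*) [RCLike 𝕜] (V : Type*) [AddCommGroup V] [Module 𝕜 V]
    [Bornology V] : Prop extends BornologicalVectorSpace 𝕜 V where
  exists_completeDisk : ∀ S : Set V, IsBounded S →
    ∃ T : Set V, S ⊆ T ∧ IsBounded T ∧ IsCompleteDisk 𝕜 T

/-- A complete convex bornological algebra, not necessarily unital: the multiplication is a
bounded bilinear map. -/
class CompleteConvexAlgebra (𝕜 : Type*) [RCLike 𝕜] (A : Type*) [NonUnitalRing A] [Module 𝕜 A]
    [IsScalarTower 𝕜 A A] [SMulCommClass 𝕜 A A] [Bornology A] : Prop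
    extends CompleteConvexSpace 𝕜 A, BoundedMul A

/-- A map is bounded if it maps bounded subsets to bounded subsets. -/
def BoundedMap {V W : Type*} [Bornology V] [Bornology W] (f : V → W) : Prop :=
  ∀ S : Set V, IsBounded S → IsBounded (f '' S)

/-- The sequence `x` is `S`-convergent to `l`. -/
def SetConverges (𝕜 : Type*) [RCLike 𝕜] {V : Type*} [AddCommGroup V] [Module 𝕜 V]
    (S : Set V) (x : ℕ → V) (l : V) : Prop :=
  (∀ n, x n ∈ S) ∧ l ∈ S ∧ ∃ ε : ℕ → ℝ, (∀ n, 0 < ε n) ∧ Tendsto ε atTop (𝓝 0) ∧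
    ∀ n, x n - l ∈ (ε n : 𝕜) • S

/-- Bornological convergence of sequences. -/
def BornConverges (𝕜 : Type*) [RCLike 𝕜] {V : Type*} [AddCommGroup V] [Module 𝕜 V]
    [Bornology V] (x : ℕ → V) (l : V) : Prop :=
  ∃ S : Set V, IsBounded S ∧ IsCircled 𝕜 S ∧ SetConverges 𝕜 S x l

/-- Bornologically closed subsets. -/
def IsBornClosed (𝕜 : Type*) [RCLike 𝕜] {V : Type*} [AddCommGroup V] [Module 𝕜 V]
    [Bornology V] (X : Set V) : Prop :=
  ∀ (x : ℕ → V) (l : V), (∀ n, x n ∈ X) → BornConverges 𝕜 x l → l ∈ X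

/-- A subset `X` is locally dense if for any circled bounded `S` there is a circled bounded `T`
such that any point of `S` is the limit of a `T`-convergent sequence with entries in `X ∩ T`. -/
def IsLocallyDense (𝕜 : Type*) [RCLike 𝕜] {V : Type*} [AddCommGroup V] [Module 𝕜 V]
    [Bornology V] (X : Set V) : Prop :=
  ∀ S : Set V, IsBounded S → IsCircled 𝕜 S → ∃ T : Set V, IsBounded T ∧ IsCircled 𝕜 T ∧
    ∀ v ∈ S, ∃ x : ℕ → V, (∀ n, x n ∈ X ∩ T) ∧ SetConverges 𝕜 T x v

/-- A complete convex bornological vector space `V` is nuclear if for each complete bounded disk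
`S` there is a complete bounded disk `T ⊇ S` such that the inclusion `V_S → V_T` of Banach spaces
is a nuclear map, that is, of the form `x ↦ ∑ₙ cₙ φₙ(x) yₙ` with convergence in `V_T`, where
`∑ₙ |cₙ| < ∞`, the linear functionals `φₙ` on `V_S` have norm at most one, and `yₙ ∈ T`. -/
def IsNuclear (𝕜 : Type*) [RCLike 𝕜] (V : Type*) [AddCommGroup V] [Module 𝕜 V]
    [Bornology V] : Prop :=
  ∀ S : Set V, IsBounded S → IsCompleteDisk 𝕜 S →
    ∃ T : Set V, S ⊆ T ∧ IsBounded T ∧ IsCompleteDisk 𝕜 T ∧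
      ∃ (c : ℕ → 𝕜) (φ : ℕ → (Submodule.span 𝕜 S →ₗ[𝕜] 𝕜)) (y : ℕ → V),
        Summable (fun n => ‖c n‖) ∧
        (∀ n, ∀ x : Submodule.span 𝕜 S, (x : V) ∈ S → ‖φ n x‖ ≤ 1) ∧
        (∀ n, y n ∈ T) ∧
        ∀ x : Submodule.span 𝕜 S, ∀ ε : ℝ, 0 < ε → ∃ N₀, ∀ N ≥ N₀,
          (∑ n ∈ Finset.range N, (c n * φ n x) • y n) - (x : V) ∈ (ε : 𝕜) • T

end Basic

section SpectralRadius

/-! ### Spectral radius, locally multiplicative algebras, isoradial homomorphisms -/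

/-- `setPow S n` is the set `S ^ (n + 1)` of all products of `n + 1` elements of `S`. -/
def setPow {A : Type*} [Mul A] (S : Set A) : ℕ → Set A
  | 0 => S
  | n + 1 => setPow S n * S

/-- `setPowInfty S` is `S^∞ = ⋃_{n ≥ 1} S ^ n`. -/
def setPowInfty {A : Type*} [Mul A] (S : Set A) : Set A :=
  ⋃ n : ℕ, setPow S n

/-- The spectral radius of `S`: the infimum of all real `r > 0` such that `(r⁻¹ S)^∞` is bounded,
and infinity if there is no such `r`. -/
def spectralRadius (𝕜 : Type*) [RCLike 𝕜] {A : Type*} [NonUnitalRing A] [Module 𝕜 A]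
    [Bornology A] (S : Set A) : ℝ≥0∞ :=
  sInf {ρ : ℝ≥0∞ | ∃ r : ℝ, 0 < r ∧ IsBounded (setPowInfty ((r : 𝕜)⁻¹ • S)) ∧
    ρ = ENNReal.ofReal r}

/-- All bounded subsets have finite spectral radius. -/
def IsLocallyMultiplicative (𝕜 : Type*) [RCLike 𝕜] (A : Type*) [NonUnitalRing A] [Module 𝕜 A]
    [Bornology A] : Prop :=
  ∀ S : Set A, IsBounded S → spectralRadius 𝕜 S < ∞

/-- Isoradial homomorphisms: bounded algebra homomorphisms with locally dense range that preserve
the spectral radii of bounded subsets. -/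
structure IsIsoradial {𝕜 : Type*} [RCLike 𝕜] {A B : Type*} [NonUnitalRing A] [Module 𝕜 A]
    [Bornology A] [NonUnitalRing B] [Module 𝕜 B] [Bornology B] (f : A →ₙₐ[𝕜] B) : Prop where
  bounded : BoundedMap f
  locallyDense : IsLocallyDense 𝕜 (Set.range f)
  spectralRadius_eq : ∀ S : Set A, IsBounded S → spectralRadius 𝕜 S = spectralRadius 𝕜 (f '' S)

end SpectralRadius

section Aux

/-! ### Auxiliary facts on disks and absolutely convergent series -/

variable {𝕜 : Type*} [RCLike 𝕜] {V : Type*} [AddCommGroup V] [Module 𝕜 V]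

lemma mem_smul_set_of_smul_mem {T : Set V} {r : ℝ} (hr : 0 < r) {x : V}
    (h : ((r : 𝕜)⁻¹) • x ∈ T) : x ∈ (r : 𝕜) • T := by
  have : (r : 𝕜) ≠ 0 := by exact_mod_cast hr.ne'
  exact (Set.mem_smul_set_iff_inv_smul_mem₀ this _ _).2 h

lemma IsDisk.smul_mem {T : Set V} (hT : IsDisk 𝕜 T) {x : V} (hx : x ∈ T) (c : 𝕜)
    (hc : ‖c‖ ≤ 1) : c • x ∈ T := by
  have := hT.absConvex hx hT.zero_mem c 0 (by simpa using hc)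
  simpa using this

lemma IsDisk.isCircled {T : Set V} (hT : IsDisk 𝕜 T) : IsCircled 𝕜 T :=
  ⟨fun c hc _ hx => hT.smul_mem hx c hc, hT.closed⟩

lemma IsDisk.smul_mem_smul {T : Set V} (hT : IsDisk 𝕜 T) {x : V} {r s : ℝ} (hr : 0 ≤ r)
    (hx : x ∈ (r : 𝕜) • T) (c : 𝕜) (hc : ‖c‖ * r ≤ s) : c • x ∈ (s : 𝕜) • T := by
  obtain ⟨d, hd, rfl⟩ := hx
  have h0 : 0 ≤ ‖c‖ * r := by positivity
  rcases (h0.trans hc).eq_or_lt with h | h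
  · have h1 : ‖c‖ * r = 0 := le_antisymm (h ▸ hc) h0
    have h2 : c * (r : 𝕜) = 0 := by
      rw [← norm_eq_zero, norm_mul, RCLike.norm_ofReal, abs_of_nonneg hr, h1]
    refine ⟨0, hT.zero_mem, ?_⟩
    simp [smul_smul, h2]
  · apply mem_smul_set_of_smul_mem h
    simp only [smul_smul]
    apply hT.smul_mem hd
    rw [norm_mul, norm_mul, norm_inv, RCLike.norm_ofReal, RCLike.norm_ofReal, abs_of_nonneg hr,
      abs_of_pos h, inv_mul_le_iff₀ h]
    simpa using hc

lemma IsDisk.smul_mono {T : Set V} (hT : IsDisk 𝕜 T) {x : V} {r s : ℝ} (hr : 0 ≤ r)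
    (hrs : r ≤ s) (hx : x ∈ (r : 𝕜) • T) : x ∈ (s : 𝕜) • T := by
  simpa using hT.smul_mem_smul hr hx 1 (by simpa using hrs)

lemma IsDisk.add_mem_smul {T : Set V} (hT : IsDisk 𝕜 T) {x y : V} {r s : ℝ} (hr : 0 ≤ r)
    (hs : 0 ≤ s) (hx : x ∈ (r : 𝕜) • T) (hy : y ∈ (s : 𝕜) • T) :
    x + y ∈ ((r + s : ℝ) : 𝕜) • T := by
  rcases (add_nonneg hr hs).eq_or_lt with h | h
  · obtain rfl : r = 0 := by linarith
    obtain rfl : s = 0 := by linarith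
    obtain ⟨d, hd, rfl⟩ := hx
    obtain ⟨e, he, rfl⟩ := hy
    exact ⟨0, hT.zero_mem, by simp⟩
  · obtain ⟨d, hd, rfl⟩ := hx
    obtain ⟨e, he, rfl⟩ := hy
    apply mem_smul_set_of_smul_mem h
    simp only [smul_add, smul_smul]
    apply hT.absConvex hd he
    rw [norm_mul, norm_mul, norm_inv, RCLike.norm_ofReal, RCLike.norm_ofReal, RCLike.norm_ofReal,
      abs_of_nonneg hr, abs_of_nonneg hs, abs_of_pos h, ← mul_add, inv_mul_cancel₀ h.ne']

lemma IsDisk.sub_mem_smul {T : Set V} (hT : IsDisk 𝕜 T) {x y : V} {r s : ℝ} (hr : 0 ≤ r)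
    (hs : 0 ≤ s) (hx : x ∈ (r : 𝕜) • T) (hy : y ∈ (s : 𝕜) • T) :
    x - y ∈ ((r + s : ℝ) : 𝕜) • T := by
  have h := hT.smul_mem_smul (s := s) hs hy (-1) (by simp)
  have := hT.add_mem_smul hr hs hx h
  rwa [neg_one_smul, ← sub_eq_add_neg] at this

lemma IsDisk.sum_mem_smul {T : Set V} (hT : IsDisk 𝕜 T) {ι : Type*} (s : Finset ι) (c : ι → 𝕜)
    (x : ι → V) (hx : ∀ i ∈ s, c i ≠ 0 → x i ∈ T) :
    ∑ i ∈ s, c i • x i ∈ ((∑ i ∈ s, ‖c i‖ : ℝ) : 𝕜) • T := by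
  classical
  induction s using Finset.induction_on with
  | empty => exact ⟨0, hT.zero_mem, by simp⟩
  | insert i s hi ih =>
    rw [Finset.sum_insert hi, Finset.sum_insert hi]
    apply hT.add_mem_smul (norm_nonneg _) (Finset.sum_nonneg fun _ _ => norm_nonneg _)
    · by_cases h : c i = 0
      · exact ⟨0, hT.zero_mem, by simp [h]⟩
      · have : x i ∈ ((1 : ℝ) : 𝕜) • T := by simpa using hx i (by simp) h
        exact hT.smul_mem_smul zero_le_one this _ (by simp)
    · exact ih fun j hj => hx j (by simp [hj])

lemma IsCompleteDisk.mem_of_forall {T : Set V} (hT : IsCompleteDisk 𝕜 T) {x : V} {r : ℝ}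
    (hr : 0 ≤ r) (h : ∀ ε : ℝ, 0 < ε → x ∈ ((r + ε : ℝ) : 𝕜) • T) : x ∈ (r : 𝕜) • T := by
  rcases hr.eq_or_lt with rfl | hr
  · rw [hT.eq_zero x fun ε hε => by simpa using h ε hε]
    exact ⟨0, hT.zero_mem, by simp⟩
  · apply mem_smul_set_of_smul_mem hr
    apply hT.closed
    intro t ht
    have h1 := h (r * (t - 1)) (mul_pos hr (by linarith))
    refine hT.smul_mem_smul ?_ h1 _ ?_
    · nlinarith
    · rw [norm_inv, RCLike.norm_ofReal, abs_of_pos hr, inv_mul_le_iff₀ hr]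
      linarith

lemma mem_span_of_mem_smul {T : Set V} {r : ℝ} {x : V} (hx : x ∈ (r : 𝕜) • T) :
    x ∈ Submodule.span 𝕜 T := by
  obtain ⟨d, hd, rfl⟩ := hx
  exact Submodule.smul_mem _ _ (Submodule.subset_span hd)

/-- The unordered series `∑ᵢ f i` converges to `x` in `V_T` for some bounded disk `T`. -/
def HasBornSum (𝕜 : Type*) [RCLike 𝕜] {V : Type*} [AddCommGroup V] [Module 𝕜 V] [Bornology V]
    {ι : Type*} (f : ι → V) (x : V) : Prop :=
  ∃ T : Set V, IsBounded T ∧ IsDisk 𝕜 T ∧ ∀ ε : ℝ, 0 < ε → ∃ s₀ : Finset ι, ∀ s : Finset ι,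
    s₀ ⊆ s → ∑ i ∈ s, f i - x ∈ (ε : 𝕜) • T

/-- An absolutely convergent series over a complete disk. -/
lemma IsCompleteDisk.exists_sum {T : Set V} (hT : IsCompleteDisk 𝕜 T) {ι : Type*} (c : ι → 𝕜)
    (hc : Summable fun i => ‖c i‖) (f : ι → V) (hf : ∀ i, c i ≠ 0 → f i ∈ T) :
    ∃ x ∈ ((∑' i, ‖c i‖ : ℝ) : 𝕜) • T, ∀ ε : ℝ, 0 < ε → ∃ s₀ : Finset ι, ∀ s : Finset ι,
      s₀ ⊆ s → ∑ i ∈ s, c i • f i - x ∈ (ε : 𝕜) • T := by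
  classical
  have tail : ∀ ε : ℝ, 0 < ε → ∃ s₀ : Finset ι, ∀ s, s₀ ⊆ s → ∀ t, s₀ ⊆ t →
      ∑ i ∈ s, c i • f i - ∑ i ∈ t, c i • f i ∈ (ε : 𝕜) • T := by
    intro ε hε
    obtain ⟨s₀, hs₀⟩ := summable_iff_vanishing_norm.1 hc (ε / 2) (by positivity)
    have key : ∀ s, s₀ ⊆ s → ∑ i ∈ s, c i • f i - ∑ i ∈ s₀, c i • f i ∈ ((ε / 2 : ℝ) : 𝕜) • T := by
      intro s hs
      rw [← Finset.sum_sdiff hs, add_sub_cancel_right]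
      have h := hT.sum_mem_smul (s \ s₀) c f fun i _ => hf i
      refine hT.smul_mono (Finset.sum_nonneg fun _ _ => norm_nonneg _) ?_ h
      have := hs₀ (s \ s₀) Finset.sdiff_disjoint
      rw [Real.norm_eq_abs] at this
      exact (le_abs_self _).trans this.le
    refine ⟨s₀, fun s hs t ht => ?_⟩
    have := hT.sub_mem_smul (by positivity) (by positivity) (key s hs) (key t ht)
    simpa using this
  have hpos : ∀ n : ℕ, (0 : ℝ) < 1 / ((n : ℝ) + 1) := fun n => Nat.one_div_pos_of_nat
  choose u hu using fun n : ℕ => tail (1 / ((n : ℝ) + 1)) (hpos n)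
  let w : ℕ → Finset ι := fun n => (Finset.range (n + 1)).biUnion u
  have huw : ∀ n m, n ≤ m → u n ⊆ w m := fun n m h =>
    Finset.subset_biUnion_of_mem u (by simp; omega)
  obtain ⟨l, -, hl⟩ := hT.complete (fun n => ∑ i ∈ w n, c i • f i)
    (fun n => mem_span_of_mem_smul (hT.sum_mem_smul (w n) c f fun i _ => hf i)) (by
      intro ε hε
      obtain ⟨N, hN⟩ := exists_nat_one_div_lt hε
      refine ⟨N, fun m hm n hn => ?_⟩
      exact hT.smul_mono (hpos N).le hN.le (hu N _ (huw N m hm) _ (huw N n hn)))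
  have conv : ∀ ε : ℝ, 0 < ε → ∃ s₀ : Finset ι, ∀ s : Finset ι,
      s₀ ⊆ s → ∑ i ∈ s, c i • f i - l ∈ (ε : 𝕜) • T := by
    intro ε hε
    obtain ⟨N, hN⟩ := exists_nat_one_div_lt (half_pos hε)
    obtain ⟨M, hM⟩ := hl (ε / 2) (half_pos hε)
    refine ⟨u N, fun s hs => ?_⟩
    have h1 := hT.smul_mono (hpos N).le hN.le (hu N s hs (w (max N M)) (huw N _ (le_max_left _ _)))
    have h2 := hM (max N M) (le_max_right _ _)
    have := hT.add_mem_smul (half_pos hε).le (half_pos hε).le h1 h2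
    simpa using this
  refine ⟨l, ?_, conv⟩
  have h0 : (0 : ℝ) ≤ ∑' i, ‖c i‖ := tsum_nonneg fun _ => norm_nonneg _
  apply hT.mem_of_forall h0
  intro ε hε
  obtain ⟨s, hs⟩ := conv ε hε
  have h1 := hs s subset_rfl
  have h2 := hT.smul_mono (Finset.sum_nonneg fun _ _ => norm_nonneg _)
    (hc.sum_le_tsum s fun _ _ => norm_nonneg _) (hT.sum_mem_smul s c f fun i _ => hf i)
  have := hT.sub_mem_smul h0 hε.le h2 h1
  simpa using this

variable [Bornology V]

lemma HasBornSum.exists_common [CompleteConvexSpace 𝕜 V] {ι κ : Type*} {f : ι → V} {x : V}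
    {g : κ → V} {y : V} (hf : HasBornSum 𝕜 f x) (hg : HasBornSum 𝕜 g y) :
    ∃ T : Set V, IsBounded T ∧ IsCompleteDisk 𝕜 T ∧
      (∀ ε : ℝ, 0 < ε → ∃ s₀ : Finset ι, ∀ s : Finset ι,
        s₀ ⊆ s → ∑ i ∈ s, f i - x ∈ (ε : 𝕜) • T) ∧
      (∀ ε : ℝ, 0 < ε → ∃ s₀ : Finset κ, ∀ s : Finset κ,
        s₀ ⊆ s → ∑ i ∈ s, g i - y ∈ (ε : 𝕜) • T) := by
  obtain ⟨T₁, hb₁, -, h₁⟩ := hf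
  obtain ⟨T₂, hb₂, -, h₂⟩ := hg
  obtain ⟨T, hT, hTb, hTd⟩ :=
    CompleteConvexSpace.exists_completeDisk (𝕜 := 𝕜) (T₁ ∪ T₂) (hb₁.union hb₂)
  refine ⟨T, hTb, hTd, fun ε hε => ?_, fun ε hε => ?_⟩
  · obtain ⟨s₀, hs⟩ := h₁ ε hε
    exact ⟨s₀, fun s h => Set.smul_set_mono (Set.subset_union_left.trans hT) (hs s h)⟩
  · obtain ⟨s₀, hs⟩ := h₂ ε hε
    exact ⟨s₀, fun s h => Set.smul_set_mono (Set.subset_union_right.trans hT) (hs s h)⟩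

lemma HasBornSum.unique [CompleteConvexSpace 𝕜 V] {ι : Type*} {f : ι → V} {x y : V}
    (hx : HasBornSum 𝕜 f x) (hy : HasBornSum 𝕜 f y) : x = y := by
  classical
  obtain ⟨T, -, hT, h₁, h₂⟩ := hx.exists_common hy
  rw [← sub_eq_zero]
  apply hT.eq_zero
  intro ε hε
  obtain ⟨s, hs⟩ := h₁ (ε / 2) (half_pos hε)
  obtain ⟨t, ht⟩ := h₂ (ε / 2) (half_pos hε)
  have := hT.sub_mem_smul (half_pos hε).le (half_pos hε).le
    (ht (s ∪ t) Finset.subset_union_right) (hs (s ∪ t) Finset.subset_union_left)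
  simpa using this

lemma HasBornSum.add [CompleteConvexSpace 𝕜 V] {ι : Type*} {f g : ι → V} {x y : V}
    (hx : HasBornSum 𝕜 f x) (hy : HasBornSum 𝕜 g y) :
    HasBornSum 𝕜 (fun i => f i + g i) (x + y) := by
  classical
  obtain ⟨T, hb, hT, h₁, h₂⟩ := hx.exists_common hy
  refine ⟨T, hb, hT.toIsDisk, fun ε hε => ?_⟩
  obtain ⟨s, hs⟩ := h₁ (ε / 2) (half_pos hε)
  obtain ⟨t, ht⟩ := h₂ (ε / 2) (half_pos hε)
  refine ⟨s ∪ t, fun w hw => ?_⟩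
  have := hT.add_mem_smul (half_pos hε).le (half_pos hε).le
    (hs w (Finset.subset_union_left.trans hw)) (ht w (Finset.subset_union_right.trans hw))
  rw [Finset.sum_add_distrib, add_sub_add_comm]
  simpa using this

lemma HasBornSum.smul {ι : Type*} {f : ι → V} {x : V} (hx : HasBornSum 𝕜 f x) (c : 𝕜) :
    HasBornSum 𝕜 (fun i => c • f i) (c • x) := by
  obtain ⟨T, hb, hT, h₁⟩ := hx
  refine ⟨T, hb, hT, fun ε hε => ?_⟩
  have hc : 0 < ‖c‖ + 1 := by positivity
  obtain ⟨s, hs⟩ := h₁ (ε / (‖c‖ + 1)) (by positivity)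
  refine ⟨s, fun w hw => ?_⟩
  rw [← Finset.smul_sum, ← smul_sub]
  refine hT.smul_mem_smul (by positivity) (hs w hw) c ?_
  rw [mul_div_assoc', div_le_iff₀ hc]
  nlinarith

lemma HasBornSum.map {W : Type*} [AddCommGroup W] [Module 𝕜 W] [Bornology W]
    [CompleteConvexSpace 𝕜 W] {ι : Type*} {f : ι → V} {x : V} (hx : HasBornSum 𝕜 f x)
    (Φ : V →ₗ[𝕜] W) (hΦ : BoundedMap Φ) : HasBornSum 𝕜 (fun i => Φ (f i)) (Φ x) := by
  obtain ⟨T, hb, hT, h₁⟩ := hx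
  obtain ⟨D, hD, hDb, hDd⟩ :=
    CompleteConvexSpace.exists_completeDisk (𝕜 := 𝕜) (Φ '' T) (hΦ T hb)
  refine ⟨D, hDb, hDd.toIsDisk, fun ε hε => ?_⟩
  obtain ⟨s, hs⟩ := h₁ ε hε
  refine ⟨s, fun w hw => ?_⟩
  rw [← map_sum, ← map_sub]
  obtain ⟨d, hd, h⟩ := hs w hw
  exact ⟨Φ d, hD ⟨d, hd, rfl⟩, by simp [← h]⟩

/-- Limits of bornologically convergent sequences are preserved by bounded linear maps. -/
lemma BornConverges.map {W : Type*} [AddCommGroup W] [Module 𝕜 W] [Bornology W]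
    [CompleteConvexSpace 𝕜 W] {x : ℕ → V} {l : V} (hx : BornConverges 𝕜 x l)
    (Φ : V →ₗ[𝕜] W) (hΦ : BoundedMap Φ) : BornConverges 𝕜 (fun n => Φ (x n)) (Φ l) := by
  obtain ⟨T, hb, hT, h₁, h₂, ε, h₃, h₄, h₅⟩ := hx
  obtain ⟨D, hD, hDb, hDd⟩ :=
    CompleteConvexSpace.exists_completeDisk (𝕜 := 𝕜) (Φ '' T) (hΦ T hb)
  refine ⟨D, hDb, hDd.toIsDisk.isCircled, fun n => hD ⟨_, h₁ n, rfl⟩, hD ⟨_, h₂, rfl⟩, ε, h₃, h₄,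
    fun n => ?_⟩
  obtain ⟨d, hd, h⟩ := h₅ n
  exact ⟨Φ d, hD ⟨d, hd, rfl⟩, by rw [← map_sub, ← h]; simp⟩

lemma BornConverges.eq_zero [CompleteConvexSpace 𝕜 V] {l : V}
    (h : BornConverges 𝕜 (fun _ => (0 : V)) l) : l = 0 := by
  obtain ⟨T, hb, hT, -, -, ε, h₃, h₄, h₅⟩ := h
  obtain ⟨D, hD, -, hDd⟩ := CompleteConvexSpace.exists_completeDisk (𝕜 := 𝕜) T hb
  apply hDd.eq_zero
  intro δ hδ
  obtain ⟨n, hn⟩ := (h₄.eventually_lt_const hδ).exists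
  have := hDd.smul_mem_smul (h₃ n).le (Set.smul_set_mono hD (h₅ n)) (-1) (s := δ)
    (by simpa using hn.le)
  simpa using this

/-- The kernel of a bounded linear map is closed. -/
lemma isBornClosed_ker {W : Type*} [AddCommGroup W] [Module 𝕜 W] [Bornology W]
    [CompleteConvexSpace 𝕜 W] (Φ : V →ₗ[𝕜] W) (hΦ : BoundedMap Φ) :
    IsBornClosed 𝕜 (LinearMap.ker Φ : Set V) := by
  intro x l hx hl
  have h := hl.map Φ hΦ
  have h0 : (fun n => Φ (x n)) = fun _ => 0 := funext hx
  rw [h0] at h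
  exact h.eq_zero

/-- The image of the closed unit ball under an injective linear map from a Banach space is a
complete disk. -/
lemma isCompleteDisk_image_closedBall {V : Type*} [AddCommGroup V] [Module 𝕜 V] {E : Type*}
    [NormedAddCommGroup E] [NormedSpace 𝕜 E]
    [CompleteSpace E] (j : E →ₗ[𝕜] V) (hj : Function.Injective j) :
    IsCompleteDisk 𝕜 (j '' Metric.closedBall (0 : E) 1) := by
  have hmem : ∀ (r : ℝ), 0 < r → ∀ e : E,
      j e ∈ (r : 𝕜) • (j '' Metric.closedBall (0 : E) 1) ↔ ‖e‖ ≤ r := by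
    intro r hr e
    have hr' : (r : 𝕜) ≠ 0 := by exact_mod_cast hr.ne'
    rw [Set.mem_smul_set_iff_inv_smul_mem₀ hr', ← map_smul, hj.mem_set_image, mem_closedBall_zero_iff,
      norm_smul, norm_inv, RCLike.norm_ofReal, abs_of_pos hr, inv_mul_le_iff₀ hr, mul_one]
  have hrange : ∀ (r : ℝ), ∀ x, x ∈ (r : 𝕜) • (j '' Metric.closedBall (0 : E) 1) →
      ∃ e, j e = x := by
    rintro r _ ⟨_, ⟨e, -, rfl⟩, rfl⟩
    exact ⟨(r : 𝕜) • e, by simp⟩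
  refine ⟨⟨⟨0, by simp, by simp⟩, ?_, ?_⟩, ?_, ?_⟩
  · rintro _ ⟨e, he, rfl⟩ _ ⟨e', he', rfl⟩ a b hab
    refine ⟨a • e + b • e', ?_, by simp⟩
    rw [mem_closedBall_zero_iff] at *
    calc ‖a • e + b • e'‖ ≤ ‖a‖ * ‖e‖ + ‖b‖ * ‖e'‖ := by
          rw [← norm_smul, ← norm_smul]; exact norm_add_le _ _
      _ ≤ ‖a‖ * 1 + ‖b‖ * 1 := by gcongr
      _ ≤ 1 := by linarith
  · intro x hx
    obtain ⟨e, rfl⟩ := hrange 2 x (hx 2 one_lt_two)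
    refine ⟨e, ?_, rfl⟩
    rw [mem_closedBall_zero_iff]
    exact le_of_forall_gt_imp_ge_of_dense fun t ht => (hmem t (by linarith) e).1 (hx t ht)
  · intro x hx
    obtain ⟨e, rfl⟩ := hrange 1 x (hx 1 one_pos)
    have : ‖e‖ ≤ 0 := le_of_forall_gt_imp_ge_of_dense fun t ht => (hmem t ht e).1 (hx t ht)
    rw [norm_le_zero_iff.1 this, map_zero]
  · intro x hx hc
    have hsp : ∀ n, ∃ e, j e = x n := by
      intro n
      have : Submodule.span 𝕜 (j '' Metric.closedBall (0 : E) 1) ≤ LinearMap.range j :=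
        Submodule.span_le.2 (by rintro _ ⟨e, -, rfl⟩; exact ⟨e, rfl⟩)
      exact this (hx n)
    choose e he using hsp
    have hcauchy : CauchySeq e := by
      rw [Metric.cauchySeq_iff]
      intro ε hε
      obtain ⟨N, hN⟩ := hc (ε / 2) (half_pos hε)
      refine ⟨N, fun m hm n hn => ?_⟩
      have := hN m hm n hn
      rw [← he, ← he, ← map_sub, hmem _ (half_pos hε)] at this
      rw [dist_eq_norm]; linarith
    obtain ⟨l, hl⟩ := cauchySeq_tendsto_of_complete hcauchy
    refine ⟨j l, ?_, fun ε hε => ?_⟩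
    · exact mem_span_of_mem_smul ((hmem (‖l‖ + 1) (by positivity) l).2 (by linarith))
    · obtain ⟨N, hN⟩ := Metric.tendsto_atTop.1 hl ε hε
      refine ⟨N, fun n hn => ?_⟩
      rw [← he, ← map_sub, hmem _ hε, ← dist_eq_norm]
      exact (hN n hn).le

/-- If the kernel of a linear map `i` on a Banach space is closed, then the image of the closed unit
ball of the quotient by the kernel is a complete disk. -/
lemma exists_completeDisk_of_isClosed_ker {V : Type*} [AddCommGroup V] [Module 𝕜 V] {E : Type*}
    [NormedAddCommGroup E] [NormedSpace 𝕜 E] [CompleteSpace E] (i : E →ₗ[𝕜] V)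
    (hi : IsClosed (LinearMap.ker i : Set E)) :
    ∃ T : Set V, IsCompleteDisk 𝕜 T ∧ i '' Metric.closedBall 0 1 ⊆ T ∧
      T ⊆ i '' Metric.closedBall 0 2 := by
  have := hi
  let i' : (E ⧸ LinearMap.ker i) →ₗ[𝕜] V := (LinearMap.ker i).liftQ i le_rfl
  have hi' : Function.Injective i' :=
    LinearMap.ker_eq_bot.1 (Submodule.ker_liftQ_eq_bot _ _ _ le_rfl)
  refine ⟨_, isCompleteDisk_image_closedBall i' hi', ?_, ?_⟩
  · rintro _ ⟨e, he, rfl⟩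
    refine ⟨(LinearMap.ker i).mkQ e, ?_, Submodule.liftQ_apply _ _ _⟩
    rw [mem_closedBall_zero_iff] at *
    exact (Submodule.Quotient.norm_mk_le _ _).trans he
  · rintro _ ⟨e, he, rfl⟩
    rw [mem_closedBall_zero_iff] at he
    obtain ⟨e₀, rfl, he₀⟩ := Submodule.Quotient.norm_mk_lt e one_pos
    refine ⟨e₀, ?_, (Submodule.liftQ_apply _ _ _).symm⟩
    rw [mem_closedBall_zero_iff]
    linarith

end Aux

section Tensor

/-! ### The complete projective tensor product

It is constructed as the quotient of the free complete convex bornological vector space on the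
bornological set `V × W`, which is the union of the spaces `ℓ¹(S × T)` over bounded `S ⊆ V` and
`T ⊆ W`, by the smallest closed subspace that contains the relations of bilinearity.  Its universal
property is proved below (`Tensor.lift`, `Tensor.lift_tmul`, `Tensor.boundedMap_lift`,
`Tensor.ext`). -/

variable (𝕜 : Type*) [RCLike 𝕜] (V W : Type*) [AddCommGroup V] [Module 𝕜 V] [Bornology V]
  [AddCommGroup W] [Module 𝕜 W] [Bornology W]

/-- Elements of `ℓ¹(V × W)` with support in `S × T`. -/
def suppIn (S : Set V) (T : Set W) : Submodule 𝕜 (lp (fun _ : V × W => 𝕜) 1) where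
  carrier := {g | ∀ p, p ∉ S ×ˢ T → g p = 0}
  zero_mem' := by intro p _; simp
  add_mem' := by
    intro g h hg hh p hp
    simp [hg p hp, hh p hp]
  smul_mem' := by
    intro c g hg p hp
    simp [hg p hp]

variable {𝕜 V W} in
lemma suppIn_mono {S S' : Set V} {T T' : Set W} (hS : S ⊆ S') (hT : T ⊆ T') :
    suppIn 𝕜 V W S T ≤ suppIn 𝕜 V W S' T' :=
  fun _ hg p hp => hg p fun h => hp (Set.prod_mono hS hT h)

/-- Elements of `ℓ¹(V × W)` with support in `S × T` for some bounded `S` and `T`. -/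
def boundedSupp : Submodule 𝕜 (lp (fun _ : V × W => 𝕜) 1) where
  carrier := {g | ∃ (S : Set V) (T : Set W), IsBounded S ∧ IsBounded T ∧ g ∈ suppIn 𝕜 V W S T}
  zero_mem' := ⟨∅, ∅, isBounded_empty, isBounded_empty, Submodule.zero_mem _⟩
  add_mem' := by
    rintro g h ⟨S, T, hS, hT, hg⟩ ⟨S', T', hS', hT', hh⟩
    exact ⟨S ∪ S', T ∪ T', hS.union hS', hT.union hT', Submodule.add_mem _
      (suppIn_mono Set.subset_union_left Set.subset_union_left hg)
      (suppIn_mono Set.subset_union_right Set.subset_union_right hh)⟩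
  smul_mem' := by
    rintro c g ⟨S, T, hS, hT, hg⟩
    exact ⟨S, T, hS, hT, Submodule.smul_mem _ _ hg⟩

/-- The free complete convex bornological vector space on the bornological set `V × W`. -/
def FreeSpace : Type _ := ↥(boundedSupp 𝕜 V W)

instance : AddCommGroup (FreeSpace 𝕜 V W) := inferInstanceAs (AddCommGroup ↥(boundedSupp 𝕜 V W))
instance : Module 𝕜 (FreeSpace 𝕜 V W) := inferInstanceAs (Module 𝕜 ↥(boundedSupp 𝕜 V W))

namespace FreeSpace

/-- The inclusion into `ℓ¹(V × W)`. -/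
def coeL : FreeSpace 𝕜 V W →ₗ[𝕜] lp (fun _ : V × W => 𝕜) 1 := (boundedSupp 𝕜 V W).subtype

variable {𝕜 V W}

lemma coeL_injective : Function.Injective (coeL 𝕜 V W) := Subtype.val_injective

/-- The closed ball of radius `r` in `ℓ¹(S × T)`. -/
def ball (S : Set V) (T : Set W) (r : ℝ) : Set (FreeSpace 𝕜 V W) :=
  {g | coeL 𝕜 V W g ∈ suppIn 𝕜 V W S T ∧ ‖coeL 𝕜 V W g‖ ≤ r}

lemma ball_mono {S S' : Set V} {T T' : Set W} {r r' : ℝ} (hS : S ⊆ S') (hT : T ⊆ T')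
    (hr : r ≤ r') : ball (𝕜 := 𝕜) S T r ⊆ ball S' T' r' :=
  fun _ hg => ⟨suppIn_mono hS hT hg.1, hg.2.trans hr⟩

lemma exists_mem_ball (g : FreeSpace 𝕜 V W) : ∃ (S : Set V) (T : Set W), IsBounded S ∧
    IsBounded T ∧ g ∈ ball S T ‖coeL 𝕜 V W g‖ := by
  obtain ⟨g, S, T, hS, hT, hg⟩ := g
  exact ⟨S, T, hS, hT, hg, le_rfl⟩

end FreeSpace

/-- A subset of the free space is bounded if it is a bounded subset of `ℓ¹(S × T)` for some bounded
`S` and `T`. -/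
instance : Bornology (FreeSpace 𝕜 V W) :=
  Bornology.ofBounded
    {B | ∃ (S : Set V) (T : Set W) (r : ℝ), IsBounded S ∧ IsBounded T ∧ B ⊆ FreeSpace.ball S T r}
    ⟨∅, ∅, 0, isBounded_empty, isBounded_empty, Set.empty_subset _⟩
    (by
      rintro B ⟨S, T, r, hS, hT, hB⟩ B' hB'
      exact ⟨S, T, r, hS, hT, hB'.trans hB⟩)
    (by
      rintro B ⟨S, T, r, hS, hT, hB⟩ B' ⟨S', T', r', hS', hT', hB'⟩
      refine ⟨S ∪ S', T ∪ T', max r r', hS.union hS', hT.union hT', Set.union_subset ?_ ?_⟩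
      · exact hB.trans (FreeSpace.ball_mono Set.subset_union_left Set.subset_union_left
          (le_max_left _ _))
      · exact hB'.trans (FreeSpace.ball_mono Set.subset_union_right Set.subset_union_right
          (le_max_right _ _)))
    (by
      intro g
      obtain ⟨S, T, hS, hT, hg⟩ := g.exists_mem_ball
      exact ⟨S, T, _, hS, hT, Set.singleton_subset_iff.2 hg⟩)

namespace FreeSpace

variable {𝕜 V W}

lemma isBounded_iff {B : Set (FreeSpace 𝕜 V W)} : IsBounded B ↔
    ∃ (S : Set V) (T : Set W) (r : ℝ), IsBounded S ∧ IsBounded T ∧ B ⊆ ball S T r :=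
  Bornology.isBounded_ofBounded_iff _

lemma isBounded_ball {S : Set V} {T : Set W} (hS : IsBounded S) (hT : IsBounded T) (r : ℝ) :
    IsBounded (ball (𝕜 := 𝕜) S T r) :=
  isBounded_iff.2 ⟨S, T, r, hS, hT, subset_rfl⟩

instance : BornologicalVectorSpace 𝕜 (FreeSpace 𝕜 V W) where
  isBounded_add := by
    intro B B' hB hB'
    obtain ⟨S, T, r, hS, hT, hB⟩ := isBounded_iff.1 hB
    obtain ⟨S', T', r', hS', hT', hB'⟩ := isBounded_iff.1 hB'
    refine isBounded_iff.2 ⟨S ∪ S', T ∪ T', r + r', hS.union hS', hT.union hT', ?_⟩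
    rintro _ ⟨x, hx, y, hy, rfl⟩
    obtain ⟨h1, h2⟩ := hB hx
    obtain ⟨h3, h4⟩ := hB' hy
    refine ⟨?_, ?_⟩
    · simp only [map_add]
      exact Submodule.add_mem _
        (suppIn_mono Set.subset_union_left Set.subset_union_left h1)
        (suppIn_mono Set.subset_union_right Set.subset_union_right h3)
    · simp only [map_add]
      exact (norm_add_le _ _).trans (add_le_add h2 h4)
  isBounded_smul := by
    intro R B hB
    obtain ⟨S, T, r, hS, hT, hB⟩ := isBounded_iff.1 hB
    refine isBounded_iff.2 ⟨S, T, R * r, hS, hT, ?_⟩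
    rintro _ ⟨c, hc, x, hx, rfl⟩
    obtain ⟨h1, h2⟩ := hB hx
    refine ⟨?_, ?_⟩
    · simp only [map_smul]
      exact Submodule.smul_mem _ _ h1
    · rw [map_smul, norm_smul]
      exact mul_le_mul hc h2 (norm_nonneg _) ((norm_nonneg _).trans hc)

variable (𝕜) in
lemma isClosed_suppIn (S : Set V) (T : Set W) :
    IsClosed (suppIn 𝕜 V W S T : Set (lp (fun _ : V × W => 𝕜) 1)) := by
  have : (suppIn 𝕜 V W S T : Set (lp (fun _ : V × W => 𝕜) 1)) =
      ⋂ p : V × W, ⋂ _ : p ∉ S ×ˢ T, {g | g p = 0} := by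
    ext g; simp [suppIn]
  rw [this]
  refine isClosed_iInter fun p => isClosed_iInter fun _ => isClosed_eq ?_ continuous_const
  exact (lp.evalCLM 𝕜 (fun _ : V × W => 𝕜) 1 p).continuous

instance (S : Set V) (T : Set W) : CompleteSpace (suppIn 𝕜 V W S T) :=
  (isClosed_suppIn 𝕜 S T).completeSpace_coe

/-- The inclusion of `ℓ¹(S × T)` into the free space. -/
def incl {S : Set V} {T : Set W} (hS : IsBounded S) (hT : IsBounded T) :
    suppIn 𝕜 V W S T →ₗ[𝕜] FreeSpace 𝕜 V W :=
  Submodule.inclusion (fun _ hg => ⟨S, T, hS, hT, hg⟩ : suppIn 𝕜 V W S T ≤ boundedSupp 𝕜 V W)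

@[simp] lemma coeL_incl {S : Set V} {T : Set W} (hS : IsBounded S) (hT : IsBounded T)
    (g : suppIn 𝕜 V W S T) : coeL 𝕜 V W (incl hS hT g) = g := rfl

lemma incl_surj {S : Set V} {T : Set W} (hS : IsBounded S) (hT : IsBounded T)
    {g : FreeSpace 𝕜 V W} {r : ℝ} (hg : g ∈ ball S T r) :
    ∃ e : suppIn 𝕜 V W S T, ‖e‖ ≤ r ∧ incl hS hT e = g :=
  ⟨⟨coeL 𝕜 V W g, hg.1⟩, hg.2, coeL_injective rfl⟩

lemma incl_mem {S : Set V} {T : Set W} (hS : IsBounded S) (hT : IsBounded T)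
    {e : suppIn 𝕜 V W S T} {r : ℝ} (he : ‖e‖ ≤ r) : incl hS hT e ∈ ball S T r :=
  ⟨e.2, he⟩

instance : CompleteConvexSpace 𝕜 (FreeSpace 𝕜 V W) where
  exists_completeDisk := by
    intro B hB
    obtain ⟨S, T, r, hS, hT, hB⟩ := isBounded_iff.1 hB
    have hr : 0 < max r 1 := by positivity
    have hr' : ((max r 1 : ℝ) : 𝕜) ≠ 0 := by exact_mod_cast hr.ne'
    let j : suppIn 𝕜 V W S T →ₗ[𝕜] FreeSpace 𝕜 V W := ((max r 1 : ℝ) : 𝕜) • incl hS hT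
    have hj : Function.Injective j := by
      intro e e' h
      have h1 : ((max r 1 : ℝ) : 𝕜) • incl hS hT e = ((max r 1 : ℝ) : 𝕜) • incl hS hT e' := h
      have h2 := smul_right_injective _ hr' h1
      exact Subtype.ext (congrArg (coeL 𝕜 V W) h2)
    refine ⟨j '' Metric.closedBall 0 1, ?_, ?_, isCompleteDisk_image_closedBall j hj⟩
    · intro g hg
      obtain ⟨e, he, rfl⟩ := incl_surj hS hT (hB hg)
      refine ⟨((max r 1 : ℝ) : 𝕜)⁻¹ • e, ?_, ?_⟩
      · rw [mem_closedBall_zero_iff, norm_smul, norm_inv, RCLike.norm_ofReal, abs_of_pos hr,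
          inv_mul_le_iff₀ hr, mul_one]
        exact he.trans (le_max_left _ _)
      · simp [j, smul_smul, hr']
    · refine (isBounded_ball hS hT (max r 1)).subset ?_
      rintro _ ⟨e, he, rfl⟩
      rw [mem_closedBall_zero_iff] at he
      have : j e = incl hS hT (((max r 1 : ℝ) : 𝕜) • e) := by
        rw [map_smul]; rfl
      rw [this]
      apply incl_mem
      rw [norm_smul, RCLike.norm_ofReal, abs_of_pos hr]
      nlinarith

open Classical in
/-- The basis vector of `(v, w)`. -/
def delta (p : V × W) : FreeSpace 𝕜 V W :=
  ⟨lp.single 1 p (1 : 𝕜), {p.1}, {p.2}, isBounded_singleton, isBounded_singleton, by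
    intro q hq
    have : q ≠ p := by rintro rfl; exact hq (by simp)
    exact lp.single_apply_ne _ _ _ this⟩

lemma delta_mem_ball {S : Set V} {T : Set W} {p : V × W} (h1 : p.1 ∈ S) (h2 : p.2 ∈ T) :
    delta (𝕜 := 𝕜) p ∈ ball S T 1 := by
  classical
  refine ⟨?_, ?_⟩
  · intro q hq
    have : q ≠ p := by rintro rfl; exact hq ⟨h1, h2⟩
    exact lp.single_apply_ne _ _ _ this
  · have := lp.norm_single (E := fun _ : V × W => 𝕜) (p := 1) one_pos p (1 : 𝕜)
    rw [norm_one] at this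
    refine le_trans (le_of_eq ?_) this.le
    congr! 3

lemma hasBornSum_delta (g : FreeSpace 𝕜 V W) :
    HasBornSum 𝕜 (fun p => coeL 𝕜 V W g p • delta p) g := by
  classical
  obtain ⟨S, T, hS, hT, hg⟩ := g.exists_mem_ball
  obtain ⟨D, hD, hDb, hDd⟩ := CompleteConvexSpace.exists_completeDisk (𝕜 := 𝕜) _
    (isBounded_ball (𝕜 := 𝕜) hS hT 1)
  refine ⟨D, hDb, hDd.toIsDisk, fun ε hε => ?_⟩
  have h := lp.hasSum_single (E := fun _ : V × W => 𝕜) (p := 1) ENNReal.one_ne_top (coeL 𝕜 V W g)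
  obtain ⟨s₀, hs₀⟩ := (Metric.tendsto_atTop.1 h) ε hε
  refine ⟨s₀, fun s hs => ?_⟩
  apply mem_smul_set_of_smul_mem hε
  apply hD
  have hcoe : coeL 𝕜 V W (∑ p ∈ s, coeL 𝕜 V W g p • delta p) =
      ∑ p ∈ s, lp.single 1 p (coeL 𝕜 V W g p) := by
    rw [map_sum]
    refine Finset.sum_congr rfl fun p _ => ?_
    rw [map_smul]
    have : coeL 𝕜 V W (delta p) = lp.single 1 p (1 : 𝕜) := by
      unfold delta coeL
      refine Eq.trans (b := lp.single 1 p (1 : 𝕜)) ?_ ?_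
      · rfl
      · congr!
    rw [this, ← lp.single_smul, smul_eq_mul, mul_one]
  have h1 := hs₀ s hs
  rw [dist_eq_norm, ← hcoe, ← map_sub] at h1
  refine ⟨?_, ?_⟩
  · rw [map_smul, map_sub]
    refine Submodule.smul_mem _ _ (Submodule.sub_mem _ ?_ hg.1)
    rw [map_sum]
    refine Submodule.sum_mem _ fun p _ => ?_
    by_cases hp : p ∈ S ×ˢ T
    · rw [map_smul]
      exact Submodule.smul_mem _ _ (delta_mem_ball hp.1 hp.2).1
    · rw [hg.1 p hp, zero_smul, map_zero]
      exact Submodule.zero_mem _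
  · rw [map_smul, norm_smul, norm_inv, RCLike.norm_ofReal, abs_of_pos hε, inv_mul_le_iff₀ hε,
      mul_one]
    exact h1.le

variable (𝕜 V W) in
/-- The relations of bilinearity. -/
def relations : Set (FreeSpace 𝕜 V W) :=
  {x | (∃ v v' w, x = delta (v + v', w) - delta (v, w) - delta (v', w)) ∨
    (∃ v w w', x = delta (v, w + w') - delta (v, w) - delta (v, w')) ∨
    (∃ (c : 𝕜) (v : V) (w : W), x = delta (c • v, w) - c • delta (v, w)) ∨
    (∃ (c : 𝕜) (v : V) (w : W), x = delta (v, c • w) - c • delta (v, w))}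

variable (𝕜 V W) in
/-- The smallest closed subspace that contains the relations of bilinearity. -/
def relSpan : Submodule 𝕜 (FreeSpace 𝕜 V W) :=
  sInf {N : Submodule 𝕜 (FreeSpace 𝕜 V W) |
    IsBornClosed 𝕜 (N : Set (FreeSpace 𝕜 V W)) ∧ relations 𝕜 V W ⊆ N}

lemma relations_subset : relations 𝕜 V W ⊆ relSpan 𝕜 V W := by
  intro x hx
  exact (Submodule.mem_sInf).2 fun N hN => hN.2 hx

lemma isBornClosed_relSpan :
    IsBornClosed 𝕜 (relSpan 𝕜 V W : Set (FreeSpace 𝕜 V W)) := by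
  intro x l hx hl
  refine (Submodule.mem_sInf).2 fun N hN => hN.1 x l (fun n => ?_) hl
  exact (Submodule.mem_sInf).1 (hx n) N hN

end FreeSpace

/-- The complete projective tensor product of complete convex bornological vector spaces. -/
def Tensor : Type _ := FreeSpace 𝕜 V W ⧸ FreeSpace.relSpan 𝕜 V W

instance : AddCommGroup (Tensor 𝕜 V W) :=
  inferInstanceAs (AddCommGroup (FreeSpace 𝕜 V W ⧸ FreeSpace.relSpan 𝕜 V W))
instance : Module 𝕜 (Tensor 𝕜 V W) :=
  inferInstanceAs (Module 𝕜 (FreeSpace 𝕜 V W ⧸ FreeSpace.relSpan 𝕜 V W))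

/-- The quotient map. -/
def Tensor.mk : FreeSpace 𝕜 V W →ₗ[𝕜] Tensor 𝕜 V W := (FreeSpace.relSpan 𝕜 V W).mkQ

variable {𝕜 V W} in
lemma Tensor.mk_surjective : Function.Surjective (Tensor.mk 𝕜 V W) :=
  Submodule.mkQ_surjective _

/-- The quotient bornology. -/
instance : Bornology (Tensor 𝕜 V W) :=
  Bornology.ofBounded
    {B | ∃ B' : Set (FreeSpace 𝕜 V W), IsBounded B' ∧ B ⊆ Tensor.mk 𝕜 V W '' B'}
    ⟨∅, isBounded_empty, Set.empty_subset _⟩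
    (by
      rintro B ⟨B', hB', hB⟩ B₁ h
      exact ⟨B', hB', h.trans hB⟩)
    (by
      rintro B ⟨B', hB', hB⟩ B₁ ⟨B₁', hB₁', hB₁⟩
      refine ⟨B' ∪ B₁', hB'.union hB₁', ?_⟩
      rw [Set.image_union]
      exact Set.union_subset_union hB hB₁)
    (by
      intro x
      obtain ⟨g, rfl⟩ := Tensor.mk_surjective x
      exact ⟨{g}, isBounded_singleton, by simp⟩)

namespace Tensor

variable {𝕜 V W}

lemma isBounded_iff {B : Set (Tensor 𝕜 V W)} : IsBounded B ↔
    ∃ B' : Set (FreeSpace 𝕜 V W), IsBounded B' ∧ B ⊆ mk 𝕜 V W '' B' :=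
  Bornology.isBounded_ofBounded_iff _

lemma isBounded_iff_ball {B : Set (Tensor 𝕜 V W)} : IsBounded B ↔
    ∃ (S : Set V) (T : Set W) (r : ℝ), IsBounded S ∧ IsBounded T ∧ 0 ≤ r ∧
      B ⊆ mk 𝕜 V W '' FreeSpace.ball S T r := by
  rw [isBounded_iff]
  constructor
  · rintro ⟨B', hB', hB⟩
    obtain ⟨S, T, r, hS, hT, hr⟩ := FreeSpace.isBounded_iff.1 hB'
    exact ⟨S, T, max r 0, hS, hT, le_max_right _ _, hB.trans (Set.image_mono
      (hr.trans (FreeSpace.ball_mono subset_rfl subset_rfl (le_max_left _ _))))⟩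
  · rintro ⟨S, T, r, hS, hT, -, hB⟩
    exact ⟨_, FreeSpace.isBounded_ball hS hT r, hB⟩

lemma boundedMap_mk : BoundedMap (mk 𝕜 V W) := fun B hB => isBounded_iff.2 ⟨B, hB, subset_rfl⟩

instance : BornologicalVectorSpace 𝕜 (Tensor 𝕜 V W) where
  isBounded_add := by
    intro B B₁ hB hB₁
    obtain ⟨B', hB', hB⟩ := isBounded_iff.1 hB
    obtain ⟨B₁', hB₁', hB₁⟩ := isBounded_iff.1 hB₁
    refine isBounded_iff.2 ⟨B' + B₁', BoundedAdd.isBounded_add hB' hB₁', ?_⟩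
    rintro _ ⟨x, hx, y, hy, rfl⟩
    obtain ⟨g, hg, rfl⟩ := hB hx
    obtain ⟨h, hh, rfl⟩ := hB₁ hy
    exact ⟨g + h, Set.add_mem_add hg hh, by simp⟩
  isBounded_smul := by
    intro R B hB
    obtain ⟨B', hB', hB⟩ := isBounded_iff.1 hB
    refine isBounded_iff.2 ⟨_, BornologicalVectorSpace.isBounded_smul (𝕜 := 𝕜) R hB', ?_⟩
    rintro _ ⟨c, hc, x, hx, rfl⟩
    obtain ⟨g, hg, rfl⟩ := hB hx
    exact ⟨c • g, ⟨c, hc, g, hg, rfl⟩, by simp⟩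

/-- The preimage of the closed subspace of relations in `ℓ¹(S × T)` is closed. -/
lemma isClosed_ker {S : Set V} {T : Set W} (hS : IsBounded S) (hT : IsBounded T) :
    IsClosed (LinearMap.ker (mk 𝕜 V W ∘ₗ FreeSpace.incl hS hT) :
      Set (suppIn 𝕜 V W S T)) := by
  have hker : ∀ e : suppIn 𝕜 V W S T, e ∈ LinearMap.ker (mk 𝕜 V W ∘ₗ FreeSpace.incl hS hT) ↔
      FreeSpace.incl hS hT e ∈ FreeSpace.relSpan 𝕜 V W := by
    intro e
    rw [LinearMap.mem_ker, LinearMap.comp_apply]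
    exact Submodule.Quotient.mk_eq_zero _
  apply IsSeqClosed.isClosed
  intro e l he hl
  rw [SetLike.mem_coe, hker]
  refine FreeSpace.isBornClosed_relSpan (fun n => FreeSpace.incl hS hT (e n)) _
    (fun n => (hker _).1 (he n)) ?_
  have hbd : ∃ R, ∀ n, ‖e n‖ ≤ R := by
    obtain ⟨R, hR⟩ := (Metric.isBounded_range_of_tendsto e hl).exists_norm_le
    exact ⟨R, fun n => hR _ ⟨n, rfl⟩⟩
  obtain ⟨R, hR⟩ := hbd
  obtain ⟨D, hD, hDb, hDd⟩ := CompleteConvexSpace.exists_completeDisk (𝕜 := 𝕜) _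
    (FreeSpace.isBounded_ball (𝕜 := 𝕜) hS hT (max (max R ‖l‖) 1))
  refine ⟨D, hDb, hDd.toIsDisk.isCircled, fun n => hD (FreeSpace.incl_mem _ _
    ((hR n).trans ((le_max_left _ _).trans (le_max_left _ _)))), hD (FreeSpace.incl_mem _ _
    ((le_max_right _ _).trans (le_max_left _ _))),
    fun n => ‖e n - l‖ + 1 / ((n : ℝ) + 1), fun n => by positivity, ?_, fun n => ?_⟩
  · have h1 : Tendsto (fun n => ‖e n - l‖) atTop (𝓝 0) := tendsto_iff_norm_sub_tendsto_zero.1 hl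
    simpa using h1.add tendsto_one_div_add_atTop_nhds_zero_nat
  · have hpos : 0 < ‖e n - l‖ + 1 / ((n : ℝ) + 1) := by positivity
    apply mem_smul_set_of_smul_mem hpos
    apply hD
    rw [← map_sub, ← map_smul]
    apply FreeSpace.incl_mem
    rw [norm_smul, norm_inv, RCLike.norm_ofReal, abs_of_pos hpos, inv_mul_le_iff₀ hpos]
    have h2 : (0 : ℝ) < 1 / ((n : ℝ) + 1) := by positivity
    have h3 : 1 ≤ max (max R ‖l‖) 1 := le_max_right _ _
    nlinarith [norm_nonneg (e n - l)]

instance : CompleteConvexSpace 𝕜 (Tensor 𝕜 V W) where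
  exists_completeDisk := by
    intro B hB
    obtain ⟨S, T, r, hS, hT, -, hB⟩ := isBounded_iff_ball.1 hB
    have hr : 0 < max r 1 := by positivity
    have hr' : ((max r 1 : ℝ) : 𝕜) ≠ 0 := by exact_mod_cast hr.ne'
    have hker : IsClosed (LinearMap.ker (((max r 1 : ℝ) : 𝕜) •
        (mk 𝕜 V W ∘ₗ FreeSpace.incl hS hT)) : Set (suppIn 𝕜 V W S T)) := by
      rw [LinearMap.ker_smul _ _ hr']
      exact isClosed_ker hS hT
    obtain ⟨D, hD, h1, h2⟩ := exists_completeDisk_of_isClosed_ker _ hker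
    refine ⟨D, ?_, ?_, hD⟩
    · intro x hx
      obtain ⟨g, hg, rfl⟩ := hB hx
      obtain ⟨e, he, rfl⟩ := FreeSpace.incl_surj hS hT hg
      refine h1 ⟨((max r 1 : ℝ) : 𝕜)⁻¹ • e, ?_, ?_⟩
      · rw [mem_closedBall_zero_iff, norm_smul, norm_inv, RCLike.norm_ofReal, abs_of_pos hr,
          inv_mul_le_iff₀ hr, mul_one]
        exact he.trans (le_max_left _ _)
      · rw [LinearMap.smul_apply, map_smul, smul_smul, mul_inv_cancel₀ hr', one_smul]
        rfl
    · refine isBounded_iff.2 ⟨_, FreeSpace.isBounded_ball hS hT (max r 1 * 2), ?_⟩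
      intro x hx
      obtain ⟨e, he, rfl⟩ := h2 hx
      rw [mem_closedBall_zero_iff] at he
      refine ⟨FreeSpace.incl hS hT (((max r 1 : ℝ) : 𝕜) • e), FreeSpace.incl_mem _ _ ?_, ?_⟩
      · rw [norm_smul, RCLike.norm_ofReal, abs_of_pos hr]
        nlinarith
      · rw [map_smul, map_smul]
        rfl

/-- The elementary tensors `v ⊗ w`, as a bilinear map. -/
def tmul : V →ₗ[𝕜] W →ₗ[𝕜] Tensor 𝕜 V W :=
  LinearMap.mk₂ 𝕜 (fun v w => mk 𝕜 V W (FreeSpace.delta (v, w)))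
    (fun v v' w => by
      rw [← map_add, ← sub_eq_zero, ← map_sub]
      refine (Submodule.Quotient.mk_eq_zero _).2 (FreeSpace.relations_subset ?_)
      exact Or.inl ⟨v, v', w, by abel⟩)
    (fun c v w => by
      rw [← map_smul, ← sub_eq_zero, ← map_sub]
      refine (Submodule.Quotient.mk_eq_zero _).2 (FreeSpace.relations_subset ?_)
      exact Or.inr (Or.inr (Or.inl ⟨c, v, w, rfl⟩)))
    (fun v w w' => by
      rw [← map_add, ← sub_eq_zero, ← map_sub]
      refine (Submodule.Quotient.mk_eq_zero _).2 (FreeSpace.relations_subset ?_)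
      exact Or.inr (Or.inl ⟨v, w, w', by abel⟩))
    (fun c v w => by
      rw [← map_smul, ← sub_eq_zero, ← map_sub]
      refine (Submodule.Quotient.mk_eq_zero _).2 (FreeSpace.relations_subset ?_)
      exact Or.inr (Or.inr (Or.inr ⟨c, v, w, rfl⟩)))

lemma mk_delta (p : V × W) : mk 𝕜 V W (FreeSpace.delta p) = tmul p.1 p.2 := rfl

end Tensor

section Lift

variable {𝕜 V W} {X : Type*} [AddCommGroup X] [Module 𝕜 X] [Bornology X]

/-- A bounded bilinear map. -/
def BoundedBilin (φ : V →ₗ[𝕜] W →ₗ[𝕜] X) : Prop :=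
  ∀ (S : Set V) (T : Set W), IsBounded S → IsBounded T →
    IsBounded (Set.image2 (fun v w => φ v w) S T)

lemma Tensor.boundedBilin_tmul : BoundedBilin (Tensor.tmul (𝕜 := 𝕜) (V := V) (W := W)) := by
  intro S T hS hT
  refine Tensor.isBounded_iff.2 ⟨_, FreeSpace.isBounded_ball hS hT 1, ?_⟩
  rintro _ ⟨v, hv, w, hw, rfl⟩
  exact ⟨FreeSpace.delta (v, w), FreeSpace.delta_mem_ball hv hw, rfl⟩

lemma FreeSpace.summable (g : FreeSpace 𝕜 V W) : Summable fun p => ‖coeL 𝕜 V W g p‖ := by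
  have := (lp.memℓp (coeL 𝕜 V W g)).summable (by simp)
  simpa using this

lemma FreeSpace.norm_eq (g : FreeSpace 𝕜 V W) :
    ‖coeL 𝕜 V W g‖ = ∑' p, ‖coeL 𝕜 V W g p‖ := by
  rw [lp.norm_eq_tsum_rpow (by simp)]
  simp

variable [CompleteConvexSpace 𝕜 X]

lemma FreeSpace.exists_hasBornSum_mem (φ : V →ₗ[𝕜] W →ₗ[𝕜] X) {S : Set V} {T : Set W} {D : Set X}
    (hDb : IsBounded D) (hD : IsCompleteDisk 𝕜 D) (h : ∀ v ∈ S, ∀ w ∈ T, φ v w ∈ D) {r : ℝ}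
    {g : FreeSpace 𝕜 V W} (hg : g ∈ ball S T r) :
    ∃ x ∈ (r : 𝕜) • D, HasBornSum 𝕜 (fun p => coeL 𝕜 V W g p • φ p.1 p.2) x := by
  obtain ⟨x, hx, hs⟩ := hD.exists_sum _ g.summable (fun p : V × W => φ p.1 p.2) (by
    intro p hp
    by_cases hp' : p ∈ S ×ˢ T
    · exact h _ hp'.1 _ hp'.2
    · exact absurd (hg.1 p hp') hp)
  refine ⟨x, hD.smul_mono (tsum_nonneg fun _ => norm_nonneg _) ?_ hx, D, hDb, hD.toIsDisk, hs⟩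
  rw [← FreeSpace.norm_eq]
  exact hg.2

lemma FreeSpace.exists_hasBornSum (φ : V →ₗ[𝕜] W →ₗ[𝕜] X) (hφ : BoundedBilin φ)
    (g : FreeSpace 𝕜 V W) :
    ∃ x, HasBornSum 𝕜 (fun p => coeL 𝕜 V W g p • φ p.1 p.2) x := by
  obtain ⟨S, T, hS, hT, hg⟩ := g.exists_mem_ball
  obtain ⟨D, hD, hDb, hDd⟩ := CompleteConvexSpace.exists_completeDisk (𝕜 := 𝕜) _ (hφ S T hS hT)
  obtain ⟨x, -, hx⟩ := FreeSpace.exists_hasBornSum_mem φ hDb hDd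
    (fun v hv w hw => hD ⟨v, hv, w, hw, rfl⟩) hg
  exact ⟨x, hx⟩

/-- The extension of a bounded bilinear map to the free space. -/
def FreeSpace.lift (φ : V →ₗ[𝕜] W →ₗ[𝕜] X) (hφ : BoundedBilin φ) : FreeSpace 𝕜 V W →ₗ[𝕜] X where
  toFun g := (FreeSpace.exists_hasBornSum φ hφ g).choose
  map_add' g h := by
    refine (FreeSpace.exists_hasBornSum φ hφ (g + h)).choose_spec.unique (𝕜 := 𝕜) ?_
    have := (FreeSpace.exists_hasBornSum φ hφ g).choose_spec.add
      (FreeSpace.exists_hasBornSum φ hφ h).choose_spec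
    refine (congrArg (fun F => HasBornSum 𝕜 F _) (funext fun p => ?_)).mp this
    simp [add_smul]
  map_smul' c g := by
    refine (FreeSpace.exists_hasBornSum φ hφ (c • g)).choose_spec.unique (𝕜 := 𝕜) ?_
    have := (FreeSpace.exists_hasBornSum φ hφ g).choose_spec.smul c
    refine (congrArg (fun F => HasBornSum 𝕜 F _) (funext fun p => ?_)).mp this
    simp [mul_smul]

lemma FreeSpace.hasBornSum_lift (φ : V →ₗ[𝕜] W →ₗ[𝕜] X) (hφ : BoundedBilin φ)
    (g : FreeSpace 𝕜 V W) :
    HasBornSum 𝕜 (fun p => coeL 𝕜 V W g p • φ p.1 p.2) (FreeSpace.lift φ hφ g) :=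
  (FreeSpace.exists_hasBornSum φ hφ g).choose_spec

lemma FreeSpace.lift_mem (φ : V →ₗ[𝕜] W →ₗ[𝕜] X) (hφ : BoundedBilin φ) {S : Set V} {T : Set W}
    {D : Set X} (hDb : IsBounded D) (hD : IsCompleteDisk 𝕜 D) (h : ∀ v ∈ S, ∀ w ∈ T, φ v w ∈ D)
    {r : ℝ} {g : FreeSpace 𝕜 V W} (hg : g ∈ ball S T r) :
    FreeSpace.lift φ hφ g ∈ (r : 𝕜) • D := by
  obtain ⟨x, hx, hs⟩ := FreeSpace.exists_hasBornSum_mem φ hDb hD h hg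
  rwa [(FreeSpace.hasBornSum_lift φ hφ g).unique hs]

lemma isBounded_smul_set {D : Set X} (hD : IsBounded D) (c : 𝕜) : IsBounded (c • D) := by
  refine (BornologicalVectorSpace.isBounded_smul (𝕜 := 𝕜) ‖c‖ hD).subset ?_
  rintro _ ⟨d, hd, rfl⟩
  exact ⟨c, le_rfl, d, hd, rfl⟩

lemma FreeSpace.boundedMap_lift (φ : V →ₗ[𝕜] W →ₗ[𝕜] X) (hφ : BoundedBilin φ) :
    BoundedMap (FreeSpace.lift φ hφ) := by
  intro B hB
  obtain ⟨S, T, r, hS, hT, hB⟩ := FreeSpace.isBounded_iff.1 hB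
  obtain ⟨D, hD, hDb, hDd⟩ := CompleteConvexSpace.exists_completeDisk (𝕜 := 𝕜) _ (hφ S T hS hT)
  refine (isBounded_smul_set hDb (r : 𝕜)).subset ?_
  rintro _ ⟨g, hg, rfl⟩
  exact FreeSpace.lift_mem φ hφ hDb hDd (fun v hv w hw => hD ⟨v, hv, w, hw, rfl⟩) (hB hg)

lemma FreeSpace.lift_delta (φ : V →ₗ[𝕜] W →ₗ[𝕜] X) (hφ : BoundedBilin φ) (p : V × W) :
    FreeSpace.lift φ hφ (delta p) = φ p.1 p.2 := by
  classical
  refine (FreeSpace.hasBornSum_lift φ hφ (delta p)).unique (𝕜 := 𝕜) ?_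
  refine ⟨{0}, isBounded_singleton, ⟨rfl, by simp, ?_⟩, fun ε _ => ⟨{p}, fun s hs => ?_⟩⟩
  · intro x hx
    simpa using hx 2 one_lt_two
  · have h1 : ∀ q, q ≠ p → coeL 𝕜 V W (delta p) q = 0 := fun q hq =>
      lp.single_apply_ne (E := fun _ : V × W => 𝕜) _ _ _ hq
    have h2 : coeL 𝕜 V W (delta p) p = 1 := lp.single_apply_self (E := fun _ : V × W => 𝕜) _ _ _
    rw [Finset.sum_eq_single_of_mem p (hs (by simp)) fun q _ hq => by rw [h1 q hq, zero_smul], h2]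
    simp

lemma FreeSpace.relSpan_le_ker (φ : V →ₗ[𝕜] W →ₗ[𝕜] X) (hφ : BoundedBilin φ) :
    relSpan 𝕜 V W ≤ LinearMap.ker (FreeSpace.lift φ hφ) := by
  refine sInf_le ⟨isBornClosed_ker _ (FreeSpace.boundedMap_lift φ hφ), ?_⟩
  rintro x (⟨v, v', w, rfl⟩ | ⟨v, w, w', rfl⟩ | ⟨c, v, w, rfl⟩ | ⟨c, v, w, rfl⟩) <;>
    simp [FreeSpace.lift_delta]

namespace Tensor

/-- The universal property: the bounded linear map on the tensor product that corresponds to a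
bounded bilinear map into a complete convex bornological vector space. -/
def lift (φ : V →ₗ[𝕜] W →ₗ[𝕜] X) (hφ : BoundedBilin φ) : Tensor 𝕜 V W →ₗ[𝕜] X :=
  (FreeSpace.relSpan 𝕜 V W).liftQ (FreeSpace.lift φ hφ) (FreeSpace.relSpan_le_ker φ hφ)

lemma lift_mk (φ : V →ₗ[𝕜] W →ₗ[𝕜] X) (hφ : BoundedBilin φ) (g : FreeSpace 𝕜 V W) :
    lift φ hφ (mk 𝕜 V W g) = FreeSpace.lift φ hφ g := Submodule.liftQ_apply _ _ _

@[simp] lemma lift_tmul (φ : V →ₗ[𝕜] W →ₗ[𝕜] X) (hφ : BoundedBilin φ) (v : V) (w : W) :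
    lift φ hφ (tmul v w) = φ v w := by
  rw [← mk_delta (v, w), lift_mk, FreeSpace.lift_delta]

lemma lift_mem (φ : V →ₗ[𝕜] W →ₗ[𝕜] X) (hφ : BoundedBilin φ) {S : Set V} {T : Set W}
    {D : Set X} (hDb : IsBounded D) (hD : IsCompleteDisk 𝕜 D) (h : ∀ v ∈ S, ∀ w ∈ T, φ v w ∈ D)
    {r : ℝ} {x : Tensor 𝕜 V W} (hx : x ∈ mk 𝕜 V W '' FreeSpace.ball S T r) :
    lift φ hφ x ∈ (r : 𝕜) • D := by
  obtain ⟨g, hg, rfl⟩ := hx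
  rw [lift_mk]
  exact FreeSpace.lift_mem φ hφ hDb hD h hg

lemma boundedMap_lift (φ : V →ₗ[𝕜] W →ₗ[𝕜] X) (hφ : BoundedBilin φ) :
    BoundedMap (lift φ hφ) := by
  intro B hB
  obtain ⟨B', hB', hB⟩ := isBounded_iff.1 hB
  refine (FreeSpace.boundedMap_lift φ hφ B' hB').subset ?_
  rintro _ ⟨x, hx, rfl⟩
  obtain ⟨g, hg, rfl⟩ := hB hx
  exact ⟨g, hg, (lift_mk φ hφ g).symm⟩

/-- Bounded linear maps that agree on elementary tensors are equal. -/
lemma ext {Φ Ψ : Tensor 𝕜 V W →ₗ[𝕜] X} (hΦ : BoundedMap Φ) (hΨ : BoundedMap Ψ)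
    (h : ∀ v w, Φ (tmul v w) = Ψ (tmul v w)) : Φ = Ψ := by
  ext x
  obtain ⟨g, rfl⟩ := mk_surjective x
  have hg := (FreeSpace.hasBornSum_delta g).map (mk 𝕜 V W) boundedMap_mk
  have h1 := hg.map Φ hΦ
  have h2 := hg.map Ψ hΨ
  refine h1.unique (𝕜 := 𝕜) ?_
  refine (congrArg (fun F => HasBornSum 𝕜 F _) (funext fun p => ?_)).mp h2
  simp [mk_delta, h]

end Tensor

end Lift

end Tensor

section TensorAlgebra

/-! ### The tensor product of algebras -/

section BoundedMap

variable {𝕜 : Type*} [RCLike 𝕜] {X Y Z : Type*} [AddCommGroup X] [Module 𝕜 X] [Bornology X]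
  [AddCommGroup Y] [Module 𝕜 Y] [Bornology Y] [AddCommGroup Z] [Module 𝕜 Z] [Bornology Z]

lemma BoundedMap.add [BoundedAdd Y] {Φ Ψ : X →ₗ[𝕜] Y} (hΦ : BoundedMap Φ) (hΨ : BoundedMap Ψ) :
    BoundedMap (Φ + Ψ) := by
  intro S hS
  refine (BoundedAdd.isBounded_add (hΦ S hS) (hΨ S hS)).subset ?_
  rintro _ ⟨x, hx, rfl⟩
  exact Set.add_mem_add ⟨x, hx, rfl⟩ ⟨x, hx, rfl⟩

lemma BoundedMap.const_smul [BornologicalVectorSpace 𝕜 Y] {Φ : X →ₗ[𝕜] Y} (hΦ : BoundedMap Φ)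
    (c : 𝕜) : BoundedMap (c • Φ) := by
  intro S hS
  refine (BornologicalVectorSpace.isBounded_smul (𝕜 := 𝕜) ‖c‖ (hΦ S hS)).subset ?_
  rintro _ ⟨x, hx, rfl⟩
  exact ⟨c, le_rfl, Φ x, ⟨x, hx, rfl⟩, rfl⟩

lemma BoundedMap.comp {Φ : X →ₗ[𝕜] Y} {Ψ : Y →ₗ[𝕜] Z} (hΨ : BoundedMap Ψ) (hΦ : BoundedMap Φ) :
    BoundedMap (Ψ ∘ₗ Φ) := by
  intro S hS
  rw [LinearMap.coe_comp, Set.image_comp]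
  exact hΨ _ (hΦ S hS)

lemma boundedMap_id : BoundedMap (id : X → X) := fun S hS => by simpa using hS

end BoundedMap

namespace Tensor

variable {𝕜 : Type*} [RCLike 𝕜] {A C : Type*}
  [NonUnitalRing A] [Module 𝕜 A] [IsScalarTower 𝕜 A A] [SMulCommClass 𝕜 A A] [Bornology A]
  [CompleteConvexAlgebra 𝕜 A]
  [NonUnitalRing C] [Module 𝕜 C] [IsScalarTower 𝕜 C C] [SMulCommClass 𝕜 C C] [Bornology C]
  [CompleteConvexAlgebra 𝕜 C]

variable (𝕜) in
/-- The bilinear map `(a', c') ↦ a a' ⊗ c c'`. -/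
def leftMulBilin (a : A) (c : C) : A →ₗ[𝕜] C →ₗ[𝕜] Tensor 𝕜 A C :=
  (tmul (𝕜 := 𝕜)).compl₁₂ (LinearMap.mulLeft 𝕜 a) (LinearMap.mulLeft 𝕜 c)

lemma leftMulBilin_apply (a a' : A) (c c' : C) :
    leftMulBilin 𝕜 a c a' c' = tmul (a * a') (c * c') := rfl

variable (𝕜) in
lemma boundedMul_of_algebra (A : Type*) [NonUnitalRing A] [Module 𝕜 A] [IsScalarTower 𝕜 A A]
    [SMulCommClass 𝕜 A A] [Bornology A] [h : CompleteConvexAlgebra 𝕜 A] : BoundedMul A :=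
  h.toBoundedMul

lemma exists_disk_mul {S S' : Set A} {T T' : Set C} (hS : IsBounded S) (hS' : IsBounded S')
    (hT : IsBounded T) (hT' : IsBounded T') : ∃ D : Set (Tensor 𝕜 A C), IsBounded D ∧
      IsCompleteDisk 𝕜 D ∧ ∀ a ∈ S, ∀ c ∈ T, ∀ a' ∈ S', ∀ c' ∈ T',
        leftMulBilin 𝕜 a c a' c' ∈ D := by
  have := boundedMul_of_algebra 𝕜 A
  have := boundedMul_of_algebra 𝕜 C
  obtain ⟨D, hD, hDb, hDd⟩ := CompleteConvexSpace.exists_completeDisk (𝕜 := 𝕜) _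
    (boundedBilin_tmul (𝕜 := 𝕜) (S * S') (T * T') (BoundedMul.isBounded_mul hS hS')
      (BoundedMul.isBounded_mul hT hT'))
  exact ⟨D, hDb, hDd, fun a ha c hc a' ha' c' hc' =>
    hD ⟨_, Set.mul_mem_mul ha ha', _, Set.mul_mem_mul hc hc', rfl⟩⟩

variable (𝕜) in
lemma boundedBilin_leftMulBilin (a : A) (c : C) : BoundedBilin (leftMulBilin 𝕜 a c) := by
  intro S T hS hT
  obtain ⟨D, hDb, -, hD⟩ := exists_disk_mul (𝕜 := 𝕜) (isBounded_singleton (x := a)) hS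
    (isBounded_singleton (x := c)) hT
  refine hDb.subset ?_
  rintro _ ⟨a', ha', c', hc', rfl⟩
  exact hD a rfl c rfl a' ha' c' hc'

variable (𝕜) in
/-- Left multiplication by `a ⊗ c`. -/
def leftMul (a : A) (c : C) : Tensor 𝕜 A C →ₗ[𝕜] Tensor 𝕜 A C :=
  lift (leftMulBilin 𝕜 a c) (boundedBilin_leftMulBilin 𝕜 a c)

lemma boundedMap_leftMul (a : A) (c : C) : BoundedMap (leftMul 𝕜 a c) := boundedMap_lift _ _

lemma leftMul_tmul (a a' : A) (c c' : C) :
    leftMul 𝕜 a c (tmul a' c') = tmul (a * a') (c * c') := lift_tmul _ _ _ _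

/-- The bilinear map `(a, c) ↦ (a ⊗ c) q`. -/
def rightMulBilin (q : Tensor 𝕜 A C) : A →ₗ[𝕜] C →ₗ[𝕜] Tensor 𝕜 A C :=
  LinearMap.mk₂ 𝕜 (fun a c => leftMul 𝕜 a c q)
    (fun a a' c => by
      rw [← LinearMap.add_apply]
      refine LinearMap.congr_fun (ext (boundedMap_leftMul _ _)
        ((boundedMap_leftMul _ _).add (boundedMap_leftMul _ _)) fun v w => ?_) q
      simp [leftMul_tmul, add_mul])
    (fun k a c => by
      rw [← LinearMap.smul_apply]
      refine LinearMap.congr_fun (ext (boundedMap_leftMul _ _)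
        ((boundedMap_leftMul _ _).const_smul k) fun v w => ?_) q
      simp [leftMul_tmul, smul_mul_assoc])
    (fun a c c' => by
      rw [← LinearMap.add_apply]
      refine LinearMap.congr_fun (ext (boundedMap_leftMul _ _)
        ((boundedMap_leftMul _ _).add (boundedMap_leftMul _ _)) fun v w => ?_) q
      simp [leftMul_tmul, add_mul])
    (fun k a c => by
      rw [← LinearMap.smul_apply]
      refine LinearMap.congr_fun (ext (boundedMap_leftMul _ _)
        ((boundedMap_leftMul _ _).const_smul k) fun v w => ?_) q
      simp [leftMul_tmul, smul_mul_assoc])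

lemma exists_disk_rightMul {S S' : Set A} {T T' : Set C} (hS : IsBounded S) (hS' : IsBounded S')
    (hT : IsBounded T) (hT' : IsBounded T') (r : ℝ) : ∃ D : Set (Tensor 𝕜 A C), IsBounded D ∧
      IsCompleteDisk 𝕜 D ∧ ∀ q ∈ mk 𝕜 A C '' FreeSpace.ball S' T' r, ∀ a ∈ S, ∀ c ∈ T,
        rightMulBilin q a c ∈ D := by
  obtain ⟨D, hDb, hDd, hD⟩ := exists_disk_mul (𝕜 := 𝕜) hS hS' hT hT'
  obtain ⟨D', hD', hDb', hDd'⟩ := CompleteConvexSpace.exists_completeDisk (𝕜 := 𝕜) _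
    (isBounded_smul_set hDb (r : 𝕜))
  refine ⟨D', hDb', hDd', fun q hq a ha c hc => hD' ?_⟩
  exact lift_mem _ (boundedBilin_leftMulBilin 𝕜 a c) hDb hDd (hD a ha c hc) hq

lemma exists_ball (q : Tensor 𝕜 A C) : ∃ (S : Set A) (T : Set C) (r : ℝ), IsBounded S ∧
    IsBounded T ∧ q ∈ mk 𝕜 A C '' FreeSpace.ball S T r := by
  obtain ⟨S, T, r, hS, hT, -, h⟩ := isBounded_iff_ball.1 (isBounded_singleton (x := q))
  exact ⟨S, T, r, hS, hT, h rfl⟩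

lemma boundedBilin_rightMulBilin (q : Tensor 𝕜 A C) : BoundedBilin (rightMulBilin q) := by
  intro S T hS hT
  obtain ⟨S', T', r, hS', hT', hq⟩ := exists_ball q
  obtain ⟨D, hDb, -, hD⟩ := exists_disk_rightMul (𝕜 := 𝕜) hS hS' hT hT' r
  refine hDb.subset ?_
  rintro _ ⟨a, ha, c, hc, rfl⟩
  exact hD q hq a ha c hc

/-- Right multiplication by `q`. -/
def rightMul (q : Tensor 𝕜 A C) : Tensor 𝕜 A C →ₗ[𝕜] Tensor 𝕜 A C :=
  lift (rightMulBilin q) (boundedBilin_rightMulBilin q)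

lemma boundedMap_rightMul (q : Tensor 𝕜 A C) : BoundedMap (rightMul q) := boundedMap_lift _ _

lemma rightMul_tmul (q : Tensor 𝕜 A C) (a : A) (c : C) :
    rightMul q (tmul a c) = leftMul 𝕜 a c q := lift_tmul _ _ _ _

/-- The multiplication on the tensor product: the unique bounded bilinear map with
`(a ⊗ c) (a' ⊗ c') = a a' ⊗ c c'`. -/
instance : Mul (Tensor 𝕜 A C) := ⟨fun p q => rightMul q p⟩

lemma mul_def (p q : Tensor 𝕜 A C) : p * q = rightMul q p := rfl

lemma tmul_mul (a : A) (c : C) (q : Tensor 𝕜 A C) : tmul a c * q = leftMul 𝕜 a c q :=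
  rightMul_tmul q a c

lemma tmul_mul_tmul (a a' : A) (c c' : C) :
    (tmul a c * tmul a' c' : Tensor 𝕜 A C) = tmul (a * a') (c * c') := by
  rw [tmul_mul, leftMul_tmul]

lemma isBounded_mul' {P Q : Set (Tensor 𝕜 A C)} (hP : IsBounded P) (hQ : IsBounded Q) :
    IsBounded (P * Q) := by
  obtain ⟨S, T, r, hS, hT, -, hP⟩ := isBounded_iff_ball.1 hP
  obtain ⟨S', T', r', hS', hT', -, hQ⟩ := isBounded_iff_ball.1 hQ
  obtain ⟨D, hDb, hDd, hD⟩ := exists_disk_rightMul (𝕜 := 𝕜) hS hS' hT hT' r'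
  refine (isBounded_smul_set hDb (r : 𝕜)).subset ?_
  rintro _ ⟨p, hp, q, hq, rfl⟩
  exact lift_mem _ (boundedBilin_rightMulBilin q) hDb hDd (hD q (hQ hq)) (hP hp)

instance : BoundedMul (Tensor 𝕜 A C) := ⟨isBounded_mul'⟩

lemma right_add (p q q' : Tensor 𝕜 A C) : p * (q + q') = p * q + p * q' := by
  have : rightMul (q + q') = rightMul q + rightMul q' :=
    ext (boundedMap_rightMul _) ((boundedMap_rightMul _).add (boundedMap_rightMul _))
      fun v w => by simp [rightMul_tmul]
  exact LinearMap.congr_fun this p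

lemma right_smul (p : Tensor 𝕜 A C) (k : 𝕜) (q : Tensor 𝕜 A C) : p * (k • q) = k • (p * q) := by
  have : rightMul (k • q) = k • rightMul q :=
    ext (boundedMap_rightMul _) ((boundedMap_rightMul _).const_smul k)
      fun v w => by simp [rightMul_tmul]
  exact LinearMap.congr_fun this p

/-- Left multiplication by `p`. -/
def leftMul' (p : Tensor 𝕜 A C) : Tensor 𝕜 A C →ₗ[𝕜] Tensor 𝕜 A C where
  toFun q := p * q
  map_add' := right_add p
  map_smul' k q := right_smul p k q

@[simp] lemma leftMul'_apply (p q : Tensor 𝕜 A C) : leftMul' p q = p * q := rfl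

lemma boundedMap_leftMul' (p : Tensor 𝕜 A C) : BoundedMap (leftMul' p) := by
  intro Q hQ
  refine (isBounded_mul' (isBounded_singleton (x := p)) hQ).subset ?_
  intro y hy
  obtain ⟨q, hq, hy⟩ := hy
  rw [leftMul'_apply] at hy
  exact Set.mem_mul.2 ⟨p, Set.mem_singleton p, q, hq, hy⟩

lemma mul_assoc' (p q r : Tensor 𝕜 A C) : p * q * r = p * (q * r) := by
  have h1 : ∀ (a : A) (c : C) (a' : A) (c' : C) (r : Tensor 𝕜 A C),
      tmul a c * tmul a' c' * r = tmul a c * (tmul a' c' * r) := by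
    intro a c a' c' r
    have : leftMul' (tmul a c * tmul a' c' : Tensor 𝕜 A C) =
        leftMul' (tmul a c) ∘ₗ leftMul' (tmul a' c') :=
      ext (boundedMap_leftMul' _) ((boundedMap_leftMul' _).comp (boundedMap_leftMul' _))
        fun v w => by simp [leftMul', tmul_mul_tmul, mul_assoc]
    exact LinearMap.congr_fun this r
  have h2 : ∀ (a : A) (c : C) (q r : Tensor 𝕜 A C),
      tmul a c * q * r = tmul a c * (q * r) := by
    intro a c q r
    have : rightMul r ∘ₗ leftMul' (tmul a c) = leftMul' (tmul a c) ∘ₗ rightMul r :=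
      ext ((boundedMap_rightMul _).comp (boundedMap_leftMul' _))
        ((boundedMap_leftMul' _).comp (boundedMap_rightMul _)) fun v w => h1 a c v w r
    exact LinearMap.congr_fun this q
  have : rightMul r ∘ₗ rightMul q = rightMul (q * r) :=
    ext ((boundedMap_rightMul _).comp (boundedMap_rightMul _)) (boundedMap_rightMul _)
      fun v w => h2 v w q r
  exact LinearMap.congr_fun this p

/-- The tensor product of two complete convex bornological algebras is an algebra. -/
instance : NonUnitalRing (Tensor 𝕜 A C) where
  left_distrib := right_add
  right_distrib p p' q := map_add (rightMul q) p p'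
  zero_mul q := map_zero (rightMul q)
  mul_zero p := map_zero (leftMul' p)
  mul_assoc := mul_assoc'

instance : IsScalarTower 𝕜 (Tensor 𝕜 A C) (Tensor 𝕜 A C) :=
  ⟨fun k p q => map_smul (rightMul q) k p⟩

instance : SMulCommClass 𝕜 (Tensor 𝕜 A C) (Tensor 𝕜 A C) :=
  ⟨fun k p q => (right_smul p k q).symm⟩

instance : CompleteConvexAlgebra 𝕜 (Tensor 𝕜 A C) where

variable {B D : Type*}
  [NonUnitalRing B] [Module 𝕜 B] [IsScalarTower 𝕜 B B] [SMulCommClass 𝕜 B B] [Bornology B]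
  [CompleteConvexAlgebra 𝕜 B]
  [NonUnitalRing D] [Module 𝕜 D] [IsScalarTower 𝕜 D D] [SMulCommClass 𝕜 D D] [Bornology D]
  [CompleteConvexAlgebra 𝕜 D]

/-- The bilinear map `(a, c) ↦ f a ⊗ g c`. -/
def mapBilin (f : A →ₙₐ[𝕜] B) (g : C →ₙₐ[𝕜] D) : A →ₗ[𝕜] C →ₗ[𝕜] Tensor 𝕜 B D :=
  (tmul (𝕜 := 𝕜)).compl₁₂ (f : A →ₗ[𝕜] B) (g : C →ₗ[𝕜] D)

lemma boundedBilin_mapBilin {f : A →ₙₐ[𝕜] B} {g : C →ₙₐ[𝕜] D} (hf : BoundedMap f)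
    (hg : BoundedMap g) : BoundedBilin (mapBilin f g) := by
  intro S T hS hT
  refine (boundedBilin_tmul (𝕜 := 𝕜) _ _ (hf S hS) (hg T hT)).subset ?_
  rintro _ ⟨a, ha, c, hc, rfl⟩
  exact ⟨f a, ⟨a, ha, rfl⟩, g c, ⟨c, hc, rfl⟩, rfl⟩

/-- The tensor product `f ⊗ g` of two bounded algebra homomorphisms: the unique bounded linear map
with `a ⊗ c ↦ f a ⊗ g c`. -/
def map (f : A →ₙₐ[𝕜] B) (g : C →ₙₐ[𝕜] D) (hf : BoundedMap f) (hg : BoundedMap g) :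
    Tensor 𝕜 A C →ₙₐ[𝕜] Tensor 𝕜 B D :=
  { lift (mapBilin f g) (boundedBilin_mapBilin hf hg) with
    map_zero' := map_zero (lift (mapBilin f g) (boundedBilin_mapBilin hf hg))
    map_mul' := by
      intro p q
      have hb := boundedMap_lift (mapBilin f g) (boundedBilin_mapBilin hf hg)
      set Φ := lift (mapBilin f g) (boundedBilin_mapBilin hf hg) with hΦ
      have ht : ∀ a c, Φ (tmul a c) = tmul (f a) (g c) := fun a c => lift_tmul _ _ _ _
      change Φ (p * q) = Φ p * Φ q
      have h1 : ∀ (a : A) (c : C) (q : Tensor 𝕜 A C), Φ (tmul a c * q) = Φ (tmul a c) * Φ q := by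
        intro a c q
        have : Φ ∘ₗ leftMul' (tmul a c) = leftMul' (Φ (tmul a c)) ∘ₗ Φ :=
          ext (hb.comp (boundedMap_leftMul' _)) ((boundedMap_leftMul' _).comp hb)
            fun v w => by simp [leftMul', tmul_mul_tmul, ht]
        exact LinearMap.congr_fun this q
      have : Φ ∘ₗ rightMul q = rightMul (Φ q) ∘ₗ Φ :=
        ext (hb.comp (boundedMap_rightMul _)) ((boundedMap_rightMul _).comp hb)
          fun v w => h1 v w q
      exact LinearMap.congr_fun this p }

@[simp] lemma map_tmul (f : A →ₙₐ[𝕜] B) (g : C →ₙₐ[𝕜] D) (hf : BoundedMap f) (hg : BoundedMap g)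
    (a : A) (c : C) : map f g hf hg (tmul a c) = tmul (f a) (g c) :=
  lift_tmul (mapBilin f g) (boundedBilin_mapBilin hf hg) a c

lemma boundedMap_map (f : A →ₙₐ[𝕜] B) (g : C →ₙₐ[𝕜] D) (hf : BoundedMap f) (hg : BoundedMap g) :
    BoundedMap (map f g hf hg) :=
  boundedMap_lift (mapBilin f g) (boundedBilin_mapBilin hf hg)

end Tensor

end TensorAlgebra

end

end BornAlg

/-!
The tensor product of an isoradial homomorphism `f : A → B` with the identity of a nuclear locally
multiplicative algebra `C` is isoradial.

Local multiplicativity of `A ⊗ C`: a bounded subset lies in a multiple of the disked hull of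
`S ⊗ T` with `S` and `T` bounded. After rescaling, the powers of `S` and of `T` are jointly bounded,
hence so are those of `S ⊗ T`, and passing to hulls preserves this
(`isBounded_setPowInfty_diskHull`).

Local density of the range: an element of `B ⊗ C` is an absolutely convergent series
`∑ λ_p b_p ⊗ c_p`; it is approximated by a partial sum in which the finitely many `b_p` are replaced
by elements of `f(A)`, uniformly on bounded subsets (`Tensor.isLocallyDense_range_map`).

Spectral radii: let `S ⊆ A ⊗ C` be bounded, and let the powers of its image `F(S)` be jointly
bounded in `B ⊗ C`. They lie in a ball of `B_U ⊗ C_T` for complete bounded disks `U` and `T`, where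
`T` may be chosen so large that every power `S ^ k` lies in `A_{S_k} ⊗ C_T` for some `S_k`. A nuclear
representation `z = ∑ cₙ φₙ(z) yₙ` on `C_T` gives `x = ∑ cₙ uₙ ⊗ yₙ` for `x ∈ S ^ k`, where
`uₙ ∈ A` is the slice of `x` by `φₙ`. The slices of all `x ∈ S ^ k` form a bounded subset of `A`,
whose image in `B` lies in a multiple of `U` that does not depend on `k`, because `f(uₙ)` is the
slice of `F(x)` by `φₙ`. As `f` preserves spectral radii, the spectral radius of this set of slices
is bounded independently of `k`, and then so is that of `S ^ k` (`Tensor.exists_uniform_bound`).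
Taking `k`-th roots, the spectral radius of `S` is at most `1`
(`Tensor.isBounded_setPowInfty_of_map`).

The slice of `F(x)` by `φₙ` needs care: `φₙ` is a functional on `C_T` only, and different
representatives of `F(x)` in `B_U ⊗ C_T` agree merely in `B ⊗ C`. That the slice does not depend on
the representative is `FreeSpace.pair_eq_of_mk_eq`. Its proof exhibits a closed subspace of the free
space that contains the relations of bilinearity and on which all `ψ ⊗ φ` vanish. The delicate point,
that these conditions form a subspace, is the Hahn–Banach argument in
`FreeSpace.pair_eq_zero_of_subset`.
-/

namespace BornAlg

set_option linter.unusedSectionVars false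

noncomputable section

/-! ### Complete disks as Banach spaces -/

section Disks

variable {𝕜 : Type*} [RCLike 𝕜] {V : Type*} [AddCommGroup V] [Module 𝕜 V]

/-- The series `∑ᵢ f i` converges to `x`, unconditionally, in the normed space `V_D`. In contrast to
`HasBornSum`, the disk is prescribed. -/
def HasSumIn (𝕜 : Type*) [RCLike 𝕜] {V : Type*} [AddCommGroup V] [Module 𝕜 V] (D : Set V)
    {ι : Type*} (f : ι → V) (x : V) : Prop :=
  ∀ ε : ℝ, 0 < ε → ∃ s₀ : Finset ι, ∀ s : Finset ι, s₀ ⊆ s → ∑ i ∈ s, f i - x ∈ (ε : 𝕜) • D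

lemma IsDisk.mem_span {D : Set V} (hD : IsDisk 𝕜 D) {x : V} (hx : x ∈ Submodule.span 𝕜 D) :
    ∃ r : ℝ, 0 < r ∧ x ∈ (r : 𝕜) • D := by
  induction hx using Submodule.span_induction with
  | mem x hx => exact ⟨1, one_pos, by simpa using hx⟩
  | zero => exact ⟨1, one_pos, by simpa using hD.zero_mem⟩
  | add x y _ _ hx hy =>
    obtain ⟨r, hr, hx⟩ := hx
    obtain ⟨s, hs, hy⟩ := hy
    exact ⟨r + s, add_pos hr hs, hD.add_mem_smul hr.le hs.le hx hy⟩
  | smul c x _ hx =>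
    obtain ⟨r, hr, hx⟩ := hx
    exact ⟨‖c‖ * r + 1, by positivity, hD.smul_mem_smul hr.le hx c (by linarith)⟩

/-- The gauge of `D`. It is a seminorm only on the span of `D`; elsewhere the infimum is taken over
the empty set. -/
def diskGauge (𝕜 : Type*) [RCLike 𝕜] {V : Type*} [AddCommGroup V] [Module 𝕜 V] (D : Set V)
    (x : V) : ℝ :=
  sInf {r : ℝ | 0 < r ∧ x ∈ (r : 𝕜) • D}

lemma diskGauge_nonneg (D : Set V) (x : V) : 0 ≤ diskGauge 𝕜 D x :=
  Real.sInf_nonneg fun _ hr => hr.1.le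

lemma diskGauge_le {D : Set V} {x : V} {r : ℝ} (hr : 0 < r) (hx : x ∈ (r : 𝕜) • D) :
    diskGauge 𝕜 D x ≤ r :=
  csInf_le ⟨0, fun _ hr => hr.1.le⟩ ⟨hr, hx⟩

lemma IsDisk.exists_of_diskGauge_lt {D : Set V} (hD : IsDisk 𝕜 D) {x : V}
    (hx : x ∈ Submodule.span 𝕜 D) {r : ℝ} (h : diskGauge 𝕜 D x < r) :
    ∃ s : ℝ, 0 < s ∧ x ∈ (s : 𝕜) • D ∧ s < r := by
  obtain ⟨s, hs, hsr⟩ := exists_lt_of_csInf_lt (hD.mem_span hx) h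
  exact ⟨s, hs.1, hs.2, hsr⟩

/-- The gauge of a disk `D`, as a seminorm on the linear span `V_D`. -/
def IsDisk.seminorm {D : Set V} (hD : IsDisk 𝕜 D) : Seminorm 𝕜 (Submodule.span 𝕜 D) :=
  Seminorm.ofSMulLE (fun x => diskGauge 𝕜 D (x : V))
    (by
      refine le_antisymm (le_of_forall_pos_le_add fun ε hε => ?_) (diskGauge_nonneg _ _)
      rw [zero_add]
      exact diskGauge_le hε ⟨0, hD.zero_mem, by simp⟩)
    (by
      intro x y
      refine le_of_forall_pos_le_add fun ε hε => ?_
      obtain ⟨r, hr, hrx, h1⟩ := hD.exists_of_diskGauge_lt x.2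
        (lt_add_of_pos_right _ (half_pos hε))
      obtain ⟨s, hs, hsy, h2⟩ := hD.exists_of_diskGauge_lt y.2
        (lt_add_of_pos_right _ (half_pos hε))
      have := diskGauge_le (add_pos hr hs) (hD.add_mem_smul hr.le hs.le hrx hsy)
      exact this.trans (by linarith))
    (by
      intro c x
      refine le_of_forall_pos_le_add fun ε hε => ?_
      have hδ : 0 < ε / (2 * (‖c‖ + 1)) := by positivity
      obtain ⟨r, hr, hrx, h1⟩ := hD.exists_of_diskGauge_lt x.2 (lt_add_of_pos_right _ hδ)
      have := diskGauge_le (r := ‖c‖ * r + ε / 2) (by positivity)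
        (hD.smul_mem_smul hr.le hrx c (by linarith))
      refine this.trans ?_
      have h2 : ‖c‖ * (ε / (2 * (‖c‖ + 1))) ≤ ε / 2 := by
        rw [mul_div_assoc', div_le_div_iff₀ (by positivity) (by positivity)]
        nlinarith [norm_nonneg c]
      have h3 := mul_le_mul_of_nonneg_left h1.le (norm_nonneg c)
      rw [mul_add] at h3
      linarith)

lemma IsDisk.seminorm_le_iff {D : Set V} (hD : IsDisk 𝕜 D) {r : ℝ} (hr : 0 < r)
    (x : Submodule.span 𝕜 D) : hD.seminorm x ≤ r ↔ (x : V) ∈ (r : 𝕜) • D := by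
  constructor
  · intro h
    apply mem_smul_set_of_smul_mem hr
    apply hD.closed
    intro t ht
    have hlt : diskGauge 𝕜 D (x : V) < t * r := lt_of_le_of_lt h (by nlinarith)
    obtain ⟨s, hs, hsx, hst⟩ := hD.exists_of_diskGauge_lt x.2 hlt
    refine hD.smul_mem_smul hs.le hsx _ ?_
    rw [norm_inv, RCLike.norm_ofReal, abs_of_pos hr, inv_mul_le_iff₀ hr]
    linarith
  · exact fun h => diskGauge_le hr h

/-- The linear span `V_D` of a complete disk `D`, to be normed by the gauge of `D`. -/
def IsCompleteDisk.Space {D : Set V} (_ : IsCompleteDisk 𝕜 D) : Type _ := Submodule.span 𝕜 D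

namespace IsCompleteDisk.Space

variable {D : Set V} (hD : IsCompleteDisk 𝕜 D)

instance : AddCommGroup hD.Space := inferInstanceAs (AddCommGroup (Submodule.span 𝕜 D))
instance : Module 𝕜 hD.Space := inferInstanceAs (Module 𝕜 (Submodule.span 𝕜 D))

/-- The inclusion of `V_D` into `V`. -/
def incl : hD.Space →ₗ[𝕜] V := (Submodule.span 𝕜 D).subtype

lemma incl_injective : Function.Injective (incl hD) := Subtype.val_injective

lemma exists_incl_eq {x : V} (hx : x ∈ Submodule.span 𝕜 D) : ∃ e, incl hD e = x := ⟨⟨x, hx⟩, rfl⟩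

instance : Norm hD.Space := ⟨fun x => hD.toIsDisk.seminorm x⟩

lemma norm_le_iff {r : ℝ} (hr : 0 < r) (e : hD.Space) : ‖e‖ ≤ r ↔ incl hD e ∈ (r : 𝕜) • D :=
  hD.toIsDisk.seminorm_le_iff hr e

lemma core : NormedSpace.Core 𝕜 hD.Space where
  norm_nonneg x := apply_nonneg hD.toIsDisk.seminorm x
  norm_smul c x := map_smul_eq_mul hD.toIsDisk.seminorm c x
  norm_triangle x y := map_add_le_add hD.toIsDisk.seminorm x y
  norm_eq_zero_iff x := by
    refine ⟨fun hx => incl_injective hD ?_, ?_⟩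
    · rw [map_zero]
      exact hD.eq_zero _ fun ε hε => (norm_le_iff hD hε x).1 (hx.trans_le hε.le)
    · rintro rfl
      exact map_zero hD.toIsDisk.seminorm

instance : NormedAddCommGroup hD.Space := NormedAddCommGroup.ofCore (core hD)
instance : NormedSpace 𝕜 hD.Space := NormedSpace.ofCore (core hD)

instance : CompleteSpace hD.Space := by
  apply Metric.complete_of_cauchySeq_tendsto
  intro u hu
  obtain ⟨l, hl, hlim⟩ := hD.complete (fun n => incl hD (u n)) (fun n => (u n).2) (by
    intro ε hε
    obtain ⟨N, hN⟩ := Metric.cauchySeq_iff.1 hu ε hε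
    refine ⟨N, fun m hm n hn' => ?_⟩
    have := hN m hm n hn'
    rw [dist_eq_norm] at this
    rw [← map_sub]
    exact (norm_le_iff hD hε _).1 this.le)
  obtain ⟨l, rfl⟩ := exists_incl_eq hD hl
  refine ⟨l, Metric.tendsto_atTop.2 fun ε hε => ?_⟩
  obtain ⟨N, hN⟩ := hlim (ε / 2) (half_pos hε)
  refine ⟨N, fun n hn' => ?_⟩
  have h := hN n hn'
  rw [← map_sub] at h
  rw [dist_eq_norm]
  exact ((norm_le_iff hD (half_pos hε) _).2 h).trans_lt (by linarith)

end IsCompleteDisk.Space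

open IsCompleteDisk.Space in
/-- The Hahn–Banach theorem for `V_D`. The functional is extended from `V_D` to `V` without any
continuity. -/
lemma IsCompleteDisk.exists_functional {D : Set V} (hD : IsCompleteDisk 𝕜 D) {x : V}
    (hx : x ∈ Submodule.span 𝕜 D) (hx0 : x ≠ 0) :
    ∃ ψ : V →ₗ[𝕜] 𝕜, (∀ d ∈ D, ‖ψ d‖ ≤ 1) ∧ ψ x ≠ 0 := by
  have hj := incl_injective hD
  have hsurj := fun x => exists_incl_eq hD (x := x)
  have hn := fun r hr => norm_le_iff hD (r := r) hr
  set j := incl hD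
  obtain ⟨e, rfl⟩ := hsurj x hx
  have he : e ≠ 0 := by rintro rfl; simp at hx0
  obtain ⟨g, hg, hge⟩ := exists_dual_vector 𝕜 e (norm_ne_zero_iff.2 he)
  obtain ⟨q, hq⟩ := j.exists_leftInverse_of_injective (LinearMap.ker_eq_bot.2 hj)
  have hq' : ∀ e, q (j e) = e := fun e => LinearMap.congr_fun hq e
  refine ⟨g.toLinearMap ∘ₗ q, fun d hd => ?_, ?_⟩
  · obtain ⟨e', rfl⟩ := hsurj d (Submodule.subset_span hd)
    have h1 : ‖e'‖ ≤ 1 := (hn 1 one_pos e').2 (by simpa using hd)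
    simp only [LinearMap.comp_apply, hq', ContinuousLinearMap.coe_coe]
    calc ‖g e'‖ ≤ ‖g‖ * ‖e'‖ := g.le_opNorm e'
      _ ≤ 1 * 1 := by rw [hg]; gcongr
      _ = 1 := one_mul 1
  · simp only [LinearMap.comp_apply, hq', ContinuousLinearMap.coe_coe, hge]
    simpa using he

/-- The `ε`-characterization of unconditional sums in a normed space. -/
lemma hasSum_iff_forall_norm_le {E : Type*} [SeminormedAddCommGroup E] {ι : Type*} {f : ι → E}
    {x : E} : HasSum f x ↔
      ∀ ε : ℝ, 0 < ε → ∃ s₀ : Finset ι, ∀ s : Finset ι, s₀ ⊆ s → ‖∑ i ∈ s, f i - x‖ ≤ ε := by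
  classical
  rw [HasSum, SummationFilter.unconditional_filter, Metric.tendsto_atTop]
  simp only [dist_eq_norm]
  constructor
  · intro h ε hε
    obtain ⟨s₀, hs⟩ := h ε hε
    exact ⟨s₀, fun s hss => (hs s hss).le⟩
  · intro h ε hε
    obtain ⟨s₀, hs⟩ := h (ε / 2) (half_pos hε)
    exact ⟨s₀, fun s hss => (hs s hss).trans_lt (by linarith)⟩

lemma norm_le_of_mem_smul {D : Set V} {ψ : V →ₗ[𝕜] 𝕜} (hψ : ∀ d ∈ D, ‖ψ d‖ ≤ 1) {r : ℝ}
    (hr : 0 ≤ r) {x : V} (hx : x ∈ (r : 𝕜) • D) : ‖ψ x‖ ≤ r := by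
  obtain ⟨d, hd, rfl⟩ := hx
  simp only [map_smul, smul_eq_mul, norm_mul, RCLike.norm_ofReal, abs_of_nonneg hr]
  exact mul_le_of_le_one_right hr (hψ d hd)

lemma HasSumIn.hasSum_functional {D : Set V} {ψ : V →ₗ[𝕜] 𝕜} (hψ : ∀ d ∈ D, ‖ψ d‖ ≤ 1)
    {ι : Type*} {f : ι → V} {x : V} (h : HasSumIn 𝕜 D f x) :
    HasSum (fun i => ψ (f i)) (ψ x) := by
  refine hasSum_iff_forall_norm_le.2 fun ε hε => ?_
  obtain ⟨s₀, hs⟩ := h ε hε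
  refine ⟨s₀, fun s hss => ?_⟩
  rw [← map_sum, ← map_sub]
  exact norm_le_of_mem_smul hψ hε.le (hs s hss)

lemma IsCompleteDisk.tendsto_unique {D : Set V} (hD : IsCompleteDisk 𝕜 D) {u : ℕ → V} {x y : V}
    (hx : ∀ ε : ℝ, 0 < ε → ∃ N₀, ∀ N ≥ N₀, u N - x ∈ (ε : 𝕜) • D)
    (hy : ∀ ε : ℝ, 0 < ε → ∃ N₀, ∀ N ≥ N₀, u N - y ∈ (ε : 𝕜) • D) : x = y := by
  rw [← sub_eq_zero]
  refine hD.eq_zero _ fun ε hε => ?_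
  obtain ⟨M, hM⟩ := hx (ε / 2) (half_pos hε)
  obtain ⟨N, hN⟩ := hy (ε / 2) (half_pos hε)
  have := hD.sub_mem_smul (half_pos hε).le (half_pos hε).le (hN (max M N) (le_max_right _ _))
    (hM (max M N) (le_max_left _ _))
  simpa using this

lemma HasSumIn.tendsto_range {D : Set V} {f : ℕ → V} {x : V} (h : HasSumIn 𝕜 D f x) :
    ∀ ε : ℝ, 0 < ε → ∃ N₀, ∀ N ≥ N₀, ∑ n ∈ Finset.range N, f n - x ∈ (ε : 𝕜) • D := by
  intro ε hε
  obtain ⟨s₀, hs⟩ := h ε hε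
  obtain ⟨N₀, hN⟩ := s₀.exists_nat_subset_range
  exact ⟨N₀, fun N hN' => hs _ (hN.trans (Finset.range_mono hN'))⟩

lemma HasSumIn.hasBornSum [Bornology V] {D : Set V} (hDb : IsBounded D) (hD : IsDisk 𝕜 D) {ι : Type*}
    {f : ι → V} {x : V} (h : HasSumIn 𝕜 D f x) : HasBornSum 𝕜 f x := ⟨D, hDb, hD, h⟩

lemma IsCompleteDisk.exists_hasSumIn {D : Set V} (hD : IsCompleteDisk 𝕜 D)
    {ι : Type*} (c : ι → 𝕜) (hc : Summable fun i => ‖c i‖) (f : ι → V) (hf : ∀ i, c i ≠ 0 → f i ∈ D)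
    {r : ℝ} (hr : ∑' i, ‖c i‖ ≤ r) :
    ∃ x ∈ (r : 𝕜) • D, HasSumIn 𝕜 D (fun i => c i • f i) x := by
  obtain ⟨x, hx, h⟩ := hD.exists_sum c hc f hf
  exact ⟨x, hD.smul_mono (tsum_nonneg fun _ => norm_nonneg _) hr hx, h⟩

variable [Bornology V]

/-- A bornologically convergent series with absolutely summable coefficients over a complete bounded
disk `D` already converges in `V_D`. -/
lemma IsCompleteDisk.hasSumIn_of_hasBornSum [CompleteConvexSpace 𝕜 V] {D : Set V}
    (hD : IsCompleteDisk 𝕜 D) (hDb : IsBounded D) {ι : Type*} {c : ι → 𝕜}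
    (hc : Summable fun i => ‖c i‖) {f : ι → V} (hf : ∀ i, c i ≠ 0 → f i ∈ D)
    {r : ℝ} (hr : ∑' i, ‖c i‖ ≤ r) {x : V} (hx : HasBornSum 𝕜 (fun i => c i • f i) x) :
    x ∈ (r : 𝕜) • D ∧ HasSumIn 𝕜 D (fun i => c i • f i) x := by
  obtain ⟨y, hy, h⟩ := hD.exists_hasSumIn c hc f hf hr
  rw [hx.unique (h.hasBornSum hDb hD.toIsDisk)]
  exact ⟨hy, h⟩

lemma IsCompleteDisk.Space.hasBornSum_incl {D : Set V} (hDb : IsBounded D)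
    (hD : IsCompleteDisk 𝕜 D) {ι : Type*} {g : ι → hD.Space} {y : hD.Space} (hg : HasSum g y) :
    HasBornSum 𝕜 (fun i => incl hD (g i)) (incl hD y) := by
  refine ⟨D, hDb, hD.toIsDisk, fun ε hε => ?_⟩
  obtain ⟨s₀, hs⟩ := hasSum_iff_forall_norm_le.1 hg ε hε
  refine ⟨s₀, fun s hss => ?_⟩
  rw [← map_sum, ← map_sub, ← norm_le_iff hD hε]
  exact hs s hss

open IsCompleteDisk.Space in
/-- Fubini's theorem for absolutely convergent double series over a complete bounded disk. -/
lemma IsCompleteDisk.hasBornSum_comm [CompleteConvexSpace 𝕜 V] {D : Set V}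
    (hD : IsCompleteDisk 𝕜 D) (hDb : IsBounded D) {ι κ : Type*} {c : ι × κ → 𝕜}
    (hc : Summable fun i => ‖c i‖) {f : ι × κ → V} (hf : ∀ i, c i ≠ 0 → f i ∈ D)
    {a : ι → V} (ha : ∀ i, HasBornSum 𝕜 (fun k => c (i, k) • f (i, k)) (a i))
    {b : κ → V} (hb : ∀ k, HasBornSum 𝕜 (fun i => c (i, k) • f (i, k)) (b k))
    {x : V} (hx : HasBornSum 𝕜 a x) : HasBornSum 𝕜 b x := by
  have hsurj := fun x => exists_incl_eq hD (x := x)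
  have hn := fun r hr => norm_le_iff hD (r := r) hr
  have hF : ∀ i, ∃ e, incl hD e = c i • f i ∧ ‖e‖ ≤ ‖c i‖ := by
    intro i
    by_cases h : c i = 0
    · exact ⟨0, by simp [h]⟩
    obtain ⟨e, he⟩ := hsurj (f i) (Submodule.subset_span (hf i h))
    refine ⟨c i • e, by rw [map_smul, he], ?_⟩
    have h1 : ‖e‖ ≤ 1 := (hn 1 one_pos e).2 (by simpa [he] using hf i h)
    rw [norm_smul]
    exact mul_le_of_le_one_right (norm_nonneg _) h1
  choose F hjF hFn using hF
  have hFs : Summable F := Summable.of_norm_bounded hc hFn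
  have hrow : ∀ i, incl hD (∑' k, F (i, k)) = a i := by
    intro i
    have h1 := hasBornSum_incl hDb hD (hFs.comp_injective (Prod.mk_right_injective i)).hasSum
    refine h1.unique (𝕜 := 𝕜) ?_
    simpa only [Function.comp_apply, hjF] using ha i
  have hcol : ∀ k, incl hD (∑' i, F (i, k)) = b k := by
    intro k
    have h1 := hasBornSum_incl hDb hD (hFs.comp_injective (Prod.mk_left_injective k)).hasSum
    refine h1.unique (𝕜 := 𝕜) ?_
    simpa only [Function.comp_apply, hjF] using hb k
  have h1 : HasSum (fun i => ∑' k, F (i, k)) (∑' q, F q) := hFs.hasSum.prod_fiberwise fun i =>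
    (hFs.comp_injective (Prod.mk_right_injective i)).hasSum
  have h2 : HasSum (fun k => ∑' i, F (i, k)) (∑' q, F q) := by
    have hsw := (Equiv.prodComm κ ι).hasSum_iff.2 hFs.hasSum
    exact hsw.prod_fiberwise fun k =>
      (hFs.comp_injective (Prod.mk_left_injective k)).hasSum
  have h3 := hasBornSum_incl hDb hD h1
  simp only [hrow] at h3
  have h4 := hasBornSum_incl hDb hD h2
  simp only [hcol] at h4
  rwa [hx.unique h3]

end Disks

/-! ### Functionals and slices on the complete tensor product -/

section Pairing

variable {𝕜 : Type*} [RCLike 𝕜] {V W : Type*} [AddCommGroup V] [Module 𝕜 V] [Bornology V]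
  [AddCommGroup W] [Module 𝕜 W] [Bornology W]

namespace FreeSpace

/-- The pairing of an element of the free space with `ψ ⊗ φ`. The series need not converge unless
`ψ` and `φ` are bounded on sets `S` and `T` with `g` supported in `S × T`. -/
def pair (ψ : V →ₗ[𝕜] 𝕜) (φ : W →ₗ[𝕜] 𝕜) (g : FreeSpace 𝕜 V W) : 𝕜 :=
  ∑' p, coeL 𝕜 V W g p * (ψ p.1 * φ p.2)

variable {S : Set V} {T : Set W} {ψ : V →ₗ[𝕜] 𝕜} {φ : W →ₗ[𝕜] 𝕜}

lemma norm_pair_term_le (hψ : ∀ v ∈ S, ‖ψ v‖ ≤ 1) (hφ : ∀ w ∈ T, ‖φ w‖ ≤ 1)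
    {g : FreeSpace 𝕜 V W} (hg : coeL 𝕜 V W g ∈ suppIn 𝕜 V W S T) (p : V × W) :
    ‖coeL 𝕜 V W g p * (ψ p.1 * φ p.2)‖ ≤ ‖coeL 𝕜 V W g p‖ := by
  by_cases hp : p ∈ S ×ˢ T
  · rw [norm_mul, norm_mul]
    exact mul_le_of_le_one_right (norm_nonneg _)
      (mul_le_one₀ (hψ _ hp.1) (norm_nonneg _) (hφ _ hp.2))
  · simp [hg p hp]

lemma hasSum_pair (hψ : ∀ v ∈ S, ‖ψ v‖ ≤ 1) (hφ : ∀ w ∈ T, ‖φ w‖ ≤ 1)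
    {g : FreeSpace 𝕜 V W} (hg : coeL 𝕜 V W g ∈ suppIn 𝕜 V W S T) :
    HasSum (fun p => coeL 𝕜 V W g p * (ψ p.1 * φ p.2)) (pair ψ φ g) :=
  (Summable.of_norm_bounded g.summable (norm_pair_term_le hψ hφ hg)).hasSum

lemma norm_pair_le (hψ : ∀ v ∈ S, ‖ψ v‖ ≤ 1) (hφ : ∀ w ∈ T, ‖φ w‖ ≤ 1)
    {g : FreeSpace 𝕜 V W} (hg : coeL 𝕜 V W g ∈ suppIn 𝕜 V W S T) :
    ‖pair ψ φ g‖ ≤ ‖coeL 𝕜 V W g‖ := by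
  rw [norm_eq]
  exact tsum_of_norm_bounded g.summable.hasSum (norm_pair_term_le hψ hφ hg)

lemma pair_add (hψ : ∀ v ∈ S, ‖ψ v‖ ≤ 1) (hφ : ∀ w ∈ T, ‖φ w‖ ≤ 1)
    {g h : FreeSpace 𝕜 V W} (hg : coeL 𝕜 V W g ∈ suppIn 𝕜 V W S T)
    (hh : coeL 𝕜 V W h ∈ suppIn 𝕜 V W S T) : pair ψ φ (g + h) = pair ψ φ g + pair ψ φ h := by
  rw [← ((hasSum_pair hψ hφ hg).add (hasSum_pair hψ hφ hh)).tsum_eq, pair]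
  congr 1
  ext p
  simp [add_mul]

lemma pair_smul (c : 𝕜) (g : FreeSpace 𝕜 V W) : pair ψ φ (c • g) = c * pair ψ φ g := by
  rw [pair, pair, ← tsum_mul_left]
  congr 1
  ext p
  simp [mul_assoc]

lemma pair_sub (hψ : ∀ v ∈ S, ‖ψ v‖ ≤ 1) (hφ : ∀ w ∈ T, ‖φ w‖ ≤ 1)
    {g h : FreeSpace 𝕜 V W} (hg : coeL 𝕜 V W g ∈ suppIn 𝕜 V W S T)
    (hh : coeL 𝕜 V W h ∈ suppIn 𝕜 V W S T) : pair ψ φ (g - h) = pair ψ φ g - pair ψ φ h := by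
  have h1 : coeL 𝕜 V W ((-1 : 𝕜) • h) ∈ suppIn 𝕜 V W S T := by
    rw [map_smul]; exact Submodule.smul_mem _ _ hh
  have := pair_add hψ hφ hg h1
  rw [pair_smul, neg_one_smul, ← sub_eq_add_neg] at this
  rw [this]; ring

lemma pair_delta (p : V × W) : pair ψ φ (delta (𝕜 := 𝕜) p) = ψ p.1 * φ p.2 := by
  classical
  have h1 : ∀ q, q ≠ p → coeL 𝕜 V W (delta p) q = 0 := fun q hq =>
    lp.single_apply_ne (E := fun _ : V × W => 𝕜) _ _ _ hq
  have h2 : coeL 𝕜 V W (delta p) p = 1 := lp.single_apply_self (E := fun _ : V × W => 𝕜) _ _ _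
  rw [pair, tsum_eq_single p fun q hq => by rw [h1 q hq, zero_mul], h2, one_mul]

lemma coeL_delta_mem_suppIn {p : V × W} (h1 : p.1 ∈ S) (h2 : p.2 ∈ T) :
    coeL 𝕜 V W (delta p) ∈ suppIn 𝕜 V W S T := (delta_mem_ball h1 h2).1

/-- The slice `(id ⊗ φ)(g)`. -/
lemma exists_slice_left (hS : IsCompleteDisk 𝕜 S) (hφ : ∀ w ∈ T, ‖φ w‖ ≤ 1)
    {g : FreeSpace 𝕜 V W} {r : ℝ} (hg : g ∈ ball S T r) :
    ∃ s ∈ (r : 𝕜) • S, HasSumIn 𝕜 S (fun p => (coeL 𝕜 V W g p * φ p.2) • p.1) s ∧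
      ∀ ψ : V →ₗ[𝕜] 𝕜, (∀ v ∈ S, ‖ψ v‖ ≤ 1) → ψ s = pair ψ φ g := by
  have hle : ∀ p, ‖coeL 𝕜 V W g p * φ p.2‖ ≤ ‖coeL 𝕜 V W g p‖ := by
    intro p
    by_cases hp : p ∈ S ×ˢ T
    · rw [norm_mul]
      exact mul_le_of_le_one_right (norm_nonneg _) (hφ _ hp.2)
    · simp [hg.1 p hp]
  have hsum := Summable.of_nonneg_of_le (fun _ => norm_nonneg _) hle g.summable
  obtain ⟨s, hs, h⟩ := hS.exists_hasSumIn _ hsum (fun p : V × W => p.1) (fun p hp => by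
    by_contra h
    exact hp (by rw [hg.1 p fun h' => h h'.1, zero_mul])) (r := r)
    ((hsum.tsum_le_tsum hle g.summable).trans (by rw [← norm_eq]; exact hg.2))
  refine ⟨s, hs, h, fun ψ hψ => ?_⟩
  refine (h.hasSum_functional hψ).unique ?_
  refine (congrArg (fun F => HasSum F _) (funext fun p => ?_)).mp (hasSum_pair hψ hφ hg.1)
  simp only [map_smul, smul_eq_mul]
  ring

/-- The slice `(ψ ⊗ id)(g)`. -/
lemma exists_slice_right (hT : IsCompleteDisk 𝕜 T) (hψ : ∀ v ∈ S, ‖ψ v‖ ≤ 1)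
    {g : FreeSpace 𝕜 V W} {r : ℝ} (hg : g ∈ ball S T r) :
    ∃ s ∈ (r : 𝕜) • T, ∀ φ : W →ₗ[𝕜] 𝕜, (∀ w ∈ T, ‖φ w‖ ≤ 1) → φ s = pair ψ φ g := by
  have hle : ∀ p, ‖coeL 𝕜 V W g p * ψ p.1‖ ≤ ‖coeL 𝕜 V W g p‖ := by
    intro p
    by_cases hp : p ∈ S ×ˢ T
    · rw [norm_mul]
      exact mul_le_of_le_one_right (norm_nonneg _) (hψ _ hp.1)
    · simp [hg.1 p hp]
  have hsum := Summable.of_nonneg_of_le (fun _ => norm_nonneg _) hle g.summable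
  obtain ⟨s, hs, h⟩ := hT.exists_hasSumIn _ hsum (fun p : V × W => p.2) (fun p hp => by
    by_contra h
    exact hp (by rw [hg.1 p fun h' => h h'.2, zero_mul])) (r := r)
    ((hsum.tsum_le_tsum hle g.summable).trans (by rw [← norm_eq]; exact hg.2))
  refine ⟨s, hs, fun φ hφ => ?_⟩
  refine (h.hasSum_functional hφ).unique ?_
  refine (congrArg (fun F => HasSum F _) (funext fun p => ?_)).mp (hasSum_pair hψ hφ hg.1)
  simp only [map_smul, smul_eq_mul]
  ring

/-- Functionals on larger disks `S'` and `T'` already separate what functionals on `S` and `T` see: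
by the Hahn–Banach theorem a non-zero slice in `W_T` remains visible in `W_{T'}`, and then a
non-zero slice in `V_S` remains visible in `V_{S'}`. -/
lemma pair_eq_zero_of_subset {S' : Set V} {T' : Set W} (hS : IsCompleteDisk 𝕜 S)
    (hT : IsCompleteDisk 𝕜 T) (hS' : IsCompleteDisk 𝕜 S') (hT' : IsCompleteDisk 𝕜 T')
    (hSS : S ⊆ S') (hTT : T ⊆ T') {g : FreeSpace 𝕜 V W}
    (hg : coeL 𝕜 V W g ∈ suppIn 𝕜 V W S T)
    (h : ∀ (ψ : V →ₗ[𝕜] 𝕜) (φ : W →ₗ[𝕜] 𝕜), (∀ v ∈ S', ‖ψ v‖ ≤ 1) → (∀ w ∈ T', ‖φ w‖ ≤ 1) →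
      pair ψ φ g = 0)
    (hψ : ∀ v ∈ S, ‖ψ v‖ ≤ 1) (hφ : ∀ w ∈ T, ‖φ w‖ ≤ 1) : pair ψ φ g = 0 := by
  by_contra h0
  obtain ⟨c, hc, hcp⟩ := exists_slice_right hT hψ (g := g) ⟨hg, le_rfl⟩
  have hc0 : c ≠ 0 := by
    rintro rfl
    exact h0 (by rw [← hcp φ hφ, map_zero])
  obtain ⟨φ', hφ', hcφ'⟩ := hT'.exists_functional
    (mem_span_of_mem_smul (Set.smul_set_mono hTT hc)) hc0
  have hφT : ∀ w ∈ T, ‖φ' w‖ ≤ 1 := fun w hw => hφ' w (hTT hw)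
  rw [hcp φ' hφT] at hcφ'
  obtain ⟨s, hs, -, hsp⟩ := exists_slice_left hS hφT (g := g) ⟨hg, le_rfl⟩
  have hs0 : s ≠ 0 := by
    rintro rfl
    exact hcφ' (by rw [← hsp ψ hψ, map_zero])
  obtain ⟨ψ', hψ', hsψ'⟩ := hS'.exists_functional
    (mem_span_of_mem_smul (Set.smul_set_mono hSS hs)) hs0
  rw [hsp ψ' fun v hv => hψ' v (hSS hv)] at hsψ'
  exact hsψ' (h ψ' φ' hψ' hφ')

/-- Absolutely convergent series of elementary tensors lift to the free space. -/
lemma exists_family_sum {S : Set V} {T : Set W} (hSb : IsBounded S) (hTb : IsBounded T)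
    {ι : Type*} {c : ι → 𝕜} (hc : Summable fun i => ‖c i‖) {v : ι → V} {w : ι → W}
    (hv : ∀ i, c i ≠ 0 → v i ∈ S) (hw : ∀ i, c i ≠ 0 → w i ∈ T) :
    ∃ g : FreeSpace 𝕜 V W, coeL 𝕜 V W g ∈ suppIn 𝕜 V W S T ∧
      HasBornSum 𝕜 (fun i => c i • Tensor.tmul (𝕜 := 𝕜) (v i) (w i)) (Tensor.mk 𝕜 V W g) ∧
      ∀ (ψ : V →ₗ[𝕜] 𝕜) (φ : W →ₗ[𝕜] 𝕜), (∀ v ∈ S, ‖ψ v‖ ≤ 1) → (∀ w ∈ T, ‖φ w‖ ≤ 1) →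
        HasSum (fun i => c i * (ψ (v i) * φ (w i))) (pair ψ φ g) := by
  have hF : ∀ i, ∃ e : suppIn 𝕜 V W S T, ‖e‖ ≤ ‖c i‖ ∧
      incl hSb hTb e = c i • delta (v i, w i) := by
    intro i
    by_cases hi : c i = 0
    · exact ⟨0, by simp, by simp [hi]⟩
    obtain ⟨e, he, he'⟩ := incl_surj hSb hTb (delta_mem_ball (𝕜 := 𝕜) (p := (v i, w i)) (hv i hi)
      (hw i hi))
    refine ⟨c i • e, ?_, by rw [map_smul, he']⟩
    rw [norm_smul]
    exact mul_le_of_le_one_right (norm_nonneg _) he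
  choose e he he' using hF
  have hsum := (Summable.of_norm_bounded hc he).hasSum
  refine ⟨incl hSb hTb (∑' i, e i), (∑' i, e i).2, ?_, fun ψ φ hψ hφ => ?_⟩
  · have hfree : HasBornSum 𝕜 (fun i => c i • delta (𝕜 := 𝕜) (v i, w i))
        (incl hSb hTb (∑' i, e i)) := by
      obtain ⟨D, hD, hDb, hDd⟩ := CompleteConvexSpace.exists_completeDisk (𝕜 := 𝕜) _
        (isBounded_ball (𝕜 := 𝕜) hSb hTb 1)
      refine ⟨D, hDb, hDd.toIsDisk, fun ε hε => ?_⟩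
      obtain ⟨s₀, hs₀⟩ := hasSum_iff_forall_norm_le.1 hsum ε hε
      refine ⟨s₀, fun s hs => mem_smul_set_of_smul_mem hε (hD ?_)⟩
      simp only [← he']
      rw [← map_sum, ← map_sub, ← map_smul]
      apply incl_mem
      rw [norm_smul, norm_inv, RCLike.norm_ofReal, abs_of_pos hε, inv_mul_le_iff₀ hε, mul_one]
      exact hs₀ s hs
    have := hfree.map (Tensor.mk 𝕜 V W) Tensor.boundedMap_mk
    simpa only [map_smul, Tensor.mk_delta] using this
  · let F : suppIn 𝕜 V W S T →ₗ[𝕜] 𝕜 :=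
      { toFun := fun e => pair ψ φ (incl hSb hTb e)
        map_add' := fun e e' => by rw [map_add]; exact pair_add hψ hφ e.2 e'.2
        map_smul' := fun c e => by rw [map_smul]; exact pair_smul c _ }
    have h1 := hsum.mapL (F.mkContinuous 1 fun e => by
      rw [one_mul]; exact norm_pair_le hψ hφ e.2)
    refine (congrArg (fun f => HasSum f (pair ψ φ (incl hSb hTb (∑' i, e i))))
      (funext fun i => ?_)).mp h1
    change pair ψ φ (incl hSb hTb (e i)) = _
    rw [he', pair_smul, pair_delta]

variable [CompleteConvexSpace 𝕜 V] [CompleteConvexSpace 𝕜 W]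

lemma exists_disks {S S' : Set V} {T T' : Set W} (hS : IsBounded S) (hS' : IsBounded S')
    (hT : IsBounded T) (hT' : IsBounded T') : ∃ (S₁ : Set V) (T₁ : Set W), S ⊆ S₁ ∧ S' ⊆ S₁ ∧
      T ⊆ T₁ ∧ T' ⊆ T₁ ∧ IsBounded S₁ ∧ IsBounded T₁ ∧ IsCompleteDisk 𝕜 S₁ ∧
      IsCompleteDisk 𝕜 T₁ := by
  obtain ⟨S₁, h1, h2, h3⟩ :=
    CompleteConvexSpace.exists_completeDisk (𝕜 := 𝕜) (S ∪ S') (hS.union hS')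
  obtain ⟨T₁, h4, h5, h6⟩ :=
    CompleteConvexSpace.exists_completeDisk (𝕜 := 𝕜) (T ∪ T') (hT.union hT')
  exact ⟨S₁, T₁, Set.subset_union_left.trans h1, Set.subset_union_right.trans h1,
    Set.subset_union_left.trans h4, Set.subset_union_right.trans h4, h2, h5, h3, h6⟩

variable (𝕜 V W) in
/-- The common kernel of all functionals `ψ ⊗ φ`, where `ψ` and `φ` are functionals on `V_S` and
`W_T` for complete bounded disks `S` and `T`. -/
def pairKer : Submodule 𝕜 (FreeSpace 𝕜 V W) where
  carrier := {g | ∀ (S : Set V) (T : Set W), IsBounded S → IsBounded T → IsCompleteDisk 𝕜 S →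
    IsCompleteDisk 𝕜 T → coeL 𝕜 V W g ∈ suppIn 𝕜 V W S T → ∀ (ψ : V →ₗ[𝕜] 𝕜) (φ : W →ₗ[𝕜] 𝕜),
    (∀ v ∈ S, ‖ψ v‖ ≤ 1) → (∀ w ∈ T, ‖φ w‖ ≤ 1) → pair ψ φ g = 0}
  zero_mem' := by
    intro S T _ _ _ _ _ ψ φ _ _
    simp [pair]
  add_mem' := by
    intro g h hg hh S T hSb hTb hS hT hgh ψ φ hψ hφ
    obtain ⟨S₁, T₁, hS₁, hT₁, hg₁⟩ := g.exists_mem_ball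
    obtain ⟨S₂, T₂, hS₂, hT₂, hh₂⟩ := h.exists_mem_ball
    obtain ⟨S₃, T₃, h1, h2, h3, h4, h5, h6, -, -⟩ := exists_disks (𝕜 := 𝕜) hS₁ hS₂ hT₁ hT₂
    obtain ⟨S', T', a1, a2, a3, a4, a5, a6, a7, a8⟩ := exists_disks (𝕜 := 𝕜) hSb h5 hTb h6
    refine pair_eq_zero_of_subset hS hT a7 a8 a1 a3 hgh (fun ψ' φ' hψ' hφ' => ?_) hψ hφ
    have hg' := suppIn_mono (h1.trans a2) (h3.trans a4) hg₁.1
    have hh' := suppIn_mono (h2.trans a2) (h4.trans a4) hh₂.1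
    rw [pair_add hψ' hφ' hg' hh', hg _ _ a5 a6 a7 a8 hg' _ _ hψ' hφ',
      hh _ _ a5 a6 a7 a8 hh' _ _ hψ' hφ', add_zero]
  smul_mem' := by
    intro c g hg S T hSb hTb hS hT hcg ψ φ hψ hφ
    rw [pair_smul]
    by_cases hc : c = 0
    · rw [hc, zero_mul]
    rw [hg S T hSb hTb hS hT ?_ ψ φ hψ hφ, mul_zero]
    have := Submodule.smul_mem _ c⁻¹ hcg
    rwa [← map_smul, inv_smul_smul₀ hc] at this

/-- To check membership in `pairKer`, one pair of disks that is large enough suffices. -/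
lemma mem_pairKer {g : FreeSpace 𝕜 V W} {S₀ : Set V} {T₀ : Set W} (hS₀ : IsBounded S₀)
    (hT₀ : IsBounded T₀)
    (h : ∀ (ψ : V →ₗ[𝕜] 𝕜) (φ : W →ₗ[𝕜] 𝕜), (∀ v ∈ S₀, ‖ψ v‖ ≤ 1) → (∀ w ∈ T₀, ‖φ w‖ ≤ 1) →
      pair ψ φ g = 0) : g ∈ pairKer 𝕜 V W := by
  intro S T hSb hTb hS hT hg ψ φ hψ hφ
  obtain ⟨S', T', a1, a2, a3, a4, a5, a6, a7, a8⟩ := exists_disks (𝕜 := 𝕜) hSb hS₀ hTb hT₀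
  exact pair_eq_zero_of_subset hS hT a7 a8 a1 a3 hg (fun ψ' φ' hψ' hφ' =>
    h ψ' φ' (fun v hv => hψ' v (a2 hv)) (fun w hw => hφ' w (a4 hw))) hψ hφ

lemma relations_subset_pairKer : relations 𝕜 V W ⊆ pairKer 𝕜 V W := by
  rintro x (⟨v, v', w, rfl⟩ | ⟨v, w, w', rfl⟩ | ⟨c, v, w, rfl⟩ | ⟨c, v, w, rfl⟩)
  · refine mem_pairKer (S₀ := {v + v', v, v'}) (T₀ := {w}) (Set.toFinite _).isBounded
      isBounded_singleton fun ψ φ hψ hφ => ?_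
    have m1 := coeL_delta_mem_suppIn (𝕜 := 𝕜) (S := {v + v', v, v'}) (T := {w})
      (p := (v + v', w)) (by simp) (by simp)
    have m2 := coeL_delta_mem_suppIn (𝕜 := 𝕜) (S := {v + v', v, v'}) (T := {w})
      (p := (v, w)) (by simp) (by simp)
    have m3 := coeL_delta_mem_suppIn (𝕜 := 𝕜) (S := {v + v', v, v'}) (T := {w})
      (p := (v', w)) (by simp) (by simp)
    rw [pair_sub hψ hφ (by rw [map_sub]; exact Submodule.sub_mem _ m1 m2) m3,
      pair_sub hψ hφ m1 m2]
    simp [pair_delta, add_mul]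
  · refine mem_pairKer (S₀ := {v}) (T₀ := {w + w', w, w'}) isBounded_singleton
      (Set.toFinite _).isBounded fun ψ φ hψ hφ => ?_
    have m1 := coeL_delta_mem_suppIn (𝕜 := 𝕜) (S := {v}) (T := {w + w', w, w'})
      (p := (v, w + w')) (by simp) (by simp)
    have m2 := coeL_delta_mem_suppIn (𝕜 := 𝕜) (S := {v}) (T := {w + w', w, w'})
      (p := (v, w)) (by simp) (by simp)
    have m3 := coeL_delta_mem_suppIn (𝕜 := 𝕜) (S := {v}) (T := {w + w', w, w'})
      (p := (v, w')) (by simp) (by simp)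
    rw [pair_sub hψ hφ (by rw [map_sub]; exact Submodule.sub_mem _ m1 m2) m3,
      pair_sub hψ hφ m1 m2]
    simp [pair_delta, mul_add]
  · refine mem_pairKer (S₀ := {c • v, v}) (T₀ := {w}) (Set.toFinite _).isBounded
      isBounded_singleton fun ψ φ hψ hφ => ?_
    have m1 := coeL_delta_mem_suppIn (𝕜 := 𝕜) (S := {c • v, v}) (T := {w})
      (p := (c • v, w)) (by simp) (by simp)
    have m2 := coeL_delta_mem_suppIn (𝕜 := 𝕜) (S := {c • v, v}) (T := {w})
      (p := (v, w)) (by simp) (by simp)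
    rw [pair_sub hψ hφ m1 (by rw [map_smul]; exact Submodule.smul_mem _ _ m2), pair_smul]
    simp [pair_delta, mul_assoc]
  · refine mem_pairKer (S₀ := {v}) (T₀ := {c • w, w}) isBounded_singleton
      (Set.toFinite _).isBounded fun ψ φ hψ hφ => ?_
    have m1 := coeL_delta_mem_suppIn (𝕜 := 𝕜) (S := {v}) (T := {c • w, w})
      (p := (v, c • w)) (by simp) (by simp)
    have m2 := coeL_delta_mem_suppIn (𝕜 := 𝕜) (S := {v}) (T := {c • w, w})
      (p := (v, w)) (by simp) (by simp)
    rw [pair_sub hψ hφ m1 (by rw [map_smul]; exact Submodule.smul_mem _ _ m2), pair_smul]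
    simp [pair_delta, mul_left_comm]

lemma isBornClosed_pairKer :
    IsBornClosed 𝕜 (pairKer 𝕜 V W : Set (FreeSpace 𝕜 V W)) := by
  rintro x l hx ⟨D, hDb, -, hxD, hlD, ε, hε, hlim, hxl⟩
  obtain ⟨S₀, T₀, r, hS₀, hT₀, hD⟩ := FreeSpace.isBounded_iff.1 hDb
  obtain ⟨S, T, a1, -, a3, -, a5, a6, a7, a8⟩ := exists_disks (𝕜 := 𝕜) hS₀ hS₀ hT₀ hT₀
  replace hD := hD.trans (ball_mono a1 a3 le_rfl)
  refine mem_pairKer a5 a6 fun ψ φ hψ hφ => ?_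
  have hle : ∀ n, ‖pair ψ φ l‖ ≤ ε n * r := by
    intro n
    obtain ⟨d, hd, hdx⟩ := hxl n
    have h1 := pair_sub hψ hφ (hD (hxD n)).1 (hD hlD).1
    rw [hx n S T a5 a6 a7 a8 (hD (hxD n)).1 ψ φ hψ hφ, ← hdx, zero_sub] at h1
    rw [← norm_neg, ← h1, pair_smul, norm_mul, RCLike.norm_ofReal, abs_of_pos (hε n)]
    exact mul_le_mul_of_nonneg_left ((norm_pair_le hψ hφ (hD hd).1).trans (hD hd).2) (hε n).le
  have h0 : Tendsto (fun n => ε n * r) atTop (𝓝 0) := by simpa using hlim.mul_const r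
  exact norm_le_zero_iff.1 (ge_of_tendsto' h0 hle)

/-- Functionals `ψ ⊗ φ` on `V_S ⊗ W_T` vanish on every element that becomes zero in the complete
tensor product, although they need not extend to the latter. -/
lemma pair_eq_of_mk_eq {S : Set V} {T : Set W} (hSb : IsBounded S) (hTb : IsBounded T)
    (hS : IsCompleteDisk 𝕜 S) (hT : IsCompleteDisk 𝕜 T) {g h : FreeSpace 𝕜 V W}
    (hg : coeL 𝕜 V W g ∈ suppIn 𝕜 V W S T) (hh : coeL 𝕜 V W h ∈ suppIn 𝕜 V W S T)
    (hgh : Tensor.mk 𝕜 V W g = Tensor.mk 𝕜 V W h)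
    (hψ : ∀ v ∈ S, ‖ψ v‖ ≤ 1) (hφ : ∀ w ∈ T, ‖φ w‖ ≤ 1) : pair ψ φ g = pair ψ φ h := by
  have hrel : relSpan 𝕜 V W ≤ pairKer 𝕜 V W :=
    sInf_le ⟨isBornClosed_pairKer, relations_subset_pairKer⟩
  have hmem : g - h ∈ pairKer 𝕜 V W := by
    refine hrel ((Submodule.Quotient.mk_eq_zero _).1 ?_)
    change Tensor.mk 𝕜 V W (g - h) = 0
    rw [map_sub, hgh, sub_self]
  rw [← sub_eq_zero, ← pair_sub hψ hφ hg hh]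
  exact hmem S T hSb hTb hS hT (by rw [map_sub]; exact Submodule.sub_mem _ hg hh) ψ φ hψ hφ

end FreeSpace

end Pairing

/-! ### Powers of sets and the spectral radius -/

section Powers

lemma setPow_mul_setPow {A : Type*} [Semigroup A] (S : Set A) (m n : ℕ) :
    setPow S m * setPow S n = setPow S (m + n + 1) := by
  induction n with
  | zero => rfl
  | succ n ih =>
    rw [setPow, ← mul_assoc, ih]
    rfl

lemma setPow_mono {A : Type*} [Mul A] {S S' : Set A} (h : S ⊆ S') (n : ℕ) :
    setPow S n ⊆ setPow S' n := by
  induction n with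
  | zero => exact h
  | succ n ih => exact Set.mul_subset_mul ih h

lemma setPowInfty_mono {A : Type*} [Mul A] {S S' : Set A} (h : S ⊆ S') :
    setPowInfty S ⊆ setPowInfty S' :=
  Set.iUnion_mono fun n => setPow_mono h n

lemma setPow_subset_setPowInfty {A : Type*} [Mul A] (S : Set A) (n : ℕ) :
    setPow S n ⊆ setPowInfty S := Set.subset_iUnion (setPow S) n

lemma subset_setPowInfty {A : Type*} [Mul A] (S : Set A) : S ⊆ setPowInfty S :=
  setPow_subset_setPowInfty S 0

lemma mul_mem_setPowInfty {A : Type*} [Semigroup A] {S : Set A} {x y : A}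
    (hx : x ∈ setPowInfty S) (hy : y ∈ setPowInfty S) : x * y ∈ setPowInfty S := by
  obtain ⟨m, hm⟩ := Set.mem_iUnion.1 hx
  obtain ⟨n, hn⟩ := Set.mem_iUnion.1 hy
  exact setPow_subset_setPowInfty S (m + n + 1)
    (setPow_mul_setPow S m n ▸ Set.mul_mem_mul hm hn)

lemma image_setPow {A B F : Type*} [Mul A] [Mul B] [FunLike F A B] [MulHomClass F A B] (f : F)
    (S : Set A) (n : ℕ) : f '' setPow S n = setPow (f '' S) n := by
  induction n with
  | zero => rfl
  | succ n ih => rw [setPow, Set.image_mul, ih]; rfl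

lemma image_setPowInfty {A B F : Type*} [Mul A] [Mul B] [FunLike F A B] [MulHomClass F A B] (f : F)
    (S : Set A) : f '' setPowInfty S = setPowInfty (f '' S) := by
  simp only [setPowInfty, Set.image_iUnion, image_setPow]

lemma isBounded_setPow {A : Type*} [Mul A] [Bornology A] [BoundedMul A] {S : Set A}
    (hS : IsBounded S) (n : ℕ) : IsBounded (setPow S n) := by
  induction n with
  | zero => exact hS
  | succ n ih => exact BoundedMul.isBounded_mul ih hS

/-- If the powers of `S ^ (k + 1)` are jointly bounded, then so are those of `S`. -/
lemma isBounded_setPowInfty_of_setPow {A : Type*} [Semigroup A] [Bornology A] [BoundedMul A]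
    {S : Set A} (hS : IsBounded S) (k : ℕ) (h : IsBounded (setPowInfty (setPow S k))) :
    IsBounded (setPowInfty S) := by
  set U : Set A := ⋃ j ∈ Set.Iic k, setPow S j with hU
  have hUb : IsBounded U :=
    (isBounded_biUnion (Set.finite_Iic k)).2 fun j _ => isBounded_setPow hS j
  refine (hUb.union (BoundedMul.isBounded_mul h hUb)).subset (Set.iUnion_subset fun n => ?_)
  induction n using Nat.strong_induction_on with
  | _ n ih =>
    by_cases hn : n ≤ k
    · exact fun x hx => Or.inl (Set.mem_biUnion (Set.mem_Iic.2 hn) hx)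
    obtain ⟨m, rfl⟩ : ∃ m, n = k + m + 1 := ⟨n - k - 1, by omega⟩
    rw [← setPow_mul_setPow]
    rintro _ ⟨x, hx, y, hy, rfl⟩
    right
    have hx' := subset_setPowInfty _ hx
    rcases ih m (by omega) hy with hy | ⟨z, hz, u, hu, rfl⟩
    · exact Set.mul_mem_mul hx' hy
    · exact ⟨x * z, mul_mem_setPowInfty hx' hz, u, hu, mul_assoc _ _ _⟩

variable {𝕜 : Type*} [RCLike 𝕜] {A : Type*} [NonUnitalRing A] [Module 𝕜 A]
  [IsScalarTower 𝕜 A A] [SMulCommClass 𝕜 A A]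

lemma setPow_smul (c : 𝕜) (S : Set A) (n : ℕ) :
    setPow (c • S) n = c ^ (n + 1) • setPow S n := by
  induction n with
  | zero => simp [setPow]
  | succ n ih =>
    rw [setPow, ih, setPow]
    ext x
    constructor
    · rintro ⟨_, ⟨a, ha, rfl⟩, _, ⟨b, hb, rfl⟩, rfl⟩
      refine ⟨a * b, Set.mul_mem_mul ha hb, ?_⟩
      simp only [smul_mul_smul_comm, pow_succ]
    · rintro ⟨_, ⟨a, ha, b, hb, rfl⟩, rfl⟩
      refine ⟨_, ⟨a, ha, rfl⟩, _, ⟨b, hb, rfl⟩, ?_⟩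
      simp only [smul_mul_smul_comm, pow_succ]

variable [Bornology A]

lemma isBounded_setPowInfty_smul [BornologicalVectorSpace 𝕜 A] {S : Set A} {c : 𝕜} (hc : ‖c‖ ≤ 1)
    (hS : IsBounded (setPowInfty S)) : IsBounded (setPowInfty (c • S)) := by
  refine (BornologicalVectorSpace.isBounded_smul (𝕜 := 𝕜) 1 hS).subset
    (Set.iUnion_subset fun n => ?_)
  rw [setPow_smul]
  rintro _ ⟨x, hx, rfl⟩
  exact ⟨c ^ (n + 1), by rw [norm_pow]; exact pow_le_one₀ (norm_nonneg _) hc, x,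
    setPow_subset_setPowInfty S n hx, rfl⟩

lemma spectralRadius_le {S : Set A} {r : ℝ} (hr : 0 < r)
    (h : IsBounded (setPowInfty ((r : 𝕜)⁻¹ • S))) : spectralRadius 𝕜 S ≤ ENNReal.ofReal r :=
  sInf_le ⟨r, hr, h, rfl⟩

lemma exists_isBounded_setPowInfty {S : Set A} (h : spectralRadius 𝕜 S < ∞) :
    ∃ r : ℝ, 0 < r ∧ IsBounded (setPowInfty ((r : 𝕜)⁻¹ • S)) := by
  obtain ⟨_, ⟨r, hr, hb, -⟩, -⟩ := sInf_lt_iff.1 h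
  exact ⟨r, hr, hb⟩

lemma isBounded_setPowInfty_of_spectralRadius_lt [BornologicalVectorSpace 𝕜 A] {S : Set A} {r : ℝ}
    (hr : 0 < r) (h : spectralRadius 𝕜 S < ENNReal.ofReal r) :
    IsBounded (setPowInfty ((r : 𝕜)⁻¹ • S)) := by
  obtain ⟨_, ⟨s, hs, hb, rfl⟩, hsr⟩ := sInf_lt_iff.1 h
  have hsr' : s < r := (ENNReal.ofReal_lt_ofReal_iff hr).1 hsr
  have hs0 : (s : 𝕜) ≠ 0 := by exact_mod_cast hs.ne'
  have := isBounded_setPowInfty_smul (c := (r : 𝕜)⁻¹ * s) (by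
    rw [norm_mul, norm_inv, RCLike.norm_ofReal, RCLike.norm_ofReal, abs_of_pos hr, abs_of_pos hs,
      inv_mul_le_iff₀ hr, mul_one]
    exact hsr'.le) hb
  rwa [smul_smul, mul_assoc, mul_inv_cancel₀ hs0, mul_one] at this

end Powers

section Hull

variable (𝕜 : Type*) [RCLike 𝕜] {A : Type*} [NonUnitalRing A] [Module 𝕜 A]
  [IsScalarTower 𝕜 A A] [SMulCommClass 𝕜 A A] [Bornology A]

/-- A bornological substitute for the complete disked hull of `G`: all points that no bounded linear
endomorphism `Φ` and complete bounded disk `D` can distinguish from `G`, in the sense that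
`Φ x ∈ D` whenever `Φ '' G ⊆ D`. It contains all series `∑ cᵢ gᵢ` with `∑ |cᵢ| ≤ 1` and
`gᵢ ∈ G`. -/
def diskHull (G : Set A) : Set A :=
  {x | ∀ D : Set A, IsBounded D → IsCompleteDisk 𝕜 D → ∀ Φ : A →ₗ[𝕜] A, BoundedMap Φ →
    (∀ g ∈ G, Φ g ∈ D) → Φ x ∈ D}

variable {𝕜}

lemma boundedMap_mulLeft [BoundedMul A] (a : A) : BoundedMap (LinearMap.mulLeft 𝕜 a) := by
  intro S hS
  refine (BoundedMul.isBounded_mul (isBounded_singleton (x := a)) hS).subset ?_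
  rintro _ ⟨x, hx, rfl⟩
  exact Set.mul_mem_mul rfl hx

lemma boundedMap_mulRight [BoundedMul A] (a : A) : BoundedMap (LinearMap.mulRight 𝕜 a) := by
  intro S hS
  refine (BoundedMul.isBounded_mul hS (isBounded_singleton (x := a))).subset ?_
  rintro _ ⟨x, hx, rfl⟩
  exact Set.mul_mem_mul hx rfl

variable [CompleteConvexAlgebra 𝕜 A]

/-- Passing to disked hulls preserves joint boundedness of powers. -/
lemma isBounded_setPowInfty_diskHull {G : Set A} (hG : IsBounded (setPowInfty G)) :
    IsBounded (setPowInfty (diskHull 𝕜 G)) := by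
  have : BoundedMul A := Tensor.boundedMul_of_algebra 𝕜 A
  obtain ⟨D, hD, hDb, hDd⟩ := CompleteConvexSpace.exists_completeDisk (𝕜 := 𝕜) _ hG
  refine hDb.subset (Set.iUnion_subset fun n => ?_)
  -- The second half of the claim is what makes the induction work.
  suffices h : ∀ x ∈ setPow (diskHull 𝕜 G) n, x ∈ D ∧ ∀ g ∈ setPowInfty G, x * g ∈ D from
    fun x hx => (h x hx).1
  induction n with
  | zero =>
    intro x hx
    refine ⟨hx D hDb hDd LinearMap.id boundedMap_id fun g hg => hD (subset_setPowInfty G hg),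
      fun g hg => ?_⟩
    exact hx D hDb hDd (LinearMap.mulRight 𝕜 g) (boundedMap_mulRight g) fun g' hg' =>
      hD (mul_mem_setPowInfty (subset_setPowInfty G hg') hg)
  | succ n ih =>
    rintro _ ⟨x, hx, y, hy, rfl⟩
    refine ⟨hy D hDb hDd (LinearMap.mulLeft 𝕜 x) (boundedMap_mulLeft x) fun g hg =>
      (ih x hx).2 g (subset_setPowInfty G hg), fun g hg => ?_⟩
    have := hy D hDb hDd (LinearMap.mulLeft 𝕜 x ∘ₗ LinearMap.mulRight 𝕜 g)
      ((boundedMap_mulLeft x).comp (boundedMap_mulRight g)) fun g' hg' =>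
        (ih x hx).2 _ (mul_mem_setPowInfty (subset_setPowInfty G hg') hg)
    simpa [mul_assoc] using this

end Hull

/-! ### Bounded sets and powers in tensor products -/

namespace Tensor

section Spaces

variable {𝕜 : Type*} [RCLike 𝕜] {V W X : Type*} [AddCommGroup V] [Module 𝕜 V] [Bornology V]
  [AddCommGroup W] [Module 𝕜 W] [Bornology W] [AddCommGroup X] [Module 𝕜 X] [Bornology X]
  [CompleteConvexSpace 𝕜 X]

lemma hasBornSum_mk (g : FreeSpace 𝕜 V W) :
    HasBornSum 𝕜 (fun p => FreeSpace.coeL 𝕜 V W g p • tmul (𝕜 := 𝕜) p.1 p.2) (mk 𝕜 V W g) := by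
  have := (FreeSpace.hasBornSum_delta g).map (mk 𝕜 V W) boundedMap_mk
  simpa only [map_smul, mk_delta] using this

lemma hasBornSum_map_mk {Φ : Tensor 𝕜 V W →ₗ[𝕜] X} (hΦ : BoundedMap Φ) (g : FreeSpace 𝕜 V W) :
    HasBornSum 𝕜 (fun p => FreeSpace.coeL 𝕜 V W g p • Φ (tmul p.1 p.2)) (Φ (mk 𝕜 V W g)) := by
  have := (hasBornSum_mk g).map Φ hΦ
  simpa only [map_smul] using this

/-- A bounded linear map that sends `v ⊗ w` for `v ∈ S` and `w ∈ T` into a complete bounded disk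
`D` maps the ball of radius `r` in `ℓ¹(S × T)` into `r • D`, and the defining series converges in
`X_D`. -/
lemma map_mk_mem {Φ : Tensor 𝕜 V W →ₗ[𝕜] X} (hΦ : BoundedMap Φ) {S : Set V} {T : Set W}
    {D : Set X} (hDb : IsBounded D) (hD : IsCompleteDisk 𝕜 D)
    (h : ∀ v ∈ S, ∀ w ∈ T, Φ (tmul v w) ∈ D) {r : ℝ} {g : FreeSpace 𝕜 V W}
    (hg : g ∈ FreeSpace.ball S T r) : Φ (mk 𝕜 V W g) ∈ (r : 𝕜) • D ∧
      HasSumIn 𝕜 D (fun p => FreeSpace.coeL 𝕜 V W g p • Φ (tmul p.1 p.2)) (Φ (mk 𝕜 V W g)) := by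
  refine hD.hasSumIn_of_hasBornSum hDb g.summable (fun p hp => ?_)
    (by rw [← FreeSpace.norm_eq]; exact hg.2) (hasBornSum_map_mk hΦ g)
  by_cases hp' : p ∈ S ×ˢ T
  · exact h _ hp'.1 _ hp'.2
  · exact absurd (hg.1 p hp') hp

/-- The image of the unit ball of `ℓ¹(S × T)` is a complete disk up to the factor `2`. -/
lemma exists_disk_ball {S : Set V} {T : Set W} (hS : IsBounded S) (hT : IsBounded T) :
    ∃ D : Set (Tensor 𝕜 V W), IsBounded D ∧ IsCompleteDisk 𝕜 D ∧
      (∀ v ∈ S, ∀ w ∈ T, tmul v w ∈ D) ∧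
      ∀ r : ℝ, 0 ≤ r → (r : 𝕜) • D ⊆ mk 𝕜 V W '' FreeSpace.ball S T (r * 2) := by
  obtain ⟨D, hD, h1, h2⟩ := exists_completeDisk_of_isClosed_ker _ (isClosed_ker (𝕜 := 𝕜) hS hT)
  have h3 : D ⊆ mk 𝕜 V W '' FreeSpace.ball S T 2 := by
    intro x hx
    obtain ⟨e, he, rfl⟩ := h2 hx
    rw [mem_closedBall_zero_iff] at he
    exact ⟨FreeSpace.incl hS hT e, FreeSpace.incl_mem _ _ he, rfl⟩
  refine ⟨D, isBounded_iff.2 ⟨_, FreeSpace.isBounded_ball hS hT 2, h3⟩, hD, fun v hv w hw => ?_,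
    fun r hr => ?_⟩
  · obtain ⟨e, he, he'⟩ := FreeSpace.incl_surj hS hT
      (FreeSpace.delta_mem_ball (𝕜 := 𝕜) (p := (v, w)) hv hw)
    exact h1 ⟨e, by rwa [mem_closedBall_zero_iff], by rw [LinearMap.comp_apply, he']; rfl⟩
  · rintro _ ⟨x, hx, rfl⟩
    obtain ⟨g, hg, rfl⟩ := h3 hx
    refine ⟨(r : 𝕜) • g, ⟨?_, ?_⟩, by simp⟩
    · rw [map_smul]; exact Submodule.smul_mem _ _ hg.1
    · rw [map_smul, norm_smul, RCLike.norm_ofReal, abs_of_nonneg hr]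
      exact mul_le_mul_of_nonneg_left hg.2 hr

lemma boundedMap_tmul_left (v : V) : BoundedMap (tmul (𝕜 := 𝕜) (W := W) v) := by
  intro T hT
  refine (boundedBilin_tmul (𝕜 := 𝕜) {v} T isBounded_singleton hT).subset ?_
  rintro _ ⟨w, hw, rfl⟩
  exact ⟨v, rfl, w, hw, rfl⟩

lemma boundedMap_tmul_right (w : W) : BoundedMap ((tmul (𝕜 := 𝕜) (V := V)).flip w) := by
  intro S hS
  refine (boundedBilin_tmul (𝕜 := 𝕜) S {w} hS isBounded_singleton).subset ?_
  rintro _ ⟨v, hv, rfl⟩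
  exact ⟨v, hv, w, rfl, rfl⟩

end Spaces

section Algebras

variable {𝕜 : Type*} [RCLike 𝕜] {A C : Type*}
  [NonUnitalRing A] [Module 𝕜 A] [IsScalarTower 𝕜 A A] [SMulCommClass 𝕜 A A] [Bornology A]
  [CompleteConvexAlgebra 𝕜 A]
  [NonUnitalRing C] [Module 𝕜 C] [IsScalarTower 𝕜 C C] [SMulCommClass 𝕜 C C] [Bornology C]
  [CompleteConvexAlgebra 𝕜 C]

variable (𝕜) in
/-- The set of elementary tensors `a ⊗ c` with `a ∈ S` and `c ∈ T`. -/
def tmulSet (S : Set A) (T : Set C) : Set (Tensor 𝕜 A C) :=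
  Set.image2 (fun a c => tmul (𝕜 := 𝕜) a c) S T

lemma setPow_tmulSet_subset (S : Set A) (T : Set C) (n : ℕ) :
    setPow (tmulSet 𝕜 S T) n ⊆ tmulSet 𝕜 (setPow S n) (setPow T n) := by
  induction n with
  | zero => exact subset_rfl
  | succ n ih =>
    rintro _ ⟨x, hx, _, ⟨a, ha, c, hc, rfl⟩, rfl⟩
    obtain ⟨a', ha', c', hc', rfl⟩ := ih hx
    exact ⟨a' * a, Set.mul_mem_mul ha' ha, c' * c, Set.mul_mem_mul hc' hc,
      (tmul_mul_tmul _ _ _ _).symm⟩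

lemma isBounded_setPowInfty_tmulSet {S : Set A} {T : Set C} (hS : IsBounded (setPowInfty S))
    (hT : IsBounded (setPowInfty T)) : IsBounded (setPowInfty (tmulSet 𝕜 S T)) := by
  refine (boundedBilin_tmul (𝕜 := 𝕜) _ _ hS hT).subset (Set.iUnion_subset fun n => ?_)
  exact (setPow_tmulSet_subset S T n).trans
    (Set.image2_subset (setPow_subset_setPowInfty S n) (setPow_subset_setPowInfty T n))

/-- Series of elementary tensors lie in multiples of disked hulls; the scalars `α` and `γ` rescale
the two factors. -/
lemma smul_mem_diskHull {S : Set A} {T : Set C} {α γ K : ℝ} (hK : 0 < K)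
    {ι : Type*} {c : ι → 𝕜} (hc : Summable fun i => ‖c i‖) (hcK : ∑' i, ‖c i‖ ≤ K) {u : ι → A}
    {y : ι → C} (hu : ∀ i, c i ≠ 0 → u i ∈ S) (hy : ∀ i, c i ≠ 0 → y i ∈ T) {x : Tensor 𝕜 A C}
    (hx : HasBornSum 𝕜 (fun i => c i • tmul (𝕜 := 𝕜) (u i) (y i)) x) :
    ((K * α * γ : ℝ) : 𝕜)⁻¹ • x ∈
      diskHull 𝕜 (tmulSet 𝕜 ((α : 𝕜)⁻¹ • S) ((γ : 𝕜)⁻¹ • T)) := by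
  intro D hDb hD Φ hΦ h
  have hs := (hx.map Φ hΦ).smul ((α * γ : ℝ) : 𝕜)⁻¹
  have hmem : ∀ i, c i ≠ 0 → ((α * γ : ℝ) : 𝕜)⁻¹ • Φ (tmul (u i) (y i)) ∈ D := by
    intro i hi
    have := h _ ⟨_, ⟨u i, hu i hi, rfl⟩, _, ⟨y i, hy i hi, rfl⟩, rfl⟩
    simp only [map_smul, LinearMap.smul_apply, smul_smul] at this
    rwa [RCLike.ofReal_mul, mul_inv, mul_comm]
  simp only [map_smul] at hs
  simp only [smul_comm (((α * γ : ℝ) : 𝕜)⁻¹) (c _)] at hs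
  have h1 := (hD.hasSumIn_of_hasBornSum hDb hc hmem hcK hs).1
  have hK0 : (K : 𝕜) ≠ 0 := by exact_mod_cast hK.ne'
  have h2 := (Set.mem_smul_set_iff_inv_smul_mem₀ hK0 _ _).1 h1
  rwa [smul_smul, ← mul_inv, ← RCLike.ofReal_mul, ← mul_assoc, ← map_smul] at h2

/-- A bounded set lies in a multiple of the disked hull of some `S ⊗ T`, whose spectral radius is
finite because those of `S` and `T` are. -/
theorem isLocallyMultiplicative (hA : IsLocallyMultiplicative 𝕜 A)
    (hC : IsLocallyMultiplicative 𝕜 C) : IsLocallyMultiplicative 𝕜 (Tensor 𝕜 A C) := by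
  intro P hP
  obtain ⟨S, T, r, hS, hT, hr, hPb⟩ := isBounded_iff_ball.1 hP
  obtain ⟨α, hα, hSα⟩ := exists_isBounded_setPowInfty (hA S hS)
  obtain ⟨γ, hγ, hTγ⟩ := exists_isBounded_setPowInfty (hC T hT)
  have hK : 0 < (r + 1) * α * γ := by positivity
  have hsub : (((r + 1) * α * γ : ℝ) : 𝕜)⁻¹ • P ⊆
      diskHull 𝕜 (tmulSet 𝕜 ((α : 𝕜)⁻¹ • S) ((γ : 𝕜)⁻¹ • T)) := by
    rintro _ ⟨x, hx, rfl⟩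
    obtain ⟨g, hg, rfl⟩ := hPb hx
    have hsupp : ∀ p, FreeSpace.coeL 𝕜 A C g p ≠ 0 → p ∈ S ×ˢ T := fun p hp => by
      by_contra h
      exact hp (hg.1 p h)
    have hsum : ∑' p, ‖FreeSpace.coeL 𝕜 A C g p‖ ≤ r + 1 := by
      rw [← FreeSpace.norm_eq]
      exact hg.2.trans (by linarith)
    exact smul_mem_diskHull (by positivity) g.summable hsum (fun p hp => (hsupp p hp).1)
      (fun p hp => (hsupp p hp).2) (hasBornSum_mk g)
  have hbd := (isBounded_setPowInfty_diskHull (𝕜 := 𝕜) (A := Tensor 𝕜 A C)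
    (G := tmulSet 𝕜 ((α : 𝕜)⁻¹ • S) ((γ : 𝕜)⁻¹ • T)) (isBounded_setPowInfty_tmulSet (𝕜 := 𝕜) hSα hTγ)).subset (setPowInfty_mono hsub)
  exact (spectralRadius_le hK hbd).trans_lt ENNReal.ofReal_lt_top

lemma mul_mem_ball {S S' : Set A} {T T' : Set C} (hS : IsBounded S) (hS' : IsBounded S')
    (hT : IsBounded T) (hT' : IsBounded T') {r r' : ℝ} (hr : 0 ≤ r) (hr' : 0 ≤ r')
    {x y : Tensor 𝕜 A C} (hx : x ∈ mk 𝕜 A C '' FreeSpace.ball S T r)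
    (hy : y ∈ mk 𝕜 A C '' FreeSpace.ball S' T' r') :
    x * y ∈ mk 𝕜 A C '' FreeSpace.ball (S * S') (T * T') (r * r' * 2) := by
  have := boundedMul_of_algebra 𝕜 A
  have := boundedMul_of_algebra 𝕜 C
  obtain ⟨D, hDb, hD, hm, hsub⟩ := exists_disk_ball (𝕜 := 𝕜)
    (BoundedMul.isBounded_mul hS hS') (BoundedMul.isBounded_mul hT hT')
  obtain ⟨g, hg, rfl⟩ := hx
  obtain ⟨h, hh, rfl⟩ := hy
  have hr0 : (r' + 1 : ℝ) ≠ 0 := by positivity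
  apply hsub _ (mul_nonneg hr hr')
  have key : ∀ a ∈ S, ∀ c ∈ T, tmul a c * mk 𝕜 A C h ∈ (r' : 𝕜) • D := fun a ha c hc =>
    (map_mk_mem (boundedMap_leftMul' (tmul a c)) hDb hD (fun a' ha' c' hc' => by
      rw [leftMul'_apply, tmul_mul_tmul]
      exact hm _ (Set.mul_mem_mul ha ha') _ (Set.mul_mem_mul hc hc')) hh).1
  rcases hr'.eq_or_lt with rfl | hr'
  · -- for `r' = 0` the second factor is zero
    have h0 : h = 0 := FreeSpace.coeL_injective (by
      rw [map_zero]; exact norm_le_zero_iff.1 hh.2)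
    refine ⟨0, hD.zero_mem, ?_⟩
    simp [h0]
  have hr'0 : (r' : 𝕜) ≠ 0 := by exact_mod_cast hr'.ne'
  have h1 := (map_mk_mem (Φ := (r' : 𝕜)⁻¹ • rightMul (mk 𝕜 A C h))
    ((boundedMap_rightMul _).const_smul _) hDb hD (fun a ha c hc => by
      rw [LinearMap.smul_apply, ← mul_def]
      exact (Set.mem_smul_set_iff_inv_smul_mem₀ hr'0 _ _).1 (key a ha c hc)) hg).1
  rw [LinearMap.smul_apply, ← mul_def] at h1
  obtain ⟨d, hd, hd'⟩ := h1
  refine ⟨d, hd, ?_⟩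
  rw [eq_inv_smul_iff₀ hr'0] at hd'
  rw [← hd']
  simp only [smul_smul, RCLike.ofReal_mul]
  rw [mul_comm]

lemma exists_setPow_subset_ball {S : Set A} {T : Set C} (hS : IsBounded S) (hT : IsBounded T)
    {r : ℝ} (hr : 0 ≤ r) (n : ℕ) : ∃ R : ℝ, 0 ≤ R ∧
      setPow (mk 𝕜 A C '' FreeSpace.ball S T r) n ⊆
        mk 𝕜 A C '' FreeSpace.ball (setPow S n) (setPow T n) R := by
  have := boundedMul_of_algebra 𝕜 A
  have := boundedMul_of_algebra 𝕜 C
  induction n with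
  | zero => exact ⟨r, hr, subset_rfl⟩
  | succ n ih =>
    obtain ⟨R, hR, h⟩ := ih
    refine ⟨R * r * 2, by positivity, ?_⟩
    rintro _ ⟨x, hx, y, hy, rfl⟩
    exact mul_mem_ball (isBounded_setPow hS n) hS (isBounded_setPow hT n) hT hR hr (h hx) hy

/-- In `a ⊗ c`, scalars may be moved from the second factor to the first. -/
lemma ball_subset_ball_smul {S : Set A} {T : Set C} (hS : IsBounded S) (hT : IsBounded T)
    {r : ℝ} (hr : 0 ≤ r) {k : 𝕜} (hk : k ≠ 0) : mk 𝕜 A C '' FreeSpace.ball S T r ⊆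
      mk 𝕜 A C '' FreeSpace.ball (k • S) (k⁻¹ • T) (r * 2) := by
  obtain ⟨D, hDb, hD, hm, hsub⟩ := exists_disk_ball (𝕜 := 𝕜)
    (isBounded_smul_set hS k) (isBounded_smul_set hT k⁻¹)
  rintro _ ⟨g, hg, rfl⟩
  refine hsub r hr (map_mk_mem (Φ := LinearMap.id) boundedMap_id hDb hD (fun a ha c hc => ?_) hg).1
  have := hm (k • a) ⟨a, ha, rfl⟩ (k⁻¹ • c) ⟨c, hc, rfl⟩
  simpa [smul_smul, hk] using this

end Algebras

end Tensor

/-! ### Local density -/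

section Density

variable {𝕜 : Type*} [RCLike 𝕜] {V : Type*} [AddCommGroup V] [Module 𝕜 V] [Bornology V]
  [CompleteConvexSpace 𝕜 V]

lemma IsLocallyDense.exists_disk {X : Set V} (h : IsLocallyDense 𝕜 X) {S : Set V}
    (hS : IsBounded S) : ∃ D : Set V, IsBounded D ∧ IsCompleteDisk 𝕜 D ∧
      ∀ v ∈ S, ∀ ε : ℝ, 0 < ε → ∃ x ∈ X, x - v ∈ (ε : 𝕜) • D := by
  obtain ⟨S', hSS, hS'b, hS'⟩ := CompleteConvexSpace.exists_completeDisk (𝕜 := 𝕜) S hS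
  obtain ⟨T, hTb, -, hT⟩ := h S' hS'b hS'.toIsDisk.isCircled
  obtain ⟨D, hTD, hDb, hD⟩ := CompleteConvexSpace.exists_completeDisk (𝕜 := 𝕜) T hTb
  refine ⟨D, hDb, hD, fun v hv ε hε => ?_⟩
  obtain ⟨x, hx, -, -, δ, hδ, hlim, hxv⟩ := hT v (hSS hv)
  obtain ⟨n, hn⟩ := (hlim.eventually_lt_const hε).exists
  exact ⟨x n, (hx n).1, hD.smul_mono (hδ n).le hn.le (Set.smul_set_mono hTD (hxv n))⟩

lemma isLocallyDense_of_exists_disk {X : Set V}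
    (h : ∀ S : Set V, IsBounded S → ∃ D : Set V, IsBounded D ∧ IsCompleteDisk 𝕜 D ∧
      ∀ v ∈ S, ∀ ε : ℝ, 0 < ε → ∃ x ∈ X, x - v ∈ (ε : 𝕜) • D) : IsLocallyDense 𝕜 X := by
  intro S hS _
  obtain ⟨D₀, hD₀b, -, hD₀⟩ := h S hS
  obtain ⟨D, hD, hDb, hDd⟩ :=
    CompleteConvexSpace.exists_completeDisk (𝕜 := 𝕜) (S ∪ D₀) (hS.union hD₀b)
  -- The approximations lie in `S + D₀`, hence in `2 • D`.
  obtain ⟨T, hT, hTb, hTd⟩ := CompleteConvexSpace.exists_completeDisk (𝕜 := 𝕜)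
    (((2 : ℝ) : 𝕜) • D) (isBounded_smul_set hDb _)
  have hDT : D ⊆ T := fun x hx =>
    hT (hDd.smul_mono zero_le_one one_le_two (by simpa using hx))
  refine ⟨T, hTb, hTd.toIsDisk.isCircled, fun v hv => ?_⟩
  have hpos : ∀ n : ℕ, (0 : ℝ) < 1 / ((n : ℝ) + 1) := fun n => Nat.one_div_pos_of_nat
  choose x hxX hxv using fun n : ℕ => hD₀ v hv (1 / ((n : ℝ) + 1)) (hpos n)
  have hxv' : ∀ n : ℕ, x n - v ∈ ((1 / ((n : ℝ) + 1) : ℝ) : 𝕜) • D := fun n =>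
    Set.smul_set_mono (Set.subset_union_right.trans hD) (hxv n)
  have hvD : v ∈ D := hD (Or.inl hv)
  have hxT : ∀ n, x n ∈ T := by
    intro n
    apply hT
    have h1 : (1 : ℝ) / ((n : ℝ) + 1) ≤ 1 := by
      rw [div_le_one (by positivity)]
      linarith [n.cast_nonneg (α := ℝ)]
    have h2 := hDd.add_mem_smul zero_le_one zero_le_one
      (hDd.smul_mono (hpos n).le h1 (hxv' n)) (by simpa using hvD)
    rwa [sub_add_cancel, one_add_one_eq_two] at h2
  exact ⟨x, fun n => ⟨hxX n, hxT n⟩, hxT, hDT hvD, _, hpos,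
    tendsto_one_div_add_atTop_nhds_zero_nat, fun n => Set.smul_set_mono hDT (hxv' n)⟩

end Density

namespace Tensor

variable {𝕜 : Type*} [RCLike 𝕜] {A B C : Type*}
  [NonUnitalRing A] [Module 𝕜 A] [IsScalarTower 𝕜 A A] [SMulCommClass 𝕜 A A] [Bornology A]
  [CompleteConvexAlgebra 𝕜 A]
  [NonUnitalRing B] [Module 𝕜 B] [IsScalarTower 𝕜 B B] [SMulCommClass 𝕜 B B] [Bornology B]
  [CompleteConvexAlgebra 𝕜 B]
  [NonUnitalRing C] [Module 𝕜 C] [IsScalarTower 𝕜 C C] [SMulCommClass 𝕜 C C] [Bornology C]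
  [CompleteConvexAlgebra 𝕜 C]

lemma map_id_tmul (f : A →ₙₐ[𝕜] B) (hf : BoundedMap f) (a : A) (c : C) :
    map f (NonUnitalAlgHom.id 𝕜 C) hf boundedMap_id (tmul a c) = tmul (f a) c :=
  map_tmul f (NonUnitalAlgHom.id 𝕜 C) hf boundedMap_id a c

theorem isLocallyDense_range_map (f : A →ₙₐ[𝕜] B) (hf : BoundedMap f)
    (hd : IsLocallyDense 𝕜 (Set.range f)) :
    IsLocallyDense 𝕜 (Set.range (map f (NonUnitalAlgHom.id 𝕜 C) hf boundedMap_id)) := by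
  refine isLocallyDense_of_exists_disk fun P hP => ?_
  obtain ⟨S, T, r, hS, hT, hr, hPb⟩ := isBounded_iff_ball.1 hP
  obtain ⟨U, hUb, hU, hSU⟩ := hd.exists_disk hS
  obtain ⟨D, hD, hDb, hDd⟩ := CompleteConvexSpace.exists_completeDisk (𝕜 := 𝕜) _
    (boundedBilin_tmul (𝕜 := 𝕜) (S ∪ U) T (hS.union hUb) hT)
  have hST : ∀ b ∈ S, ∀ c ∈ T, (tmul b c : Tensor 𝕜 B C) ∈ D := fun b hb c hc =>
    hD ⟨b, Or.inl hb, c, hc, rfl⟩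
  have hUT : ∀ b ∈ U, ∀ c ∈ T, (tmul b c : Tensor 𝕜 B C) ∈ D := fun b hb c hc =>
    hD ⟨b, Or.inr hb, c, hc, rfl⟩
  refine ⟨D, hDb, hDd, fun v hv ε hε => ?_⟩
  obtain ⟨g, hg, rfl⟩ := hPb hv
  have hsupp : ∀ p, FreeSpace.coeL 𝕜 B C g p ≠ 0 → p ∈ S ×ˢ T := fun p hp => by
    by_contra h
    exact hp (hg.1 p h)
  obtain ⟨s, hs⟩ := (map_mk_mem (Φ := LinearMap.id) boundedMap_id hDb hDd hST hg).2
    (ε / 2) (half_pos hε)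
  replace hs := hs s subset_rfl
  -- Approximate the finitely many factors in `B` that occur in a partial sum.
  have hδ : 0 < ε / 2 / (r + 1) := by positivity
  have happ : ∀ p : B × C, ∃ a : A, p ∈ S ×ˢ T →
      f a - p.1 ∈ ((ε / 2 / (r + 1) : ℝ) : 𝕜) • U := by
    intro p
    by_cases hp : p ∈ S ×ˢ T
    · obtain ⟨_, ⟨a, rfl⟩, ha⟩ := hSU p.1 hp.1 _ hδ
      exact ⟨a, fun _ => ha⟩
    · exact ⟨0, fun h => absurd h hp⟩
  choose a ha using happ
  refine ⟨_, ⟨∑ p ∈ s, FreeSpace.coeL 𝕜 B C g p • tmul (a p) p.2, rfl⟩, ?_⟩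
  have hterm : ∀ p ∈ s, FreeSpace.coeL 𝕜 B C g p ≠ 0 →
      ((ε / 2 / (r + 1) : ℝ) : 𝕜)⁻¹ • (tmul (f (a p) - p.1) p.2 : Tensor 𝕜 B C) ∈ D := by
    intro p _ hp
    obtain ⟨u, hu, hu'⟩ := ha p (hsupp p hp)
    have hδ0 : ((ε / 2 / (r + 1) : ℝ) : 𝕜) ≠ 0 := by exact_mod_cast hδ.ne'
    rw [← hu']
    simp only [map_smul, LinearMap.smul_apply]
    rw [inv_smul_smul₀ hδ0]
    exact hUT u hu p.2 (hsupp p hp).2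
  have h1 := hDd.sum_mem_smul s (FreeSpace.coeL 𝕜 B C g) _ hterm
  have h2 := hDd.smul_mem_smul (s := ε / 2) (Finset.sum_nonneg fun _ _ => norm_nonneg _) h1
    ((ε / 2 / (r + 1) : ℝ) : 𝕜) (by
      rw [RCLike.norm_ofReal, abs_of_pos hδ, div_mul_eq_mul_div, div_le_iff₀ (by positivity)]
      have h3 := g.summable.sum_le_tsum s fun _ _ => norm_nonneg _
      rw [← FreeSpace.norm_eq] at h3
      have h4 := h3.trans hg.2
      exact mul_le_mul_of_nonneg_left (by linarith) (half_pos hε).le)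
  have h3 := hDd.add_mem_smul (half_pos hε).le (half_pos hε).le h2 hs
  rw [add_halves] at h3
  refine (congrArg (· ∈ (ε : 𝕜) • D) ?_).mp h3
  have hδ0 : ((ε / 2 / (r + 1) : ℝ) : 𝕜) ≠ 0 := by exact_mod_cast hδ.ne'
  simp only [Finset.smul_sum, map_sum, map_smul, map_id_tmul, LinearMap.id_apply, map_sub,
    LinearMap.sub_apply]
  simp only [smul_comm _ (FreeSpace.coeL 𝕜 B C g _), smul_inv_smul₀ hδ0, smul_sub,
    Finset.sum_sub_distrib]
  abel

end Tensor

/-! ### Nuclearity and the comparison of spectral radii -/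

section Nuclear

variable {𝕜 : Type*} [RCLike 𝕜]

/-- The nuclear representation of the inclusion `C_S → C_T`, with the functionals extended to all
of `C`. -/
lemma IsNuclear.exists_hasBornSum {C : Type*} [AddCommGroup C] [Module 𝕜 C] [Bornology C]
    [CompleteConvexSpace 𝕜 C] (hC : IsNuclear 𝕜 C) {S : Set C} (hSb : IsBounded S)
    (hS : IsCompleteDisk 𝕜 S) :
    ∃ T : Set C, IsBounded T ∧ IsCompleteDisk 𝕜 T ∧
      ∃ (c : ℕ → 𝕜) (φ : ℕ → (C →ₗ[𝕜] 𝕜)) (y : ℕ → C), (Summable fun n => ‖c n‖) ∧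
        (∀ n, ∀ x ∈ S, ‖φ n x‖ ≤ 1) ∧ (∀ n, y n ∈ T) ∧
        ∀ x ∈ S, HasBornSum 𝕜 (fun n => (c n * φ n x) • y n) x := by
  obtain ⟨T, -, hTb, hT, c, φ, y, hc, hφ, hy, hlim⟩ := hC S hSb hS
  choose φ' hφ' using fun n => LinearMap.exists_extend (φ n)
  have hφ'' : ∀ n x (hx : x ∈ S), φ' n x = φ n ⟨x, Submodule.subset_span hx⟩ := fun n x hx =>
    LinearMap.congr_fun (hφ' n) ⟨x, Submodule.subset_span hx⟩
  have hbd : ∀ n, ∀ x ∈ S, ‖φ' n x‖ ≤ 1 := fun n x hx => by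
    rw [hφ'' n x hx]; exact hφ n _ hx
  refine ⟨T, hTb, hT, c, φ', y, hc, hbd, hy, fun x hx => ?_⟩
  have hs : Summable fun n => ‖c n * φ' n x‖ := by
    refine Summable.of_nonneg_of_le (fun _ => norm_nonneg _) (fun n => ?_) hc
    rw [norm_mul]
    exact mul_le_of_le_one_right (norm_nonneg _) (hbd n x hx)
  obtain ⟨z, -, hz⟩ := hT.exists_hasSumIn _ hs y (fun n _ => hy n) le_rfl
  have hzx : z = x := hT.tendsto_unique hz.tendsto_range fun ε hε => by
    obtain ⟨N₀, hN⟩ := hlim ⟨x, Submodule.subset_span hx⟩ ε hε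
    refine ⟨N₀, fun N hN' => ?_⟩
    simp only [hφ'' _ x hx]
    exact hN N hN'
  exact hzx ▸ hz.hasBornSum hTb hT.toIsDisk

end Nuclear

namespace Tensor

variable {𝕜 : Type*} [RCLike 𝕜] {A B C : Type*}
  [NonUnitalRing A] [Module 𝕜 A] [IsScalarTower 𝕜 A A] [SMulCommClass 𝕜 A A] [Bornology A]
  [CompleteConvexAlgebra 𝕜 A]
  [NonUnitalRing B] [Module 𝕜 B] [IsScalarTower 𝕜 B B] [SMulCommClass 𝕜 B B] [Bornology B]
  [CompleteConvexAlgebra 𝕜 B]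
  [NonUnitalRing C] [Module 𝕜 C] [IsScalarTower 𝕜 C C] [SMulCommClass 𝕜 C C] [Bornology C]
  [CompleteConvexAlgebra 𝕜 C]

/-- Let `x` be in `A_S ⊗ C_T`, and let its image in `B ⊗ C` lie in the ball of radius `R` of
`B_U ⊗ C_T`. A nuclear representation of the identity on `T` writes `x` as a series
`∑ cₙ uₙ ⊗ yₙ`, where `uₙ` is the slice of `x` by `φₙ`. The point is that `f uₙ` is controlled by
the image of `x` alone: it is the slice by `φₙ` of that image, by `pair_eq_of_mk_eq`. -/
lemma exists_nuclear_series (f : A →ₙₐ[𝕜] B) (hf : BoundedMap f) {S : Set A} {T : Set C} {U : Set B}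
    {Y : Set C} (hSb : IsBounded S) (hS : IsCompleteDisk 𝕜 S) (hTb : IsBounded T)
    (hT : IsCompleteDisk 𝕜 T) (hUb : IsBounded U) (hU : IsCompleteDisk 𝕜 U) (hYb : IsBounded Y)
    {c : ℕ → 𝕜} {φ : ℕ → (C →ₗ[𝕜] 𝕜)} {y : ℕ → C} (hc : Summable fun n => ‖c n‖)
    (hφ : ∀ n, ∀ x ∈ T, ‖φ n x‖ ≤ 1) (hy : ∀ n, y n ∈ Y)
    (hTY : ∀ x ∈ T, HasBornSum 𝕜 (fun n => (c n * φ n x) • y n) x)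
    {r R : ℝ} {x : Tensor 𝕜 A C} (hx : x ∈ mk 𝕜 A C '' FreeSpace.ball S T r)
    (hfx : map f (NonUnitalAlgHom.id 𝕜 C) hf boundedMap_id x ∈
      mk 𝕜 B C '' FreeSpace.ball U T R) :
    ∃ u : ℕ → A, (∀ n, u n ∈ (r : 𝕜) • S) ∧ (∀ n, f (u n) ∈ (R : 𝕜) • U) ∧
      HasBornSum 𝕜 (fun n => c n • tmul (𝕜 := 𝕜) (u n) (y n)) x := by
  obtain ⟨g, hg, rfl⟩ := hx
  obtain ⟨h, hh, hfh⟩ := hfx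
  have hsupp : ∀ p, FreeSpace.coeL 𝕜 A C g p ≠ 0 → p ∈ S ×ˢ T := fun p hp => by
    by_contra h
    exact hp (hg.1 p h)
  choose u hu hus _ using fun n => FreeSpace.exists_slice_left hS (hφ n) hg
  refine ⟨u, hu, fun n => ?_, ?_⟩
  · obtain ⟨s, hs, -, hsψ⟩ := FreeSpace.exists_slice_left hU (hφ n) hh
    obtain ⟨S', hS', hS'b, hS'd⟩ := CompleteConvexSpace.exists_completeDisk (𝕜 := 𝕜)
      (f '' S ∪ U) ((hf S hSb).union hUb)
    have hfS : ∀ a ∈ S, f a ∈ S' := fun a ha => hS' (Or.inl ⟨a, ha, rfl⟩)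
    have hUS : U ⊆ S' := Set.subset_union_right.trans hS'
    -- `g'` is the image of `g` in the free space on `B × C`
    obtain ⟨g', hg', hsum, hpair⟩ := FreeSpace.exists_family_sum (𝕜 := 𝕜) hS'b hTb g.summable
      (v := fun p => f p.1) (w := fun p => p.2) (fun p hp => hfS _ (hsupp p hp).1)
      (fun p hp => (hsupp p hp).2)
    have hmk : mk 𝕜 B C g' = mk 𝕜 B C h := by
      rw [hfh]
      refine hsum.unique (𝕜 := 𝕜) ?_
      have := hasBornSum_map_mk
        (Φ := (map f (NonUnitalAlgHom.id 𝕜 C) hf boundedMap_id : Tensor 𝕜 A C →ₗ[𝕜] Tensor 𝕜 B C))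
        (boundedMap_map f (NonUnitalAlgHom.id 𝕜 C) hf boundedMap_id) g
      refine (congrArg (fun F => HasBornSum 𝕜 F _) (funext fun p => ?_)).mp this
      congr 1
      exact map_id_tmul f hf p.1 p.2
    have hh' := suppIn_mono hUS subset_rfl hh.1
    suffices hus' : f (u n) = s by rwa [hus']
    by_contra hne
    have hspan : f (u n) - s ∈ Submodule.span 𝕜 S' := by
      refine Submodule.sub_mem _ ?_ (mem_span_of_mem_smul (Set.smul_set_mono hUS hs))
      obtain ⟨d, hd, hd'⟩ := hu n
      rw [← hd']
      simp only [map_smul]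
      exact Submodule.smul_mem _ _ (Submodule.subset_span (hfS d hd))
    obtain ⟨ψ, hψ, hψ0⟩ := hS'd.exists_functional hspan (sub_ne_zero.2 hne)
    apply hψ0
    rw [map_sub, sub_eq_zero, hsψ ψ fun v hv => hψ v (hUS hv),
      ← FreeSpace.pair_eq_of_mk_eq hS'b hTb hS'd hT hg' hh' hmk hψ (hφ n)]
    have h1 := (hus n).hasSum_functional (ψ := ψ ∘ₗ (f : A →ₗ[𝕜] B)) fun a ha => hψ _ (hfS a ha)
    refine h1.unique ?_
    refine (congrArg (fun F => HasSum F _) (funext fun p => ?_)).mp (hpair ψ (φ n) hψ (hφ n))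
    simp only [map_smul, smul_eq_mul, LinearMap.comp_apply]
    change _ = _ * ψ (f p.1)
    ring
  · obtain ⟨D, hD, hDb, hDd⟩ := CompleteConvexSpace.exists_completeDisk (𝕜 := 𝕜) _
      (boundedBilin_tmul (𝕜 := 𝕜) S Y hSb hYb)
    have hle : ∀ q : (A × C) × ℕ, ‖FreeSpace.coeL 𝕜 A C g q.1 * (c q.2 * φ q.2 q.1.2)‖ ≤
        ‖FreeSpace.coeL 𝕜 A C g q.1‖ * ‖c q.2‖ := by
      intro q
      by_cases hq : q.1 ∈ S ×ˢ T
      · rw [norm_mul, norm_mul]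
        exact mul_le_mul_of_nonneg_left
          (mul_le_of_le_one_right (norm_nonneg _) (hφ _ _ hq.2)) (norm_nonneg _)
      · simp [hg.1 q.1 hq]
    have hsum2 : Summable fun q : (A × C) × ℕ => ‖FreeSpace.coeL 𝕜 A C g q.1‖ * ‖c q.2‖ :=
      g.summable.mul_of_nonneg hc (fun _ => norm_nonneg _) fun _ => norm_nonneg _
    refine hDd.hasBornSum_comm hDb
      (c := fun q : (A × C) × ℕ => FreeSpace.coeL 𝕜 A C g q.1 * (c q.2 * φ q.2 q.1.2))
      (f := fun q => tmul (𝕜 := 𝕜) q.1.1 (y q.2))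
      (Summable.of_nonneg_of_le (fun _ => norm_nonneg _) hle hsum2) (fun q hq => ?_)
      (fun p => ?_) (fun n => ?_) (hasBornSum_mk g)
    · exact hD ⟨_, (hsupp q.1 (left_ne_zero_of_mul hq)).1, _, hy _, rfl⟩
    · by_cases hp : p ∈ S ×ˢ T
      · have := ((hTY p.2 hp.2).map (tmul (𝕜 := 𝕜) p.1) (boundedMap_tmul_left p.1)).smul
          (FreeSpace.coeL 𝕜 A C g p)
        simpa only [map_smul, smul_smul] using this
      · have := ((hTY 0 hT.zero_mem).map (tmul (𝕜 := 𝕜) p.1) (boundedMap_tmul_left p.1)).smul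
          (FreeSpace.coeL 𝕜 A C g p)
        simpa [hg.1 p hp] using this
    · have := (((hus n).hasBornSum hSb hS.toIsDisk).map _
        (boundedMap_tmul_right (𝕜 := 𝕜) (V := A) (y n))).smul (c n)
      refine (congrArg (fun F => HasBornSum 𝕜 F _) (funext fun p => ?_)).mp this
      simp only [map_smul, smul_smul, LinearMap.flip_apply]
      congr 1
      ring

/-- If the powers of the image of `S` in `B ⊗ C` are jointly bounded, then the spectral radius of
every power of `S` is at most a constant that does not depend on the exponent. -/
lemma exists_uniform_bound (hB : IsLocallyMultiplicative 𝕜 B) (hC : IsLocallyMultiplicative 𝕜 C)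
    (hCnuc : IsNuclear 𝕜 C) (f : A →ₙₐ[𝕜] B) (hf : IsIsoradial f) {S : Set (Tensor 𝕜 A C)}
    (hS : IsBounded S) (hfS : IsBounded (setPowInfty
      (map f (NonUnitalAlgHom.id 𝕜 C) hf.bounded boundedMap_id '' S))) :
    ∃ L : ℝ, 0 < L ∧ ∀ k, IsBounded (setPowInfty ((L : 𝕜)⁻¹ • setPow S k)) := by
  have := boundedMul_of_algebra 𝕜 A
  have := boundedMul_of_algebra 𝕜 C
  obtain ⟨S₁, T₁, r, hS₁, hT₁, hr, hSb⟩ := isBounded_iff_ball.1 hS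
  obtain ⟨τ, hτ, hQ⟩ := exists_isBounded_setPowInfty (hC T₁ hT₁)
  have hτ0 : (τ : 𝕜) ≠ 0 := by exact_mod_cast hτ.ne'
  replace hSb := hSb.trans (ball_subset_ball_smul hS₁ hT₁ hr hτ0)
  replace hS₁ := isBounded_smul_set hS₁ (τ : 𝕜)
  replace hT₁ := isBounded_smul_set hT₁ (τ : 𝕜)⁻¹
  set S₂ := (τ : 𝕜) • S₁
  set T₂ := (τ : 𝕜)⁻¹ • T₁
  obtain ⟨U₀, T₀, R, hU₀, hT₀, hR, hfSb⟩ := isBounded_iff_ball.1 hfS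
  obtain ⟨T, hT, hTb, hTd⟩ := CompleteConvexSpace.exists_completeDisk (𝕜 := 𝕜) _ (hQ.union hT₀)
  obtain ⟨U, hU, hUb, hUd⟩ := CompleteConvexSpace.exists_completeDisk (𝕜 := 𝕜) _ hU₀
  obtain ⟨Y, hYb, hYd, c, φ, y, hc, hφ, hy, hTY⟩ := hCnuc.exists_hasBornSum hTb hTd
  obtain ⟨β, hβ, hUβ⟩ := exists_isBounded_setPowInfty
    (hB _ (isBounded_smul_set hUb ((R + 1 : ℝ) : 𝕜)))
  obtain ⟨γ, hγ, hYγ⟩ := exists_isBounded_setPowInfty (hC Y hYb)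
  have hK0 : (0 : ℝ) ≤ ∑' n, ‖c n‖ := tsum_nonneg fun _ => norm_nonneg _
  refine ⟨(∑' n, ‖c n‖ + 1) * (2 * β) * γ, by positivity, fun k => ?_⟩
  obtain ⟨R', hR', hpow⟩ := exists_setPow_subset_ball (𝕜 := 𝕜) hS₁ hT₁ (r := r * 2)
    (by positivity) k
  obtain ⟨S₃, hS₃, hS₃b, hS₃d⟩ := CompleteConvexSpace.exists_completeDisk (𝕜 := 𝕜) _
    (isBounded_setPow hS₁ k)
  -- the possible slices of elements of `S ^ (k + 1)`
  set V : Set A := {a | a ∈ (R' : 𝕜) • S₃ ∧ f a ∈ (R : 𝕜) • U}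
  have hVb : IsBounded V := (isBounded_smul_set hS₃b (R' : 𝕜)).subset fun a ha => ha.1
  have hfV : f '' V ⊆ ((R + 1 : ℝ) : 𝕜) • U := by
    rintro _ ⟨a, ha, rfl⟩
    exact hUd.smul_mono hR (by linarith) ha.2
  have hVρ : spectralRadius 𝕜 V < ENNReal.ofReal (2 * β) := by
    rw [hf.spectralRadius_eq V hVb]
    refine (spectralRadius_le hβ (hUβ.subset (setPowInfty_mono (Set.smul_set_mono hfV)))).trans_lt
      ((ENNReal.ofReal_lt_ofReal_iff (by positivity)).2 (by linarith))
  have hVα := isBounded_setPowInfty_of_spectralRadius_lt (𝕜 := 𝕜) (r := 2 * β) (by positivity) hVρ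
  have hsub : (((∑' n, ‖c n‖ + 1) * (2 * β) * γ : ℝ) : 𝕜)⁻¹ • setPow S k ⊆
      diskHull 𝕜 (tmulSet 𝕜 (((2 * β : ℝ) : 𝕜)⁻¹ • V) ((γ : 𝕜)⁻¹ • Y)) := by
    rintro _ ⟨x, hx, rfl⟩
    have h1 : x ∈ mk 𝕜 A C '' FreeSpace.ball S₃ T R' := by
      refine Set.image_mono (FreeSpace.ball_mono hS₃ ?_ le_rfl) (hpow (setPow_mono hSb k hx))
      exact (setPow_subset_setPowInfty T₂ k).trans (Set.subset_union_left.trans hT)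
    have h2 : map f (NonUnitalAlgHom.id 𝕜 C) hf.bounded boundedMap_id x ∈
        mk 𝕜 B C '' FreeSpace.ball U T R := by
      refine Set.image_mono (FreeSpace.ball_mono hU (Set.subset_union_right.trans hT) le_rfl)
        (hfSb (setPow_subset_setPowInfty _ k ?_))
      exact image_setPow (map f (NonUnitalAlgHom.id 𝕜 C) hf.bounded boundedMap_id) S k ▸
        Set.mem_image_of_mem _ hx
    obtain ⟨u, hu, hfu, hxu⟩ := exists_nuclear_series f hf.bounded hS₃b hS₃d hTb hTd hUb hUd hYb hc
      hφ hy hTY h1 h2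
    have huV : ∀ n, u n ∈ V := fun n => ⟨hu n, hfu n⟩
    exact smul_mem_diskHull (by positivity) hc (by linarith) (fun n _ => huV n)
      (fun n _ => hy n) hxu
  exact (isBounded_setPowInfty_diskHull (𝕜 := 𝕜) (A := Tensor 𝕜 A C)
    (G := tmulSet 𝕜 (((2 * β : ℝ) : 𝕜)⁻¹ • V) ((γ : 𝕜)⁻¹ • Y))
    (isBounded_setPowInfty_tmulSet (𝕜 := 𝕜) hVα hYγ)).subset (setPowInfty_mono hsub)

/-- The constant of `exists_uniform_bound` disappears when passing to large powers. -/
lemma isBounded_setPowInfty_of_map (hB : IsLocallyMultiplicative 𝕜 B)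
    (hC : IsLocallyMultiplicative 𝕜 C) (hCnuc : IsNuclear 𝕜 C) (f : A →ₙₐ[𝕜] B)
    (hf : IsIsoradial f) {S : Set (Tensor 𝕜 A C)} (hS : IsBounded S)
    (hfS : IsBounded (setPowInfty
      (map f (NonUnitalAlgHom.id 𝕜 C) hf.bounded boundedMap_id '' S))) {t : ℝ} (ht : 1 < t) :
    IsBounded (setPowInfty ((t : 𝕜)⁻¹ • S)) := by
  obtain ⟨L, hL, hbd⟩ := exists_uniform_bound hB hC hCnuc f hf hS hfS
  obtain ⟨k, hk⟩ := pow_unbounded_of_one_lt L ht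
  have ht0 : 0 < t := by linarith
  have hL0 : (L : 𝕜) ≠ 0 := by exact_mod_cast hL.ne'
  refine isBounded_setPowInfty_of_setPow (A := Tensor 𝕜 A C) (isBounded_smul_set hS _) k ?_
  have h1 := isBounded_setPowInfty_smul (𝕜 := 𝕜) (A := Tensor 𝕜 A C)
    (c := ((t : 𝕜)⁻¹) ^ (k + 1) * L) (by
      rw [norm_mul, norm_pow, norm_inv, RCLike.norm_ofReal, RCLike.norm_ofReal, abs_of_pos ht0,
        abs_of_pos hL, inv_pow, inv_mul_le_iff₀ (by positivity), mul_one]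
      exact hk.le.trans (pow_le_pow_right₀ ht.le k.le_succ)) (hbd k)
  rw [smul_smul, mul_assoc, mul_inv_cancel₀ hL0, mul_one] at h1
  rwa [setPow_smul]

theorem spectralRadius_map (hB : IsLocallyMultiplicative 𝕜 B)
    (hC : IsLocallyMultiplicative 𝕜 C) (hCnuc : IsNuclear 𝕜 C) (f : A →ₙₐ[𝕜] B)
    (hf : IsIsoradial f) {S : Set (Tensor 𝕜 A C)} (hS : IsBounded S) :
    spectralRadius 𝕜 S =
      spectralRadius 𝕜 (map f (NonUnitalAlgHom.id 𝕜 C) hf.bounded boundedMap_id '' S) := by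
  set F := map f (NonUnitalAlgHom.id 𝕜 C) hf.bounded boundedMap_id with hF
  have hsmul : ∀ r : 𝕜, F '' (r • S) = r • (F '' S) := fun r => Set.image_smul_comm F r S
    fun x => map_smul F r x
  apply le_antisymm
  · refine le_sInf ?_
    rintro _ ⟨r, hr, hb, rfl⟩
    rw [← hsmul] at hb
    -- the spectral radius of `S` is at most `t * r` for every `t > 1`
    refine ENNReal.le_of_forall_pos_le_add fun ε hε _ => ?_
    have hε' : (0 : ℝ) < ε := hε
    have ht : 1 < 1 + (ε : ℝ) / r := lt_add_of_pos_right _ (by positivity)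
    have h1 := isBounded_setPowInfty_of_map hB hC hCnuc f hf (isBounded_smul_set hS _) hb ht
    rw [smul_smul, ← mul_inv, ← RCLike.ofReal_mul] at h1
    have h2 := spectralRadius_le (by positivity) h1
    refine h2.trans_eq ?_
    rw [add_mul, one_mul, div_mul_cancel₀ _ hr.ne', ENNReal.ofReal_add hr.le hε'.le,
      ENNReal.ofReal_coe_nnreal]
  · refine le_sInf ?_
    rintro _ ⟨r, hr, hb, rfl⟩
    refine spectralRadius_le hr ?_
    rw [← hsmul]
    have h1 := boundedMap_map f (NonUnitalAlgHom.id 𝕜 C) hf.bounded boundedMap_id _ hb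
    rwa [← hF, image_setPowInfty] at h1

end Tensor

end

end BornAlg

theorem mainTheorem10 {𝕜 : Type*} [RCLike 𝕜] {A B C : Type*}
    [NonUnitalRing A] [Module 𝕜 A] [IsScalarTower 𝕜 A A] [SMulCommClass 𝕜 A A] [Bornology A]
    [BornAlg.CompleteConvexAlgebra 𝕜 A]
    [NonUnitalRing B] [Module 𝕜 B] [IsScalarTower 𝕜 B B] [SMulCommClass 𝕜 B B] [Bornology B]
    [BornAlg.CompleteConvexAlgebra 𝕜 B]
    [NonUnitalRing C] [Module 𝕜 C] [IsScalarTower 𝕜 C C] [SMulCommClass 𝕜 C C] [Bornology C]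
    [BornAlg.CompleteConvexAlgebra 𝕜 C]
    (hA : BornAlg.IsLocallyMultiplicative 𝕜 A) (hB : BornAlg.IsLocallyMultiplicative 𝕜 B)
    (hC : BornAlg.IsLocallyMultiplicative 𝕜 C) (hCnuc : BornAlg.IsNuclear 𝕜 C)
    (f : A →ₙₐ[𝕜] B) (hf : BornAlg.IsIsoradial f) :
    BornAlg.IsLocallyMultiplicative 𝕜 (BornAlg.Tensor 𝕜 A C) ∧
    BornAlg.IsLocallyMultiplicative 𝕜 (BornAlg.Tensor 𝕜 B C) ∧
    BornAlg.IsIsoradial (BornAlg.Tensor.map f (NonUnitalAlgHom.id 𝕜 C) hf.bounded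
      BornAlg.boundedMap_id) :=
  ⟨BornAlg.Tensor.isLocallyMultiplicative hA hC, BornAlg.Tensor.isLocallyMultiplicative hB hC,
    BornAlg.Tensor.boundedMap_map _ _ _ _,
    BornAlg.Tensor.isLocallyDense_range_map f hf.bounded hf.locallyDense,
    fun _ hS => BornAlg.Tensor.spectralRadius_map hB hC hCnuc f hf hS⟩
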